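/- Let $d\ge 2$ and $N\ge 1$ be integers, let $U\subseteq\mathbb{R}^d$ be open, and let $\Delta_U$ be an arbitrary non-negative self-adjoint extension, in the Hilbert space $L^2(U;\mathbb{C}^N)$, of the Laplacian $-\left(\frac{\partial^2}{\partial x_1^2}+\cdots+\frac{\partial^2}{\partial x_d^2}\right)$ acting component-wise on $C_c^\infty(U;\mathbb{C}^N)$. Let $m\in\mathbb{N}$ with $m>\frac d2$ and let $t>0$. An integral kernel of a bounded operator $T$ on $L^2(U;\mathbb{C}^N)$ is an $N\times N$-matrix-valued function $\mathbf{k}$, continuous on $U\times U$, such that $\langle\varphi,T\psi\rangle=\int_U\int_U\langle\varphi(x),\mathbf{k}(x,y)\psi(y)\rangle\,dy\,dx$ for all $\varphi,\psi\in C_c^\infty(U;\mathbb{C}^N)$; it is unique if it exists. The operators $e^{-t\Delta_U}$ and $(1+\Delta_U)^{-m}$, defined by the functional calculus of self-adjoint operators, have such kernels, denoted by $\mathbf{K}_U(x,y;t)$ and $\mathbf{G}_U^{(m)}(x,y)$. Let $$\mathbf{K}_0(x,y;t)=(4\pi t)^{-d/2}\exp\left(-\frac{|x-y|^2}{4t}\right)\mathbf{1}$$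 be the heat kernel of $\mathbb{R}^d$, where $\mathbf 1$ is the $N\times N$ identity matrix. For $x\in U$ let $\rho(x)\in(0,\infty]$ be the distance from $x$ to the boundary of $U$ ($\rho=\infty$ if the boundary is empty, that is, if $U=\mathbb{R}^d$). For $0<R\le\infty$ let $$J_m(R;t)=\inf_{\psi}\int_{\mathbb{R}}\left|\left(1-\frac{d^2}{ds^2}\right)^m\left(\psi(s)e^{-\frac{s^2}{4t}}\right)\right|ds,$$ the infimum being over all real-valued $\psi\in C^{2m}(\mathbb{R})$ with $\operatorname{supp}(1-\psi)\subset(-R,R)$. Then for all $x,y\in U$, with $\|\cdot\|$ the operator norm of matrices acting on the Hilbert space $\mathbb{C}^N$, $$\|\mathbf{K}_U(x,y;t)-\mathbf{K}_0(x,y;t)\|\le\left(\left(\|\mathbf{G}_U^{(m)}(x,x)\|\,\|\mathbf{G}_U^{(m)}(y,y)\|\right)^{\frac12}+\frac{\Gamma(m-\frac d2)}{(4\pi)^{\frac d2}(m-1)!}\right)\frac{J_m(\rho(x)+\rho(y);t)}{2\sqrt{\pi t}}.$$ -/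

import Mathlib

open MeasureTheory Set
open scoped ENNReal ContDiff

noncomputable section

namespace NotFeeling

section AbstractOperators

variable {H : Type*} [NormedAddCommGroup H] [InnerProductSpace ℂ H] [CompleteSpace H]

/-- A (densely defined, possibly unbounded) non-negative self-adjoint operator. -/
def IsNonnegSelfAdjoint (A : H →ₗ.[ℂ] H) : Prop :=
  IsSelfAdjoint A ∧ ∀ u : A.domain, 0 ≤ (inner ℂ (u : H) (A u)).re

/-- `B` is the bounded everywhere defined inverse of `1 + A`. -/
def IsInverseOneAdd (A : H →ₗ.[ℂ] H) (B : H →L[ℂ] H) : Prop :=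
  (∀ f : H, ∃ h : B f ∈ A.domain, B f + A ⟨B f, h⟩ = f) ∧
    ∀ u : A.domain, B ((u : H) + A u) = u

theorem norm_le_norm_add {A : H →ₗ.[ℂ] H} (hA : IsNonnegSelfAdjoint A) (u : A.domain) :
    ‖(u : H)‖ ≤ ‖(u : H) + A u‖ := by
  have h1 := hA.2 u
  have h2 : ‖(u : H)‖ ^ 2 ≤ ‖(u : H)‖ * ‖(u : H) + A u‖ := by
    calc ‖(u : H)‖ ^ 2 ≤ ‖(u : H)‖ ^ 2 + (inner ℂ (u : H) (A u)).re := by linarith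
      _ = (inner ℂ (u : H) ((u : H) + A u)).re := by
        rw [inner_add_right, Complex.add_re, inner_self_eq_norm_sq_to_K]
        norm_cast
      _ ≤ ‖inner ℂ (u : H) ((u : H) + A u)‖ := Complex.re_le_norm _
      _ ≤ _ := norm_inner_le_norm _ _
  by_contra hlt
  push Not at hlt
  nlinarith [norm_nonneg ((u : H) + A u)]

/-- For a non-negative self-adjoint operator `A` the inverse of `1 + A` exists. -/
theorem exists_isInverseOneAdd {A : H →ₗ.[ℂ] H} (hA : IsNonnegSelfAdjoint A) :
    ∃ B : H →L[ℂ] H, IsInverseOneAdd A B := by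
  let M : A.domain →ₗ[ℂ] H := A.domain.subtype + A.toFun
  have hM : ∀ u, M u = (u : H) + A u := fun u => rfl
  have hinj : Function.Injective M := by
    rw [← LinearMap.ker_eq_bot, LinearMap.ker_eq_bot']
    intro u hu
    have := norm_le_norm_add hA u
    rw [← hM, hu, norm_zero, norm_le_zero_iff] at this
    exact Subtype.ext this
  have hclosed : IsClosed (LinearMap.range M : Set H) := by
    have hg : IsClosed (A.graph : Set (H × H)) := hA.1.isClosed
    have : CompleteSpace A.graph := hg.completeSpace_coe
    let L : A.graph →L[ℂ] H :=
      (ContinuousLinearMap.fst ℂ H H + ContinuousLinearMap.snd ℂ H H).comp A.graph.subtypeL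
    have hL : AntilipschitzWith 2 L := by
      refine L.antilipschitz_of_bound fun p => ?_
      obtain ⟨⟨a, b⟩, hp⟩ := p
      obtain ⟨u, rfl, rfl⟩ := (A.mem_graph_iff).1 hp
      have h1 := norm_le_norm_add hA u
      have h2 : ‖A u‖ ≤ ‖(u : H) + A u‖ + ‖(u : H)‖ := by
        have := norm_sub_le ((u : H) + A u) (u : H)
        rwa [add_sub_cancel_left] at this
      change max ‖(u : H)‖ ‖A u‖ ≤ 2 * ‖(u : H) + A u‖
      exact max_le (by linarith [norm_nonneg ((u : H) + A u)]) (by linarith)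
    have hr : (LinearMap.range M : Set H) = Set.range L := by
      ext f
      constructor
      · rintro ⟨u, rfl⟩
        exact ⟨⟨((u : H), A u), A.mem_graph u⟩, rfl⟩
      · rintro ⟨⟨⟨a, b⟩, hp⟩, rfl⟩
        obtain ⟨u, rfl, rfl⟩ := (A.mem_graph_iff).1 hp
        exact ⟨u, rfl⟩
    rw [hr]
    exact hL.isClosed_range L.uniformContinuous
  have hperp : (LinearMap.range M)ᗮ = ⊥ := by
    rw [Submodule.eq_bot_iff]
    intro w hw
    rw [Submodule.mem_orthogonal'] at hw
    have hw' : ∀ u : A.domain, inner ℂ (-w) (u : H) = inner ℂ w (A u) := by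
      intro u
      have := hw (M u) ⟨u, rfl⟩
      rw [hM, inner_add_right] at this
      rw [inner_neg_left]
      linear_combination -this
    have hmem := LinearPMap.mem_adjoint_domain_of_exists (T := A) w ⟨-w, hw'⟩
    have hval := LinearPMap.adjoint_apply_eq hA.1.dense_domain ⟨w, hmem⟩ hw'
    have hgr : (w, -w) ∈ A.adjoint.graph := by
      have := A.adjoint.mem_graph ⟨w, hmem⟩
      rwa [hval] at this
    rw [LinearPMap.isSelfAdjoint_def.1 hA.1] at hgr
    obtain ⟨u, hu1, hu2⟩ := (A.mem_graph_iff).1 hgr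
    have h0 := norm_le_norm_add hA u
    have hu1' : (u : H) = w := hu1
    have hu2' : A u = -w := hu2
    rw [hu1', hu2', add_neg_cancel, norm_zero, norm_le_zero_iff] at h0
    exact h0
  have hsurj : Function.Surjective M := by
    have : CompleteSpace (LinearMap.range M) := hclosed.completeSpace_coe
    rw [← LinearMap.range_eq_top]
    exact Submodule.orthogonal_eq_bot_iff.1 hperp
  let e : A.domain ≃ₗ[ℂ] H := LinearEquiv.ofBijective M ⟨hinj, hsurj⟩
  have he : ∀ u, e u = (u : H) + A u := fun u => rfl
  let B : H →L[ℂ] H := (A.domain.subtype ∘ₗ e.symm.toLinearMap).mkContinuous 1 (by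
    intro f
    have := norm_le_norm_add hA (e.symm f)
    rw [← he, e.apply_symm_apply] at this
    simpa using this)
  have hB : ∀ f, B f = (e.symm f : H) := fun f => rfl
  refine ⟨B, fun f => ?_, fun u => ?_⟩
  · exact ⟨(e.symm f).2, (he (e.symm f)).symm.trans (e.apply_symm_apply f)⟩
  · rw [hB, ← he, e.symm_apply_apply]

open Classical in
/-- The bounded operator `(1 + A)⁻¹`, for a non-negative self-adjoint operator `A`. -/
def invOneAdd (A : H →ₗ.[ℂ] H) : H →L[ℂ] H :=
  if h : ∃ B : H →L[ℂ] H, IsInverseOneAdd A B then h.choose else 0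

theorem invOneAdd_spec {A : H →ₗ.[ℂ] H} (hA : IsNonnegSelfAdjoint A) :
    IsInverseOneAdd A (invOneAdd A) := by
  rw [invOneAdd, dif_pos (exists_isInverseOneAdd hA)]
  exact (exists_isInverseOneAdd hA).choose_spec

/-- `(1 + A)⁻¹` is a bounded self-adjoint operator. -/
theorem isSelfAdjoint_invOneAdd {A : H →ₗ.[ℂ] H} (hA : IsNonnegSelfAdjoint A) :
    IsSelfAdjoint (invOneAdd A) := by
  rw [ContinuousLinearMap.isSelfAdjoint_iff_isSymmetric]
  intro f g
  obtain ⟨hf, hf'⟩ := (invOneAdd_spec hA).1 f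
  obtain ⟨hg, hg'⟩ := (invOneAdd_spec hA).1 g
  have hsymm : A.IsFormalAdjoint A := by
    have := LinearPMap.adjoint_isFormalAdjoint hA.1.dense_domain
    rwa [LinearPMap.isSelfAdjoint_def.1 hA.1] at this
  have h := hsymm ⟨_, hf⟩ ⟨_, hg⟩
  change inner ℂ (invOneAdd A f) g = inner ℂ f (invOneAdd A g)
  conv_lhs => rw [← hg']
  conv_rhs => rw [← hf']
  rw [inner_add_left, inner_add_right, h]

/-- The functional calculus `f(A)` of a non-negative self-adjoint operator `A`, for `f` continuous
on `[0, ∞)` and vanishing at infinity. The spectrum of the bounded self-adjoint operator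
`B = (1 + A)⁻¹` lies in `[0, 1]`, the point `b = (1 + λ)⁻¹` corresponding to the point
`λ = b⁻¹ - 1` of the spectrum of `A` (and `b = 0` to `λ = ∞`), so `f(A)` is the continuous
functional calculus of `B` applied to `b ↦ f (b⁻¹ - 1)`, extended by `0` at `b = 0`. -/
def functionalCalculus (A : H →ₗ.[ℂ] H) (f : ℝ → ℝ) : H →L[ℂ] H :=
  cfc (fun b : ℝ => if 0 < b then f (b⁻¹ - 1) else 0) (invOneAdd A)

/-- The operator `exp (-t A)` of the heat semigroup, for `t > 0`. -/
def heatSemigroup (A : H →ₗ.[ℂ] H) (t : ℝ) : H →L[ℂ] H :=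
  functionalCalculus A (fun l => Real.exp (-t * l))

end AbstractOperators

section Laplacians

variable {d N : ℕ}

/-- The Hilbert space `L²(U; ℂᴺ)`. -/
abbrev L2 (U : Set (EuclideanSpace ℝ (Fin d))) (N : ℕ) : Type :=
  Lp (EuclideanSpace ℂ (Fin N)) 2 (volume.restrict U)

/-- `f` belongs to `C_c^∞(U; ℂᴺ)`. -/
def IsTestFunction (U : Set (EuclideanSpace ℝ (Fin d)))
    (f : EuclideanSpace ℝ (Fin d) → EuclideanSpace ℂ (Fin N)) : Prop :=
  ContDiff ℝ ∞ f ∧ HasCompactSupport f ∧ tsupport f ⊆ U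

/-- The operator `A` in `L²(U; ℂᴺ)` extends the component-wise Laplacian
`-(∂²/∂x₁² + ⋯ + ∂²/∂x_d²)` on `C_c^∞(U; ℂᴺ)`: for each test function `f` the class of `f` lies
in the domain of `A`, which maps it to the class of `-Δ f`. -/
def ExtendsLaplacian (U : Set (EuclideanSpace ℝ (Fin d))) (A : L2 U N →ₗ.[ℂ] L2 U N) : Prop :=
  ∀ f : EuclideanSpace ℝ (Fin d) → EuclideanSpace ℂ (Fin N), IsTestFunction U f →
    ∀ u v : L2 U N, u =ᵐ[volume.restrict U] f →
      v =ᵐ[volume.restrict U] (fun x => -Laplacian.laplacian f x) → (u, v) ∈ A.graph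

/-- `k` is the continuous integral kernel on `U × U` of the bounded operator `T` in `L²(U; ℂᴺ)`:
it is continuous there, and the distributional kernel of `T` is the function `k`, that is
`⟨φ, T ψ⟩ = ∫∫ ⟨φ(x), k(x, y) ψ(y)⟩ dy dx` for all test functions `φ`, `ψ`. The `N × N`
matrices `k x y` are regarded as linear operators on `ℂᴺ`. -/
def IsIntegralKernel (U : Set (EuclideanSpace ℝ (Fin d))) (T : L2 U N →L[ℂ] L2 U N)
    (k : EuclideanSpace ℝ (Fin d) → EuclideanSpace ℝ (Fin d) →
      (EuclideanSpace ℂ (Fin N) →L[ℂ] EuclideanSpace ℂ (Fin N))) : Prop :=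
  ContinuousOn (fun p : EuclideanSpace ℝ (Fin d) × EuclideanSpace ℝ (Fin d) => k p.1 p.2)
      (U ×ˢ U) ∧
    ∀ φ ψ : EuclideanSpace ℝ (Fin d) → EuclideanSpace ℂ (Fin N),
      IsTestFunction U φ → IsTestFunction U ψ →
      ∀ u v : L2 U N, u =ᵐ[volume.restrict U] φ → v =ᵐ[volume.restrict U] ψ →
        inner ℂ u (T v) = ∫ x in U, ∫ y in U, inner ℂ (φ x) (k x y (ψ y))

/-- The heat kernel `(4πt)^{-d/2} exp(-|x-y|²/(4t)) 𝟙` of `ℝᵈ`. -/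
def freeHeatKernel (N : ℕ) (t : ℝ) (x y : EuclideanSpace ℝ (Fin d)) :
    EuclideanSpace ℂ (Fin N) →L[ℂ] EuclideanSpace ℂ (Fin N) :=
  (((4 * Real.pi * t) ^ (-(d : ℝ) / 2) * Real.exp (-‖x - y‖ ^ 2 / (4 * t)) : ℝ) : ℂ) •
    ContinuousLinearMap.id ℂ (EuclideanSpace ℂ (Fin N))

/-- The distance `ρ(x)` from `x` to the boundary of `U`; it is `∞` if the boundary is empty. -/
def boundaryDist (U : Set (EuclideanSpace ℝ (Fin d))) (x : EuclideanSpace ℝ (Fin d)) : ℝ≥0∞ :=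
  Metric.infEDist x (frontier U)

end Laplacians

/-- The differential operator `(1 - d²/ds²)^m`. -/
def oneSubDerivSq (m : ℕ) (f : ℝ → ℝ) : ℝ → ℝ :=
  (fun g s => g s - deriv (deriv g) s)^[m] f

/-- The set `A_R` of real-valued `ψ ∈ C^{2m}(ℝ)` with `supp (1 - ψ) ⊆ (-R, R)`, for
`0 < R ≤ ∞`. -/
def cutoffs (m : ℕ) (R : ℝ≥0∞) : Set (ℝ → ℝ) :=
  {ψ | ContDiff ℝ (2 * m : ℕ) ψ ∧ tsupport (fun s => 1 - ψ s) ⊆ {s | ENNReal.ofReal |s| < R}}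

/-- `J_m(ψ; t)`, the `L¹` norm of `(1 - d²/ds²)^m (ψ(s) exp(-s²/(4t)))`. -/
def cutoffNorm (m : ℕ) (ψ : ℝ → ℝ) (t : ℝ) : ℝ≥0∞ :=
  ∫⁻ s, ‖oneSubDerivSq m (fun r => ψ r * Real.exp (-r ^ 2 / (4 * t))) s‖ₑ

/-- `J_m(R; t)`, the infimum of `J_m(ψ; t)` over `ψ ∈ A_R`. It is finite since `1 ∈ A_R`. -/
def J (m : ℕ) (R : ℝ≥0∞) (t : ℝ) : ℝ :=
  (⨅ ψ ∈ cutoffs m R, cutoffNorm m ψ t).toReal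

end NotFeeling

end

/-! The heat semigroup is a Gaussian superposition of waves: up to the factor `2 √(π t)`, `exp (-t
A)` is the integral over `s` of `exp (-s² / (4 t)) cos (s √A)`, and the same formula holds for the
free Laplacian on the whole space. Waves travel with speed one. The wave matrix element between
points `x` and `y` can differ from the free one only if a signal has had time to go from `x` to the
boundary and from the boundary to `y`, that is for `|s|` at least `ρ(x) + ρ(y)`. Hence in the
difference of the two superpositions the Gaussian may be replaced by `ψ(s) exp (-s² / (4 t))` for
every admissible `ψ`, since `ψ = 1` wherever the difference of the waves is nonzero.

After this replacement the two terms are estimated separately. With `q = ψ exp (-s² / (4 t))` and `r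
= (1 - d²/ds²)^m q`, integration by parts gives `(1 + ν²)^m ∫ q cos (s ν) = ∫ r cos (s ν)`, so the
superposition with weight `q` is dominated, in the sense of forms, by `‖r‖₁ (1 + A)^(-m)`.
Cauchy-Schwarz for this form produces the geometric mean of the diagonal values of the resolvent
kernel (`norm_integral_mul_inner_waveOp_le`). For the free Laplacian the Fourier transform gives
instead the integral of `(1 + |2πξ|²)^(-m)`, which is the Gamma quotient
(`norm_integral_mul_freeWave_le`).

The extension `A` is arbitrary, so finite propagation speed has to come from interior information
alone. It is derived from the heat equation. A free heat kernel cut off inside `U` solves the heat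
equation of `A` up to a commutator supported away from its pole. For `a < ρ(x)` and `b < ρ(y)`, the
error made by the cutoff around `x` is of order `exp (-a² / (4 σ))`, and it is paired with the
commutator of the cutoff around `y`, of order `exp (-b² / (4 τ))`, with `σ + τ = t`. The inequality
`a² / σ + b² / τ ≥ (a + b)² / (σ + τ)` (`exp_neg_mul_exp_neg_le`) shows that the heat matrix
elements agree up to `exp (-(a + b)² / (4 t))` (`exists_norm_inner_sub_freePairing_le`). A
uniqueness theorem for the Laplace transform (`eq_zero_of_gaussian_integral_le`) turns this decay as
`t → 0` into the vanishing of the difference of the waves for `|s| < a + b`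
(`waveDifference_eq_zero`).

The kernels exist because `exp (-t A / 2)` and `(1 + A)^(-m/2)` are given locally by continuous
functions `κ` with values in the Hilbert space: this is Duhamel's formula for the cut off heat
kernel, and for the resolvent its Laplace transform, which converges at small times since `m / 2 > d
/ 4`. The kernels of the squares of these operators are then built from the inner products of `κ(x)`
and `κ(y)` (`exists_isIntegralKernel_mul_self`).

The unbounded operator enters only through its graph and through `B = (1 + A)⁻¹`, whose spectrum
lies in `[0, 1]`. All estimates concern matrix elements between smooth functions; the pointwise
bound follows by concentrating mollifiers at `x` and `y`. -/

noncomputable section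

namespace NotFeeling

/-! ### Continuous functional calculus depending on a parameter, and form bounds -/

section

open Filter Topology ContinuousMap

section CompactParameter

/-- A curve of continuous functions on a compact space which is pointwise differentiable with
a continuous derivative is differentiable in the supremum norm. -/
theorem hasDerivAt_continuousMap {K : Type*} [TopologicalSpace K] [CompactSpace K]
    {γ γ' : ℝ → C(K, ℝ)} {τ : ℝ} (hc : ContinuousAt γ' τ)
    (h : ∀ᶠ σ in 𝓝 τ, ∀ k, HasDerivAt (fun s => γ s k) (γ' σ k) σ) :
    HasDerivAt γ (γ' τ) τ := by
  rw [hasDerivAt_iff_isLittleO, Asymptotics.isLittleO_iff]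
  intro c hc0
  obtain ⟨ε, hε, hball⟩ := Metric.eventually_nhds_iff_ball.1
    (h.and (hc.eventually (Metric.closedBall_mem_nhds _ hc0)))
  filter_upwards [Metric.ball_mem_nhds τ hε] with σ hσ
  rw [ContinuousMap.norm_le _ (by positivity)]
  intro k
  -- Mean value inequality for the error of the linear approximation at a fixed point `k`. The
  -- constant is uniform in `k` because `γ'` is continuous in the supremum norm.
  have key := (convex_ball τ ε).norm_image_sub_le_of_norm_hasDerivWithin_le
    (f := fun s => γ s k - s * γ' τ k) (f' := fun s => γ' s k - γ' τ k) (C := c)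
    (fun s hs => (((hball s hs).1 k).sub (by
      simpa using (hasDerivAt_id s).mul_const (γ' τ k))).hasDerivWithinAt)
    (fun s hs => by
      have := (hball s hs).2
      rw [dist_eq_norm] at this
      exact (ContinuousMap.norm_coe_le_norm (γ' s - γ' τ) k).trans this)
    (Metric.mem_ball_self hε) hσ
  have e : (γ σ - γ τ - (σ - τ) • γ' τ) k = γ σ k - σ * γ' τ k - (γ τ k - τ * γ' τ k) := by
    simp only [ContinuousMap.sub_apply, ContinuousMap.smul_apply, smul_eq_mul]
    ring
  rw [e]
  exact key

end CompactParameter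

section FunctionalCalculusParameter

variable {H : Type*} [NormedAddCommGroup H] [InnerProductSpace ℂ H] [CompleteSpace H]
variable {B : H →L[ℂ] H}

/-- A bounded self-adjoint operator with spectrum in `[0, 1]`. -/
structure IsUnitInterval (B : H →L[ℂ] H) : Prop where
  isSelfAdjoint : IsSelfAdjoint B
  spectrum_subset : spectrum ℝ B ⊆ Icc 0 1

/-- On a compact spectrum, joint continuity of the symbol is continuity in the supremum norm with
respect to the parameter, and the functional calculus is a continuous linear map for that norm. -/
theorem IsUnitInterval.continuousOn_cfc_param (hB : IsUnitInterval B) {P : Type*}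
    [TopologicalSpace P] {s : Set P} {F : P → ℝ → ℝ}
    (hF : ContinuousOn (Function.uncurry F) (s ×ˢ Icc 0 1)) :
    ContinuousOn (fun p => cfc (F p) B) s := by
  simp_rw [fun p => cfc_eq_cfcL_mkD (F p) B hB.isSelfAdjoint]
  exact (cfcL (R := ℝ) hB.isSelfAdjoint).continuous.comp_continuousOn
    (continuousOn_mkD_restrict_of_uncurry F 0
      (hF.mono (prod_mono subset_rfl hB.spectrum_subset)))

/-- The chain rule through the continuous linear map `cfcL`: pointwise differentiability with a
jointly continuous derivative is differentiability in the supremum norm, by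
`hasDerivAt_continuousMap`. -/
theorem IsUnitInterval.hasDerivAt_cfc_param (hB : IsUnitInterval B) {s : Set ℝ} (hs : IsOpen s)
    {F F' : ℝ → ℝ → ℝ} (hF : ContinuousOn (Function.uncurry F) (s ×ˢ Icc 0 1))
    (hF' : ContinuousOn (Function.uncurry F') (s ×ˢ Icc 0 1))
    (hd : ∀ τ ∈ s, ∀ b ∈ Icc (0 : ℝ) 1, HasDerivAt (fun τ => F τ b) (F' τ b) τ)
    {τ : ℝ} (hτ : τ ∈ s) :
    HasDerivAt (fun τ => cfc (F τ) B) (cfc (F' τ) B) τ := by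
  simp_rw [fun p => cfc_eq_cfcL_mkD p B hB.isSelfAdjoint]
  have hsub := prod_mono (subset_refl s) hB.spectrum_subset
  have hcont : ∀ {G : ℝ → ℝ → ℝ}, ContinuousOn (Function.uncurry G) (s ×ˢ Icc 0 1) →
      ∀ σ ∈ s, ContinuousOn (G σ) (spectrum ℝ B) := fun {G} hG σ hσ =>
    (hG.mono hsub).comp (Continuous.prodMk_right σ).continuousOn fun z hz => ⟨hσ, hz⟩
  refine HasFDerivAt.comp_hasDerivAt (𝕜 := ℝ) τ
    ((cfcL (R := ℝ) hB.isSelfAdjoint).hasFDerivAt) ?_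
  refine hasDerivAt_continuousMap
    (γ' := fun τ => mkD ((spectrum ℝ B).domRestrict (F' τ)) 0)
    ((continuousOn_mkD_restrict_of_uncurry F' 0 (hF'.mono hsub)).continuousAt (hs.mem_nhds hτ)) ?_
  filter_upwards [hs.mem_nhds hτ] with σ hσ k
  rw [mkD_apply_of_continuousOn (hcont hF' σ hσ)]
  refine (hd σ hσ k (hB.spectrum_subset k.2)).congr_of_eventuallyEq ?_
  filter_upwards [hs.mem_nhds hσ] with ρ hρ
  rw [mkD_apply_of_continuousOn (hcont hF ρ hρ)]

theorem IsUnitInterval.norm_cfc_le (_hB : IsUnitInterval B) {f : ℝ → ℝ} {C : ℝ} (hC : 0 ≤ C)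
    (hf : ∀ b ∈ Icc (0 : ℝ) 1, |f b| ≤ C) : ‖cfc f B‖ ≤ C :=
  _root_.norm_cfc_le hC fun x hx => hf x (_hB.spectrum_subset hx)

theorem inner_cfc_left (f : ℝ → ℝ) (u v : H) :
    inner ℂ (cfc f B u) v = inner ℂ u (cfc f B v) := by
  have h : IsSelfAdjoint (cfc f B) := cfc_predicate f B
  exact (ContinuousLinearMap.isSelfAdjoint_iff_isSymmetric.1 h) u v

/-- Cauchy-Schwarz inequality for a positive operator. -/
theorem norm_inner_le_of_nonneg {T : H →L[ℂ] H} (hT : 0 ≤ T) (u v : H) :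
    ‖inner ℂ u (T v)‖ ≤ √(inner ℂ u (T u)).re * √(inner ℂ v (T v)).re := by
  have hs : IsSelfAdjoint (CFC.sqrt T) := (CFC.sqrt_nonneg T).isSelfAdjoint
  have hsym := ContinuousLinearMap.isSelfAdjoint_iff_isSymmetric.1 hs
  have hmul : ∀ a b : H, inner ℂ a (T b) = inner ℂ (CFC.sqrt T a) (CFC.sqrt T b) := by
    intro a b
    conv_lhs => rw [← CFC.sqrt_mul_sqrt_self T hT]
    exact (hsym a (CFC.sqrt T b)).symm
  have hn : ∀ a : H, √(inner ℂ a (T a)).re = ‖CFC.sqrt T a‖ := by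
    intro a
    rw [hmul, inner_self_eq_norm_sq_to_K]
    norm_cast
    exact Real.sqrt_sq (norm_nonneg _)
  rw [hn, hn, hmul]
  exact norm_inner_le_norm _ _

/-- If `|f| ≤ g` on `[0, 1]` then `f(B)` is dominated by `g(B)` in the sense of forms. -/
theorem IsUnitInterval.norm_inner_cfc_le (hB : IsUnitInterval B) {f g : ℝ → ℝ}
    (hf : ContinuousOn f (Icc 0 1)) (hg : ContinuousOn g (Icc 0 1))
    (hfg : ∀ b ∈ Icc (0 : ℝ) 1, |f b| ≤ g b) (u v : H) :
    ‖inner ℂ u (cfc f B v)‖ ≤ √(inner ℂ u (cfc g B u)).re * √(inner ℂ v (cfc g B v)).re := by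
  have hf' := hf.mono hB.spectrum_subset
  have hg' := hg.mono hB.spectrum_subset
  -- Both `g + f` and `g - f` are nonnegative on the spectrum, so Cauchy-Schwarz is available for
  -- both operators; `f(B)` is half of their difference.
  have hp : 0 ≤ cfc (fun b => g b + f b) B := cfc_nonneg fun x hx => by
    have := hfg x (hB.spectrum_subset hx); linarith [neg_abs_le (f x)]
  have hm : 0 ≤ cfc (fun b => g b - f b) B := cfc_nonneg fun x hx => by
    have := hfg x (hB.spectrum_subset hx); linarith [le_abs_self (f x)]
  have h1 := norm_inner_le_of_nonneg hp u v
  have h2 := norm_inner_le_of_nonneg hm u v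
  have n1 := fun a : H => ((ContinuousLinearMap.nonneg_iff_isPositive _).1 hp).re_inner_nonneg_right a
  have n2 := fun a : H => ((ContinuousLinearMap.nonneg_iff_isPositive _).1 hm).re_inner_nonneg_right a
  rw [cfc_add _ _ _ hg' hf'] at h1 n1
  rw [cfc_sub _ _ _ hg' hf'] at h2 n2
  simp only [_root_.add_apply, _root_.sub_apply, inner_add_right,
    inner_sub_right, Complex.add_re, Complex.sub_re, map_add, map_sub, RCLike.re_to_complex] at h1 h2 n1 n2
  set a := inner ℂ u (cfc f B v)
  set b := inner ℂ u (cfc g B v)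
  have n1u := n1 u
  have n1v := n1 v
  have n2u := n2 u
  have n2v := n2 v
  set gu := (inner ℂ u (cfc g B u)).re
  set gv := (inner ℂ v (cfc g B v)).re
  set fu := (inner ℂ u (cfc f B u)).re
  set fv := (inner ℂ v (cfc f B v)).re
  have h3 : 2 * ‖a‖ ≤ √(gu + fu) * √(gv + fv) + √(gu - fu) * √(gv - fv) := by
    calc 2 * ‖a‖ = ‖(b + a) - (b - a)‖ := by
          rw [show (b + a) - (b - a) = 2 * a by ring, norm_mul]; simp
      _ ≤ _ := (norm_sub_le _ _).trans (add_le_add h1 h2)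
  -- Cauchy-Schwarz in the plane, for two vectors of squared lengths `2 gu` and `2 gv`.
  have h4 : √(gu + fu) * √(gv + fv) + √(gu - fu) * √(gv - fv) ≤ 2 * (√gu * √gv) := by
    have hgu : 0 ≤ gu := by linarith
    have hgv : 0 ≤ gv := by linarith
    refine abs_le_of_sq_le_sq' ?_ (by positivity) |>.2
    have e1 := Real.sq_sqrt n1u
    have e2 := Real.sq_sqrt n1v
    have e3 := Real.sq_sqrt n2u
    have e4 := Real.sq_sqrt n2v
    have e5 := Real.sq_sqrt hgu
    have e6 := Real.sq_sqrt hgv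
    have : (2 * (√gu * √gv)) ^ 2 = (√(gu + fu) ^ 2 + √(gu - fu) ^ 2) *
        (√(gv + fv) ^ 2 + √(gv - fv) ^ 2) := by
      rw [e1, e2, e3, e4, mul_pow, mul_pow, e5, e6]; ring
    rw [this]
    nlinarith [sq_nonneg (√(gu + fu) * √(gv - fv) - √(gu - fu) * √(gv + fv))]
  linarith

end FunctionalCalculusParameter
end

/-! ### The heat semigroup of a non-negative self-adjoint operator -/

section

open Filter Topology ContinuousMap

section HeatSemigroup

variable {H : Type*} [NormedAddCommGroup H] [InnerProductSpace ℂ H] [CompleteSpace H]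
variable {A : H →ₗ.[ℂ] H}

theorem invOneAdd_nonneg (hA : IsNonnegSelfAdjoint A) : 0 ≤ invOneAdd A := by
  rw [ContinuousLinearMap.nonneg_iff_isPositive, ContinuousLinearMap.isPositive_def']
  refine ⟨isSelfAdjoint_invOneAdd hA, fun f => ?_⟩
  obtain ⟨hf, hf'⟩ := (invOneAdd_spec hA).1 f
  rw [ContinuousLinearMap.reApplyInnerSelf_apply]
  have h : 0 ≤ RCLike.re (inner ℂ (invOneAdd A f) (A ⟨_, hf⟩)) := hA.2 ⟨_, hf⟩
  have e : inner ℂ (invOneAdd A f) f = inner ℂ (invOneAdd A f) (invOneAdd A f) +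
      inner ℂ (invOneAdd A f) (A ⟨_, hf⟩) := by
    rw [← inner_add_right, hf']
  rw [e, inner_self_eq_norm_sq_to_K, map_add]
  refine add_nonneg ?_ h
  norm_cast
  positivity

theorem norm_invOneAdd_le (hA : IsNonnegSelfAdjoint A) : ‖invOneAdd A‖ ≤ 1 := by
  refine ContinuousLinearMap.opNorm_le_bound _ zero_le_one fun f => ?_
  obtain ⟨hf, hf'⟩ := (invOneAdd_spec hA).1 f
  have h := norm_le_norm_add hA ⟨_, hf⟩
  rw [one_mul]
  rwa [hf'] at h

theorem isUnitInterval_invOneAdd (hA : IsNonnegSelfAdjoint A) :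
    IsUnitInterval (invOneAdd A) where
  isSelfAdjoint := isSelfAdjoint_invOneAdd hA
  spectrum_subset := by
    intro b hb
    refine ⟨spectrum_nonneg_of_nonneg (invOneAdd_nonneg hA) hb, ?_⟩
    rcases subsingleton_or_nontrivial H with h | h
    · exact absurd hb (by simp)
    · exact (le_abs_self b).trans ((spectrum.norm_le_norm_of_mem hb).trans (norm_invOneAdd_le hA))

/-- Facts about the domain of `A` are carried as graph membership; this turns one of them into an
identity for a bounded operator. -/
theorem mem_graph_iff_invOneAdd (hA : IsNonnegSelfAdjoint A) {u v : H} (h : (u, v) ∈ A.graph) :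
    invOneAdd A (u + v) = u := by
  obtain ⟨w, rfl, rfl⟩ := (A.mem_graph_iff).1 h
  exact (invOneAdd_spec hA).2 w

theorem inner_graph_symm (hA : IsNonnegSelfAdjoint A) {u u' v v' : H} (h : (u, u') ∈ A.graph)
    (h' : (v, v') ∈ A.graph) : inner ℂ u' v = inner ℂ u v' := by
  have hsymm : A.IsFormalAdjoint A := by
    have := LinearPMap.adjoint_isFormalAdjoint hA.1.dense_domain
    rwa [LinearPMap.isSelfAdjoint_def.1 hA.1] at this
  obtain ⟨a, rfl, rfl⟩ := (A.mem_graph_iff).1 h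
  obtain ⟨b, rfl, rfl⟩ := (A.mem_graph_iff).1 h'
  exact hsymm a b

/-- The function of `b = (1 + λ)⁻¹` equal to `(1 + λ)ⁿ exp (-t λ)`. -/
def heatSymbol (n : ℕ) (t b : ℝ) : ℝ :=
  if 0 < b then b⁻¹ ^ n * Real.exp (-t * (b⁻¹ - 1)) else 0

theorem heatSymbol_zero_right (n : ℕ) (t : ℝ) : heatSymbol n t 0 = 0 := by simp [heatSymbol]

theorem heatSymbol_nonneg (n : ℕ) (t : ℝ) {b : ℝ} : 0 ≤ heatSymbol n t b := by
  unfold heatSymbol; split_ifs <;> positivity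

/-- The exponential series gives `exp (t / b) ≥ (t / b)^(n+1) / (n+1)!`. One power more than `b⁻¹ ^
n` is used, so that a factor `b` is left over and the symbol vanishes at `b = 0`. -/
theorem heatSymbol_le (n : ℕ) {t b : ℝ} (ht : 0 < t) (hb : 0 ≤ b) :
    heatSymbol n t b ≤ Real.exp t * ((n + 1).factorial / t ^ (n + 1)) * b := by
  unfold heatSymbol
  split_ifs with h
  · have h1 := Real.pow_div_factorial_le_exp (t / b) (by positivity) (n + 1)
    have h2 : Real.exp (-t * (b⁻¹ - 1)) = Real.exp t * (Real.exp (t / b))⁻¹ := by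
      rw [← Real.exp_neg, ← Real.exp_add]; congr 1; field_simp; ring
    have h3 : (Real.exp (t / b))⁻¹ ≤ ((t / b) ^ (n + 1) / (n + 1).factorial)⁻¹ :=
      inv_anti₀ (by positivity) h1
    calc b⁻¹ ^ n * Real.exp (-t * (b⁻¹ - 1))
        = b⁻¹ ^ n * Real.exp t * (Real.exp (t / b))⁻¹ := by rw [h2]; ring
      _ ≤ b⁻¹ ^ n * Real.exp t * ((t / b) ^ (n + 1) / (n + 1).factorial)⁻¹ := by gcongr
      _ = _ := by rw [div_pow, inv_pow]; field_simp; ring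
  · positivity

/-- Only `b = 0`, which stands for `λ = ∞`, needs an argument, and there the linear bound
`heatSymbol_le` squeezes the symbol to `0`. The time `t = 0` has to be excluded: near `(0, 0)` the
symbol has no limit. -/
theorem continuousOn_heatSymbol (n : ℕ) :
    ContinuousOn (Function.uncurry (heatSymbol n)) (Ioi 0 ×ˢ Icc 0 1) := by
  rintro ⟨t, b⟩ ⟨ht, hb0, hb1⟩
  simp only [mem_Ioi] at ht
  rcases hb0.eq_or_lt with rfl | hb
  · rw [ContinuousWithinAt]
    simp only [Function.uncurry_apply_pair, heatSymbol_zero_right]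
    have hlim : Tendsto (fun p : ℝ × ℝ => Real.exp p.1 * ((n + 1).factorial / p.1 ^ (n + 1)) * p.2)
        (𝓝[Ioi 0 ×ˢ Icc 0 1] (t, 0)) (𝓝 0) := by
      have : ContinuousAt
          (fun p : ℝ × ℝ => Real.exp p.1 * ((n + 1).factorial / p.1 ^ (n + 1)) * p.2) (t, 0) := by
        have : (t, (0:ℝ)).1 ^ (n + 1) ≠ 0 := by positivity
        fun_prop (disch := assumption)
      simpa using this.tendsto.mono_left nhdsWithin_le_nhds
    refine squeeze_zero' (Eventually.of_forall fun p => heatSymbol_nonneg _ _) ?_ hlim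
    filter_upwards [self_mem_nhdsWithin] with p hp
    exact heatSymbol_le n hp.1 hp.2.1
  · have hev : (fun p : ℝ × ℝ => p.2⁻¹ ^ n * Real.exp (-p.1 * (p.2⁻¹ - 1))) =ᶠ[𝓝 (t, b)]
        Function.uncurry (heatSymbol n) := by
      have : ∀ᶠ p : ℝ × ℝ in 𝓝 (t, b), 0 < p.2 :=
        (continuous_snd.tendsto (t, b)).eventually (lt_mem_nhds hb)
      filter_upwards [this] with p hp
      simp [Function.uncurry, heatSymbol, hp]
    refine (ContinuousAt.congr ?_ hev).continuousWithinAt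
    have : (t, b).2 ≠ 0 := hb.ne'
    fun_prop (disch := assumption)

theorem heatSemigroup_eq (A : H →ₗ.[ℂ] H) (t : ℝ) :
    heatSemigroup A t = cfc (heatSymbol 0 t) (invOneAdd A) := by
  simp only [heatSemigroup, functionalCalculus]
  congr 1
  ext b
  simp [heatSymbol]

theorem inner_heatSemigroup_left (t : ℝ) (u v : H) :
    inner ℂ (heatSemigroup A t u) v = inner ℂ u (heatSemigroup A t v) := by
  rw [heatSemigroup_eq]; exact inner_cfc_left _ u v

theorem heatSymbol_zero_le_one {t b : ℝ} (ht : 0 ≤ t) (hb : b ∈ Icc (0 : ℝ) 1) :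
    |heatSymbol 0 t b| ≤ 1 := by
  rw [abs_of_nonneg (heatSymbol_nonneg 0 t)]
  unfold heatSymbol
  split_ifs with h
  · have : 1 ≤ b⁻¹ := (one_le_inv₀ h).2 hb.2
    simp only [pow_zero, one_mul, Real.exp_le_one_iff]
    nlinarith
  · exact zero_le_one

theorem norm_heatSemigroup_le (hA : IsNonnegSelfAdjoint A) {t : ℝ} (ht : 0 ≤ t) :
    ‖heatSemigroup A t‖ ≤ 1 := by
  rw [heatSemigroup_eq]
  exact (isUnitInterval_invOneAdd hA).norm_cfc_le zero_le_one fun b hb =>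
    heatSymbol_zero_le_one ht hb

theorem norm_heatSemigroup_apply_le (hA : IsNonnegSelfAdjoint A) {t : ℝ} (ht : 0 ≤ t) (f : H) :
    ‖heatSemigroup A t f‖ ≤ ‖f‖ := by
  simpa using (heatSemigroup A t).le_of_opNorm_le (norm_heatSemigroup_le hA ht) f

theorem continuousOn_heatSemigroup (hA : IsNonnegSelfAdjoint A) :
    ContinuousOn (heatSemigroup A) (Ioi 0) := by
  simp_rw [funext (heatSemigroup_eq A)]
  exact (isUnitInterval_invOneAdd hA).continuousOn_cfc_param (continuousOn_heatSymbol 0)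

theorem continuousOn_heatSymbol_right (n : ℕ) {t : ℝ} (ht : 0 < t) :
    ContinuousOn (heatSymbol n t) (Icc 0 1) :=
  (continuousOn_heatSymbol n).comp (Continuous.prodMk_right t).continuousOn fun _ hz => ⟨ht, hz⟩

/-- The derivative of `exp (-t A)` is `exp (-t A) - (1 + A) exp (-t A)`. -/
theorem hasDerivAt_heatSemigroup (hA : IsNonnegSelfAdjoint A) {t : ℝ} (ht : 0 < t) :
    HasDerivAt (heatSemigroup A)
      (heatSemigroup A t - cfc (heatSymbol 1 t) (invOneAdd A)) t := by
  have hB := isUnitInterval_invOneAdd hA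
  rw [heatSemigroup_eq, ← cfc_sub _ _ _
    ((continuousOn_heatSymbol_right 0 ht).mono hB.spectrum_subset)
    ((continuousOn_heatSymbol_right 1 ht).mono hB.spectrum_subset)]
  simp_rw [funext (heatSemigroup_eq A)]
  refine hB.hasDerivAt_cfc_param (F' := fun t b => heatSymbol 0 t b - heatSymbol 1 t b) isOpen_Ioi
    (continuousOn_heatSymbol 0)
    ((continuousOn_heatSymbol 0).sub (continuousOn_heatSymbol 1)) ?_ ht
  intro τ hτ b hb
  unfold heatSymbol
  split_ifs with h
  · have := ((hasDerivAt_id τ).neg.mul_const (b⁻¹ - 1)).exp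
    simp only [Pi.neg_apply, id_eq] at this
    convert this using 1
    · simp
    · ring
  · simpa using hasDerivAt_const τ (0 : ℝ)

/-- The symbols satisfy `b * heatSymbol 1 t b = heatSymbol 0 t b`. In this way `(1 + A) exp (-t A)`
is treated as a bounded operator, without reference to the domain of `A`. -/
theorem invOneAdd_comp_cfc_heatSymbol (hA : IsNonnegSelfAdjoint A) {t : ℝ} (ht : 0 < t) (f : H) :
    invOneAdd A (cfc (heatSymbol 1 t) (invOneAdd A) f) = heatSemigroup A t f := by
  have hB := isUnitInterval_invOneAdd hA
  have h : invOneAdd A * cfc (heatSymbol 1 t) (invOneAdd A) = heatSemigroup A t := by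
    conv_lhs => enter [1]; rw [← cfc_id ℝ (invOneAdd A) hB.isSelfAdjoint]
    rw [← cfc_mul _ _ _ continuousOn_id
      ((continuousOn_heatSymbol_right 1 ht).mono hB.spectrum_subset), heatSemigroup_eq]
    congr 1
    ext b
    unfold heatSymbol
    split_ifs with h
    · simp only [id_eq]; field_simp
    · simp
  rw [← h]; rfl

/-- The product rule behind Duhamel's formula. -/
theorem hasDerivAt_inner_heatSemigroup (hA : IsNonnegSelfAdjoint A) {t τ : ℝ} (hτ : τ < t) (f : H)
    {z : ℝ → H} {z' a : H} (hz : HasDerivAt z z' τ) (ha : (z τ, a) ∈ A.graph) :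
    HasDerivAt (fun τ => inner ℂ (heatSemigroup A (t - τ) f) (z τ))
      (inner ℂ (heatSemigroup A (t - τ) f) (z' + a)) τ := by
  have hpos : 0 < t - τ := sub_pos.2 hτ
  have h1 := (hasDerivAt_heatSemigroup hA hpos).scomp τ ((hasDerivAt_id τ).const_sub t)
  have h2 : HasDerivAt (fun τ => heatSemigroup A (t - τ) f)
      (((-1 : ℝ) • (heatSemigroup A (t - τ) - cfc (heatSymbol 1 (t - τ)) (invOneAdd A))) f) τ :=
    HasFDerivAt.comp_hasDerivAt (𝕜 := ℝ) τ
      (((ContinuousLinearMap.apply ℂ H f).restrictScalars ℝ).hasFDerivAt) h1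
  have h3 := h2.inner ℂ hz
  refine h3.congr_deriv ?_
  -- The left entry is `(1 + A) exp (-(t - τ) A) f`. Writing `z τ = (1 + A)⁻¹ (z τ + a)` moves the
  -- factor `1 + A` over to `z τ`.
  have e : inner ℂ (cfc (heatSymbol 1 (t - τ)) (invOneAdd A) f) (z τ) =
      inner ℂ (heatSemigroup A (t - τ) f) (z τ + a) := by
    conv_lhs => rw [← mem_graph_iff_invOneAdd hA ha]
    rw [← invOneAdd_comp_cfc_heatSymbol hA hpos]
    exact ((ContinuousLinearMap.isSelfAdjoint_iff_isSymmetric.1 (isSelfAdjoint_invOneAdd hA))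
      _ _).symm
  rw [neg_one_smul, _root_.neg_apply, _root_.sub_apply, neg_sub, inner_sub_left, e, inner_add_right,
    inner_add_right]
  ring

theorem dense_range_invOneAdd (hA : IsNonnegSelfAdjoint A) :
    Dense (range (invOneAdd A)) := by
  refine hA.1.dense_domain.mono fun u hu => ?_
  exact ⟨_, (invOneAdd_spec hA).2 ⟨u, hu⟩⟩

/-- The heat semigroup is strongly continuous at `t = 0`. -/
theorem tendsto_heatSemigroup_zero (hA : IsNonnegSelfAdjoint A) (f : H) :
    Tendsto (fun t => heatSemigroup A t f) (𝓝[>] 0) (𝓝 f) := by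
  have hB := isUnitInterval_invOneAdd hA
  -- The symbol of the semigroup is not continuous at `(0, 0)`. The extra factor `b` repairs this
  -- and gives convergence in norm after composition with `(1 + A)⁻¹`; density of its range and
  -- contractivity of the semigroup then yield strong convergence.
  have hcont : ContinuousOn (Function.uncurry fun t b : ℝ => b * heatSymbol 0 t b)
      (Ici 0 ×ˢ Icc 0 1) := by
    rintro ⟨t, b⟩ ⟨ht, hb0, hb1⟩
    rcases hb0.eq_or_lt with rfl | hb
    · rw [ContinuousWithinAt]
      simp only [Function.uncurry_apply_pair, zero_mul]
      refine squeeze_zero_norm' (a := fun p : ℝ × ℝ => |p.2|) ?_ ?_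
      · filter_upwards [self_mem_nhdsWithin] with p hp
        simp only [Function.uncurry, norm_mul, Real.norm_eq_abs]
        exact mul_le_of_le_one_right (abs_nonneg _) (heatSymbol_zero_le_one hp.1 hp.2)
      · have : ContinuousAt (fun p : ℝ × ℝ => |p.2|) (t, 0) := by fun_prop
        simpa using this.tendsto.mono_left nhdsWithin_le_nhds
    · have hev : (fun p : ℝ × ℝ => p.2 * Real.exp (-p.1 * (p.2⁻¹ - 1))) =ᶠ[𝓝 (t, b)]
          (Function.uncurry fun t b : ℝ => b * heatSymbol 0 t b) := by
        have : ∀ᶠ p : ℝ × ℝ in 𝓝 (t, b), 0 < p.2 :=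
          (continuous_snd.tendsto (t, b)).eventually (lt_mem_nhds hb)
        filter_upwards [this] with p hp
        simp [Function.uncurry, heatSymbol, hp]
      refine (ContinuousAt.congr ?_ hev).continuousWithinAt
      have : (t, b).2 ≠ 0 := hb.ne'
      fun_prop (disch := assumption)
  have hlim := (hB.continuousOn_cfc_param hcont).continuousWithinAt (x := 0) self_mem_Ici
  have h0 : cfc (fun b : ℝ => b * heatSymbol 0 0 b) (invOneAdd A) = invOneAdd A := by
    conv_rhs => rw [← cfc_id ℝ (invOneAdd A) hB.isSelfAdjoint]
    refine cfc_congr fun b hb => ?_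
    rcases (hB.spectrum_subset hb).1.eq_or_lt with rfl | h
    · simp
    · simp [heatSymbol, h]
  have hmul : ∀ t ∈ Ioi (0 : ℝ), cfc (fun b : ℝ => b * heatSymbol 0 t b) (invOneAdd A) =
      heatSemigroup A t * invOneAdd A := by
    intro t ht
    conv_rhs => enter [2]; rw [← cfc_id ℝ (invOneAdd A) hB.isSelfAdjoint]
    rw [heatSemigroup_eq, ← cfc_mul _ _ _
      ((continuousOn_heatSymbol_right 0 ht).mono hB.spectrum_subset) continuousOn_id]
    congr 1
    ext b
    simp [mul_comm]
  rw [ContinuousWithinAt, h0] at hlim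
  have hlim' := hlim.mono_left (nhdsWithin_mono (0 : ℝ) Ioi_subset_Ici_self)
  rw [Metric.tendsto_nhds]
  intro ε hε
  obtain ⟨_, ⟨g, rfl⟩, hg⟩ := (dense_range_invOneAdd hA).exists_dist_lt f
    (show 0 < ε / 3 by positivity)
  have hg' := Metric.tendsto_nhds.1 (((ContinuousLinearMap.apply ℂ H g).continuous.tendsto _).comp
    hlim') (ε / 3) (by positivity)
  filter_upwards [hg', self_mem_nhdsWithin] with t h1 ht
  simp only [Function.comp_apply, hmul t ht, ContinuousLinearMap.apply_apply] at h1
  have h2 : dist (heatSemigroup A t f) (heatSemigroup A t (invOneAdd A g)) < ε / 3 := by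
    rw [dist_eq_norm, ← map_sub]
    refine (norm_heatSemigroup_apply_le hA (le_of_lt ht) _).trans_lt ?_
    rwa [← dist_eq_norm]
  have h3 := dist_triangle4 (heatSemigroup A t f) (heatSemigroup A t (invOneAdd A g))
    (invOneAdd A g) f
  rw [dist_comm] at hg
  have h1' : dist (heatSemigroup A t (invOneAdd A g)) (invOneAdd A g) < ε / 3 := h1
  linarith

end HeatSemigroup
end

/-! ### Wave operators, and the heat semigroup and fractional powers as integrals -/

section

open Filter Topology ContinuousMap

section Wave

variable {H : Type*} [NormedAddCommGroup H] [InnerProductSpace ℂ H] [CompleteSpace H]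
variable {A : H →ₗ.[ℂ] H}

/-- The function of `b = (1 + λ)⁻¹` equal to `(1 + λ)⁻¹ cos (s √λ)`. -/
def waveSymbol (s b : ℝ) : ℝ := b * Real.cos (s * √(b⁻¹ - 1))

/-- The operator `(1 + A)⁻¹ cos (s √A)`. -/
def waveOp (A : H →ₗ.[ℂ] H) (s : ℝ) : H →L[ℂ] H := cfc (waveSymbol s) (invOneAdd A)

theorem abs_waveSymbol_le (s : ℝ) {b : ℝ} (hb : 0 ≤ b) : |waveSymbol s b| ≤ b := by
  rw [waveSymbol, abs_mul, abs_of_nonneg hb]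
  exact mul_le_of_le_one_right hb (Real.abs_cos_le_one _)

/-- The cosine oscillates without limit as `b → 0`; the factor `b` makes the symbol continuous
there, whatever value the expression under the root takes at `b = 0`. For this reason waves are
always used together with a factor `(1 + A)⁻¹`. -/
theorem continuousOn_waveSymbol :
    ContinuousOn (Function.uncurry waveSymbol) (univ ×ˢ Icc 0 1) := by
  rintro ⟨s, b⟩ ⟨-, hb0, hb1⟩
  rcases hb0.eq_or_lt with rfl | hb
  · rw [ContinuousWithinAt]
    simp only [Function.uncurry_apply_pair, waveSymbol, zero_mul]
    refine squeeze_zero_norm' (a := fun p : ℝ × ℝ => p.2) ?_ ?_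
    · filter_upwards [self_mem_nhdsWithin] with p hp
      exact abs_waveSymbol_le p.1 hp.2.1
    · have : ContinuousAt (fun p : ℝ × ℝ => p.2) (s, 0) := by fun_prop
      simpa using this.tendsto.mono_left nhdsWithin_le_nhds
  · refine ContinuousAt.continuousWithinAt ?_
    have : (s, b).2 ≠ 0 := hb.ne'
    unfold Function.uncurry waveSymbol
    fun_prop (disch := assumption)

theorem norm_waveOp_le (hA : IsNonnegSelfAdjoint A) (s : ℝ) : ‖waveOp A s‖ ≤ 1 :=
  (isUnitInterval_invOneAdd hA).norm_cfc_le zero_le_one fun _ hb =>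
    (abs_waveSymbol_le s hb.1).trans hb.2

theorem continuous_waveOp (hA : IsNonnegSelfAdjoint A) : Continuous (waveOp A) := by
  rw [← continuousOn_univ]
  exact (isUnitInterval_invOneAdd hA).continuousOn_cfc_param continuousOn_waveSymbol

theorem waveOp_neg (s : ℝ) : waveOp A (-s) = waveOp A s := by
  unfold waveOp
  congr 1
  ext b
  simp [waveSymbol]

/-- Superpositions of the operators `(1 + A)⁻¹ cos (s √A)` are functions of `A`. -/
theorem integral_mul_inner_waveOp (hA : IsNonnegSelfAdjoint A) {q : ℝ → ℝ} (hq : Continuous q)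
    (hqi : Integrable q) (u g : H) :
    ∫ s, (q s : ℂ) * inner ℂ u (waveOp A s g) =
      inner ℂ u (cfc (fun b => ∫ s, q s * waveSymbol s b) (invOneAdd A) g) := by
  have hB := isUnitInterval_invOneAdd hA
  have hc : ContinuousOn (Function.uncurry fun s b => q s * waveSymbol s b)
      (univ ×ˢ Icc 0 1) :=
    (hq.comp continuous_fst).continuousOn.mul continuousOn_waveSymbol
  have hbound : ∀ s, ∀ b ∈ spectrum ℝ (invOneAdd A), ‖q s * waveSymbol s b‖ ≤ ‖q s‖ := by
    intro s b hb
    have hb' := hB.spectrum_subset hb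
    rw [norm_mul]
    exact mul_le_of_le_one_right (norm_nonneg _) ((abs_waveSymbol_le s hb'.1).trans hb'.2)
  have hintg := integrable_cfc (μ := volume) (fun s b => q s * waveSymbol s b) (fun s => ‖q s‖)
    (invOneAdd A) (hc.mono (prod_mono subset_rfl hB.spectrum_subset))
    (Eventually.of_forall hbound) hqi.norm.2 hB.isSelfAdjoint
  rw [cfc_integral (fun s b => q s * waveSymbol s b) (fun s => ‖q s‖) (invOneAdd A)
    (hc.mono (prod_mono subset_rfl hB.spectrum_subset))
    (Eventually.of_forall hbound) hqi.norm.2 hB.isSelfAdjoint]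
  rw [ContinuousLinearMap.integral_apply hintg, ← integral_inner (hintg.apply_continuousLinearMap g)]
  refine integral_congr_ae (Eventually.of_forall fun s => ?_)
  have : cfc (fun b => q s * waveSymbol s b) (invOneAdd A) = q s • waveOp A s := by
    have hw : ContinuousOn (waveSymbol s) (Icc 0 1) :=
      continuousOn_waveSymbol.comp (Continuous.prodMk_right s).continuousOn
        fun _ hz => ⟨mem_univ s, hz⟩
    rw [waveOp, ← cfc_smul (q s) (waveSymbol s) (invOneAdd A) (hw.mono hB.spectrum_subset)]
    rfl
  simp only [this]
  change _ = inner ℂ u (q s • waveOp A s g)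
  rw [inner_smul_right_eq_smul, Complex.real_smul]

/-- Real part of the Fourier transform of a Gaussian. With `ν = √λ` it is the formula that writes
`exp (-t λ)` as a superposition of cosines. -/
theorem integral_exp_mul_cos {t : ℝ} (ht : 0 < t) (ν : ℝ) :
    ∫ s : ℝ, Real.exp (-s ^ 2 / (4 * t)) * Real.cos (s * ν) =
      2 * √(Real.pi * t) * Real.exp (-t * ν ^ 2) := by
  have hb : 0 < ((1 / (4 * t) : ℝ) : ℂ).re := by rw [Complex.ofReal_re]; positivity
  have h := fourierIntegral_gaussian hb (ν : ℂ)
  have hintg : Integrable fun x : ℝ => Complex.exp (Complex.I * ν * x) *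
      Complex.exp (-((1 / (4 * t) : ℝ) : ℂ) * x ^ 2) := by
    have := integrable_cexp_quadratic hb (Complex.I * ν) 0
    refine this.congr (Eventually.of_forall fun x => ?_)
    simp only [← Complex.exp_add]
    congr 1
    ring
  have h2 := congrArg Complex.re h
  rw [← RCLike.re_to_complex, ← integral_re hintg] at h2
  have e1 : ∀ x : ℝ, RCLike.re (Complex.exp (Complex.I * ν * x) *
      Complex.exp (-((1 / (4 * t) : ℝ) : ℂ) * x ^ 2)) =
      Real.exp (-x ^ 2 / (4 * t)) * Real.cos (x * ν) := by
    intro x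
    have a1 : Complex.I * ν * x = ((x * ν : ℝ) : ℂ) * Complex.I := by push_cast; ring
    have a2 : -((1 / (4 * t) : ℝ) : ℂ) * x ^ 2 = ((-x ^ 2 / (4 * t) : ℝ) : ℂ) := by
      push_cast; ring
    rw [a1, a2, ← Complex.ofReal_exp, RCLike.re_to_complex, mul_comm, Complex.re_ofReal_mul,
      Complex.exp_ofReal_mul_I_re]
  simp_rw [e1] at h2
  rw [h2]
  have a3 : (Real.pi / ((1 / (4 * t) : ℝ) : ℂ)) ^ (1 / 2 : ℂ) =
      ((2 * √(Real.pi * t) : ℝ) : ℂ) := by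
    have : (Real.pi / ((1 / (4 * t) : ℝ) : ℂ)) = ((4 * (Real.pi * t) : ℝ) : ℂ) := by
      push_cast; field_simp
    rw [this, show (1 / 2 : ℂ) = ((1 / 2 : ℝ) : ℂ) by push_cast; rfl,
      ← Complex.ofReal_cpow (by positivity), ← Real.sqrt_eq_rpow,
      Real.sqrt_mul (by norm_num), show (4 : ℝ) = 2 ^ 2 by norm_num, Real.sqrt_sq (by norm_num)]
  have a4 : -(ν : ℂ) ^ 2 / (4 * ((1 / (4 * t) : ℝ) : ℂ)) = ((-t * ν ^ 2 : ℝ) : ℂ) := by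
    push_cast; field_simp
  rw [a3, a4, ← Complex.ofReal_exp, ← Complex.ofReal_mul, Complex.ofReal_re]

theorem integrable_exp_neg_sq_div {t : ℝ} (ht : 0 < t) :
    Integrable fun s : ℝ => Real.exp (-s ^ 2 / (4 * t)) := by
  have := integrable_exp_neg_mul_sq (show 0 < 1 / (4 * t) by positivity)
  refine this.congr (Eventually.of_forall fun x => ?_)
  simp only
  congr 1
  ring

/-- The heat semigroup as a superposition of waves. -/
theorem integral_exp_mul_inner_waveOp (hA : IsNonnegSelfAdjoint A) {t : ℝ} (ht : 0 < t)
    (u g : H) :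
    ∫ s : ℝ, (Real.exp (-s ^ 2 / (4 * t)) : ℂ) * inner ℂ u (waveOp A s g) =
      ((2 * √(Real.pi * t) : ℝ) : ℂ) * inner ℂ u (heatSemigroup A t (invOneAdd A g)) := by
  have hB := isUnitInterval_invOneAdd hA
  rw [integral_mul_inner_waveOp hA (by fun_prop) (integrable_exp_neg_sq_div ht)]
  have : cfc (fun b => ∫ s : ℝ, Real.exp (-s ^ 2 / (4 * t)) * waveSymbol s b) (invOneAdd A) =
      (2 * √(Real.pi * t)) • (heatSemigroup A t * invOneAdd A) := by
    conv_rhs => enter [2, 2]; rw [← cfc_id ℝ (invOneAdd A) hB.isSelfAdjoint]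
    have hc := (continuousOn_heatSymbol_right 0 ht).mono hB.spectrum_subset
    rw [heatSemigroup_eq, ← cfc_mul _ _ _ hc continuousOn_id,
      ← cfc_smul _ (fun x => heatSymbol 0 t x * id x) _ (hc.mul continuousOn_id)]
    refine cfc_congr fun b hb => ?_
    have hb' := hB.spectrum_subset hb
    rcases hb'.1.eq_or_lt with rfl | h
    · simp [waveSymbol]
    · have h1 : 1 ≤ b⁻¹ := (one_le_inv₀ h).2 hb'.2
      simp only [waveSymbol, mul_left_comm _ b, integral_const_mul]
      rw [integral_exp_mul_cos ht, Real.sq_sqrt (by linarith)]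
      simp [heatSymbol, h]
      ring
  rw [this]
  change inner ℂ u ((2 * √(Real.pi * t)) • heatSemigroup A t (invOneAdd A g)) = _
  rw [inner_smul_right_eq_smul, Complex.real_smul]

theorem continuousOn_integral_waveSymbol {q : ℝ → ℝ} (hqi : Integrable q) :
    ContinuousOn (fun b => ∫ s, q s * waveSymbol s b) (Icc 0 1) := by
  refine continuousOn_of_dominated (bound := fun s => ‖q s‖) ?_ ?_ hqi.norm ?_
  · intro b _
    refine hqi.aestronglyMeasurable.mul (Continuous.aestronglyMeasurable ?_)
    unfold waveSymbol; fun_prop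
  · intro b hb
    refine Eventually.of_forall fun s => ?_
    rw [norm_mul]
    exact mul_le_of_le_one_right (norm_nonneg _) ((abs_waveSymbol_le s hb.1).trans hb.2)
  · refine Eventually.of_forall fun s => continuousOn_const.mul ?_
    exact continuousOn_waveSymbol.comp (Continuous.prodMk_right s).continuousOn
        fun _ hz => ⟨mem_univ s, hz⟩

/-- The form bound for a superposition of waves whose symbol is
`(1 + λ)⁻ᵐ ∫ r(s) cos (s √λ) ds`. -/
theorem norm_integral_mul_inner_waveOp_le (hA : IsNonnegSelfAdjoint A) {q r : ℝ → ℝ}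
    (hq : Continuous q) (hqi : Integrable q) (hri : Integrable r) {m : ℕ} (hm : 0 < m)
    (hqr : ∀ ν : ℝ, (1 + ν ^ 2) ^ m * ∫ s, q s * Real.cos (s * ν) = ∫ s, r s * Real.cos (s * ν))
    (u g : H) :
    ‖∫ s, (q s : ℂ) * inner ℂ u (waveOp A s g)‖ ≤ (∫ s, |r s|) *
      (√(inner ℂ u ((invOneAdd A ^ m) u)).re *
        √(inner ℂ (invOneAdd A g) ((invOneAdd A ^ m) (invOneAdd A g))).re) := by
  have hB := isUnitInterval_invOneAdd hA
  obtain ⟨n, rfl⟩ : ∃ n, m = n + 1 := ⟨m - 1, by omega⟩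
  -- One of the `m = n + 1` powers of `b` is already contained in `waveSymbol`. The power of `b` in
  -- the symbol of the `q` superposition is split off as the factor `(1 + A)⁻¹` that acts on `g`, so
  -- the form bound pairs `u` with `(1 + A)⁻¹ g`.
  set f : ℝ → ℝ := fun b => b ^ n * ∫ s, r s * waveSymbol s b with hf
  have hfc : ContinuousOn f (Icc 0 1) :=
    (continuous_pow n).continuousOn.mul (continuousOn_integral_waveSymbol hri)
  have e : cfc (fun b => ∫ s, q s * waveSymbol s b) (invOneAdd A) =
      cfc f (invOneAdd A) * invOneAdd A := by
    conv_rhs => enter [2]; rw [← cfc_id ℝ (invOneAdd A) hB.isSelfAdjoint]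
    rw [← cfc_mul _ _ _ (hfc.mono hB.spectrum_subset) continuousOn_id]
    refine cfc_congr fun b hb => ?_
    have hb' := hB.spectrum_subset hb
    rcases hb'.1.eq_or_lt with rfl | h
    · simp [waveSymbol]
    · have h1 : 1 ≤ b⁻¹ := (one_le_inv₀ h).2 hb'.2
      have h2 := hqr √(b⁻¹ - 1)
      rw [Real.sq_sqrt (by linarith)] at h2
      simp only [hf, waveSymbol, mul_left_comm _ b, integral_const_mul, id_eq]
      rw [← h2, add_sub_cancel, inv_pow]
      generalize (∫ s, q s * Real.cos (s * √(b⁻¹ - 1))) = I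
      field_simp
      ring
  rw [integral_mul_inner_waveOp hA hq hqi, e]
  change ‖inner ℂ u (cfc f (invOneAdd A) (invOneAdd A g))‖ ≤ _
  set M := ∫ s, |r s|
  have hM : 0 ≤ M := integral_nonneg fun s => abs_nonneg _
  have hbd : ∀ b ∈ Icc (0 : ℝ) 1, |f b| ≤ M * b ^ (n + 1) := by
    intro b hb
    have : |∫ s, r s * waveSymbol s b| ≤ M * b := by
      rw [← Real.norm_eq_abs]
      refine (norm_integral_le_of_norm_le (hri.norm.mul_const b)
        (Eventually.of_forall fun s => ?_)).trans_eq ?_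
      · rw [norm_mul]
        exact mul_le_mul_of_nonneg_left (abs_waveSymbol_le s hb.1) (norm_nonneg _)
      · rw [integral_mul_const]; rfl
    rw [hf, abs_mul, abs_of_nonneg (pow_nonneg hb.1 n), pow_succ]
    calc b ^ n * |∫ s, r s * waveSymbol s b| ≤ b ^ n * (M * b) :=
          mul_le_mul_of_nonneg_left this (pow_nonneg hb.1 n)
      _ = _ := by ring
  have h := hB.norm_inner_cfc_le hfc (by fun_prop) hbd u (invOneAdd A g)
  have hp : cfc (fun b : ℝ => M * b ^ (n + 1)) (invOneAdd A) = M • invOneAdd A ^ (n + 1) := by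
    rw [cfc_const_mul M _ _, cfc_pow_id (R := ℝ) (invOneAdd A) (n + 1) hB.isSelfAdjoint]
  rw [hp] at h
  have hr : ∀ v : H, (inner ℂ v ((M • invOneAdd A ^ (n + 1)) v)).re =
      M * (inner ℂ v ((invOneAdd A ^ (n + 1)) v)).re := by
    intro v
    change (inner ℂ v (M • (invOneAdd A ^ (n + 1)) v)).re = _
    rw [inner_smul_right_eq_smul, Complex.real_smul, Complex.re_ofReal_mul]
  rw [hr, hr, Real.sqrt_mul hM, Real.sqrt_mul hM] at h
  refine h.trans_eq ?_
  linear_combination (√(inner ℂ u ((invOneAdd A ^ (n + 1)) u)).re *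
        √(inner ℂ (invOneAdd A g) ((invOneAdd A ^ (n + 1)) (invOneAdd A g))).re) * Real.mul_self_sqrt hM

/-- The fractional power `(1 + A)^{-α}`. -/
def invOneAddRpow (A : H →ₗ.[ℂ] H) (α : ℝ) : H →L[ℂ] H := cfc (fun b : ℝ => b ^ α) (invOneAdd A)

/-- This exhibits `(1 + A)^(-m)` as the square of a self-adjoint operator, as the construction of
its kernel requires. -/
theorem invOneAddRpow_mul_self (hA : IsNonnegSelfAdjoint A) {m : ℕ} (_hm : 0 < m) :
    invOneAddRpow A (m / 2) * invOneAddRpow A (m / 2) = invOneAdd A ^ m := by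
  have hB := isUnitInterval_invOneAdd hA
  have hc : ContinuousOn (fun b : ℝ => b ^ (m / 2 : ℝ)) (spectrum ℝ (invOneAdd A)) :=
    (Real.continuous_rpow_const (by positivity)).continuousOn
  rw [invOneAddRpow, ← cfc_mul _ _ _ hc hc, ← cfc_pow_id (R := ℝ) (invOneAdd A) m hB.isSelfAdjoint]
  refine cfc_congr fun b hb => ?_
  rw [← Real.mul_rpow (hB.spectrum_subset hb).1 (hB.spectrum_subset hb).1, ← pow_two,
    ← Real.rpow_natCast, ← Real.rpow_mul (hB.spectrum_subset hb).1, ← Real.rpow_natCast]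
  congr 1
  push_cast
  ring

/-- Fractional powers as Laplace transforms of the heat semigroup. -/
theorem integral_rpow_mul_inner_heatSemigroup (hA : IsNonnegSelfAdjoint A) {α : ℝ} (hα : 0 < α)
    (u g : H) :
    ∫ t in Ioi (0 : ℝ), ((t ^ (α - 1) * Real.exp (-t) : ℝ) : ℂ) * inner ℂ u (heatSemigroup A t g) =
      (Real.Gamma α : ℂ) * inner ℂ u (invOneAddRpow A α g) := by
  have hB := isUnitInterval_invOneAdd hA
  have hc : ContinuousOn (Function.uncurry fun t b => t ^ (α - 1) * Real.exp (-t) *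
      heatSymbol 0 t b) (Ioi 0 ×ˢ Icc 0 1) := by
    refine ContinuousOn.mul ?_ (continuousOn_heatSymbol 0)
    intro p hp
    have : p.1 ≠ 0 := (mem_Ioi.1 hp.1).ne'
    have : ContinuousAt (fun p : ℝ × ℝ => p.1 ^ (α - 1) * Real.exp (-p.1)) p :=
      (continuousAt_fst.rpow_const (Or.inl this)).mul (by fun_prop)
    exact this.continuousWithinAt
  have hw : IntegrableOn (fun t : ℝ => t ^ (α - 1) * Real.exp (-t)) (Ioi 0) := by
    simpa [mul_comm] using Real.GammaIntegral_convergent hα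
  have hbound : ∀ᵐ t ∂volume.restrict (Ioi (0 : ℝ)), ∀ b ∈ spectrum ℝ (invOneAdd A),
      ‖t ^ (α - 1) * Real.exp (-t) * heatSymbol 0 t b‖ ≤ ‖t ^ (α - 1) * Real.exp (-t)‖ := by
    refine (ae_restrict_iff' measurableSet_Ioi).2 (Eventually.of_forall fun t ht b hb => ?_)
    rw [norm_mul]
    exact mul_le_of_le_one_right (norm_nonneg _)
      (heatSymbol_zero_le_one (le_of_lt ht) (hB.spectrum_subset hb))
  have hintg := integrableOn_cfc (μ := volume) measurableSet_Ioi
    (fun t b => t ^ (α - 1) * Real.exp (-t) * heatSymbol 0 t b)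
    (fun t => ‖t ^ (α - 1) * Real.exp (-t)‖)
    (invOneAdd A) (hc.mono (prod_mono subset_rfl hB.spectrum_subset))
    hbound hw.norm.2 hB.isSelfAdjoint
  have key := cfc_setIntegral (μ := volume) measurableSet_Ioi
    (fun t b => t ^ (α - 1) * Real.exp (-t) * heatSymbol 0 t b)
    (fun t => ‖t ^ (α - 1) * Real.exp (-t)‖)
    (invOneAdd A) (hc.mono (prod_mono subset_rfl hB.spectrum_subset))
    hbound hw.norm.2 hB.isSelfAdjoint
  have hl : cfc (fun b => ∫ t in Ioi (0 : ℝ), t ^ (α - 1) * Real.exp (-t) * heatSymbol 0 t b)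
      (invOneAdd A) = Real.Gamma α • invOneAddRpow A α := by
    rw [invOneAddRpow, ← cfc_smul _ _ _ (Real.continuous_rpow_const hα.le).continuousOn]
    refine cfc_congr fun b hb => ?_
    have hb' := hB.spectrum_subset hb
    rcases hb'.1.eq_or_lt with rfl | h
    · simp [heatSymbol, hα.ne']
    · simp only [heatSymbol, h, if_true, pow_zero, one_mul, smul_eq_mul]
      rw [mul_comm (Real.Gamma α)]
      have := Real.integral_rpow_mul_exp_neg_mul_Ioi hα (inv_pos.2 h)
      rw [one_div, inv_inv] at this
      rw [← this]
      refine integral_congr_ae (Eventually.of_forall fun t => ?_)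
      simp only [mul_assoc, ← Real.exp_add]
      congr 2
      ring
  rw [hl] at key
  have key2 : (Real.Gamma α : ℂ) * inner ℂ u (invOneAddRpow A α g) =
      inner ℂ u ((Real.Gamma α • invOneAddRpow A α) g) := by
    change _ = inner ℂ u (Real.Gamma α • invOneAddRpow A α g)
    rw [inner_smul_right_eq_smul, Complex.real_smul]
  rw [key2, key, ContinuousLinearMap.integral_apply hintg,
    ← integral_inner (hintg.integrable.apply_continuousLinearMap g)]
  refine setIntegral_congr_fun measurableSet_Ioi fun t ht => ?_
  have : cfc (fun b => t ^ (α - 1) * Real.exp (-t) * heatSymbol 0 t b) (invOneAdd A) =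
      (t ^ (α - 1) * Real.exp (-t)) • heatSemigroup A t := by
    rw [heatSemigroup_eq, ← cfc_smul _ (heatSymbol 0 t) (invOneAdd A)
      ((continuousOn_heatSymbol_right 0 ht).mono hB.spectrum_subset)]
    rfl
  simp only [this]
  change _ = inner ℂ u ((t ^ (α - 1) * Real.exp (-t)) • heatSemigroup A t g)
  rw [inner_smul_right_eq_smul, Complex.real_smul]

end Wave
end

/-! ### A uniqueness theorem for Laplace transforms -/

section

open Filter Topology

section LaplaceUniqueness

/-- Without the constant term only the powers `y ^ (k + 1)` remain, and each of them is a decaying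
Gaussian in `s` when `y = exp ((n + 1) (r² - s²))`. -/
theorem hasSum_one_sub_exp_neg (y : ℝ) :
    HasSum (fun k : ℕ => (-1) ^ k * y ^ (k + 1) / (k + 1).factorial) (1 - Real.exp (-y)) := by
  have h := NormedSpace.expSeries_div_hasSum_exp (-y)
  rw [← Real.exp_eq_exp_ℝ] at h
  have h2 := ((hasSum_nat_add_iff' 1).2 h).neg
  simp only [Finset.range_one, Finset.sum_singleton, pow_zero, Nat.factorial_zero, Nat.cast_one,
    div_one, neg_sub] at h2
  refine h2.congr_fun ?_
  intro k
  rw [neg_pow y, pow_succ (-1 : ℝ)]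
  ring

theorem one_sub_exp_neg_le {y : ℝ} : 1 - Real.exp (-y) ≤ y := by
  linarith [Real.add_one_le_exp (-y)]

/-- An even bounded continuous function whose Gaussian averages decay like `exp (-p L²)` vanishes
on `(-L, L)`. -/
theorem eq_zero_of_gaussian_integral_le {W : ℝ → ℂ} {M C L : ℝ} (hW : Continuous W)
    (hM : ∀ s, ‖W s‖ ≤ M) (heven : ∀ s, W (-s) = W s)
    (hC : ∀ p : ℝ, 1 ≤ p → ‖∫ s : ℝ, (Real.exp (-p * s ^ 2) : ℂ) * W s‖ ≤ C * Real.exp (-p * L ^ 2))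
    {s : ℝ} (hs : |s| < L) : W s = 0 := by
  have hL : 0 < L := (abs_nonneg s).trans_lt hs
  have hM0 : 0 ≤ M := (norm_nonneg _).trans (hM 0)
  have hgauss : Integrable fun s : ℝ => Real.exp (-s ^ 2) := by
    simpa using integrable_exp_neg_mul_sq one_pos
  have key : ∀ r : ℝ, 0 < r → r < L → ∫ s in (-r)..r, W s = 0 := by
    intro r hr hrL
    -- Smoothed indicator functions of `[-r, r]`: the inner exponential tends to `∞` inside the
    -- interval and to `0` outside. They are chosen because they expand into Gaussians in `s`, whose
    -- averages against `W` are controlled by hypothesis. The shift `n + 1` keeps every rate at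
    -- least `1`, which gives the domination by `exp (-s²)` and makes the hypothesis applicable.
    set f : ℕ → ℝ → ℝ := fun n s => 1 - Real.exp (-Real.exp ((n + 1 : ℝ) * (r ^ 2 - s ^ 2))) with hf
    have hf0 : ∀ n s, 0 ≤ f n s := fun n s => by
      simp only [hf, sub_nonneg, Real.exp_le_one_iff, neg_nonpos]; positivity
    have hbound : ∀ n s, f n s ≤ Real.exp (r ^ 2) * Real.exp (-s ^ 2) := by
      intro n s
      rw [← Real.exp_add, ← sub_eq_add_neg]
      rcases le_total (s ^ 2) (r ^ 2) with h | h
      · calc f n s ≤ 1 := by simp only [hf]; linarith [Real.exp_pos (-Real.exp ((n + 1 : ℝ) * (r ^ 2 - s ^ 2)))]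
          _ ≤ _ := Real.one_le_exp (by linarith)
      · refine one_sub_exp_neg_le.trans (Real.exp_le_exp.2 ?_)
        have : (0 : ℝ) ≤ n := n.cast_nonneg
        nlinarith
    have hfc : ∀ n, Continuous (f n) := fun n => by fun_prop
    -- the limit of the smoothed truncations
    have hlim1 : Tendsto (fun n => ∫ s, (f n s : ℂ) * W s) atTop
        (𝓝 (∫ s, (Icc (-r) r).indicator W s)) := by
      refine tendsto_integral_of_dominated_convergence
        (fun s => Real.exp (r ^ 2) * Real.exp (-s ^ 2) * M) ?_ ?_ ?_ ?_
      · intro n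
        have := hfc n
        exact Continuous.aestronglyMeasurable (by fun_prop)
      · exact (hgauss.const_mul _).mul_const _
      · intro n
        refine Eventually.of_forall fun s => ?_
        rw [norm_mul, Complex.norm_real, Real.norm_of_nonneg (hf0 n s)]
        exact mul_le_mul (hbound n s) (hM s) (norm_nonneg _) (by positivity)
      · have hne : ∀ᵐ s : ℝ, s ≠ r ∧ s ≠ -r := by
          rw [eventually_and]; exact ⟨Measure.ae_ne _ _, Measure.ae_ne _ _⟩
        filter_upwards [hne] with s hs
        have hn1 : Tendsto (fun n : ℕ => (n + 1 : ℝ)) atTop atTop :=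
          tendsto_natCast_atTop_atTop.atTop_add tendsto_const_nhds
        by_cases h : s ∈ Icc (-r) r
        · have hlt : 0 < r ^ 2 - s ^ 2 := by
            have h1 : -r < s := lt_of_le_of_ne h.1 (Ne.symm hs.2)
            have h2 : s < r := lt_of_le_of_ne h.2 hs.1
            nlinarith
          rw [indicator_of_mem h]
          have : Tendsto (fun n => f n s) atTop (𝓝 (1 - 0)) :=
            tendsto_const_nhds.sub (Real.tendsto_exp_neg_atTop_nhds_zero.comp
              (Real.tendsto_exp_atTop.comp (hn1.atTop_mul_const hlt)))
          have h3 := ((Complex.continuous_ofReal.tendsto _).comp this).mul_const (W s)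
          simpa using h3
        · have hlt : r ^ 2 - s ^ 2 < 0 := by
            rw [mem_Icc, not_and_or, not_le, not_le] at h
            rcases h with h | h <;> nlinarith
          rw [indicator_of_notMem h]
          have : Tendsto (fun n => f n s) atTop (𝓝 (1 - Real.exp (-0))) :=
            tendsto_const_nhds.sub ((Real.continuous_exp.tendsto _).comp
              (Tendsto.neg (Real.tendsto_exp_atBot.comp (hn1.atTop_mul_const_of_neg hlt))))
          have h3 := ((Complex.continuous_ofReal.tendsto _).comp this).mul_const (W s)
          simpa using h3
    -- the bound from the exponential series
    have hbd : ∀ n : ℕ, ‖∫ s, (f n s : ℂ) * W s‖ ≤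
        |C| * (Real.exp (Real.exp ((n + 1 : ℝ) * (r ^ 2 - L ^ 2))) - 1) := by
      intro n
      -- Coefficients of the expansion of `f n` into the Gaussians `exp (-(k + 1) (n + 1) s²)`. The
      -- factorials make the series absolutely summable, so it may be integrated term by term.
      set c : ℕ → ℝ := fun k => (-1) ^ k * Real.exp ((k + 1) * (n + 1) * r ^ 2) / (k + 1).factorial with hc
      set F : ℕ → ℝ → ℂ := fun k s => (c k : ℂ) * ((Real.exp (-((k + 1) * (n + 1)) * s ^ 2) : ℂ) * W s)
        with hF
      have hn0 : (0 : ℝ) ≤ n := n.cast_nonneg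
      have hcabs : ∀ k, |c k| = Real.exp ((n + 1) * r ^ 2) ^ (k + 1) / (k + 1).factorial := by
        intro k
        simp only [hc]
        rw [abs_div, abs_mul, abs_pow, abs_neg, abs_one, one_pow, one_mul, Real.abs_exp,
          Nat.abs_cast, ← Real.exp_nat_mul]
        push_cast; congr 2; ring
      have hp1 : ∀ k : ℕ, (1 : ℝ) ≤ (k + 1) * (n + 1) := by
        intro k
        have : (0 : ℝ) ≤ k := k.cast_nonneg
        nlinarith [mul_nonneg this hn0]
      have hFint : ∀ k, Integrable (F k) := by
        intro k
        refine Integrable.const_mul ?_ _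
        refine Integrable.mul_bdd (c := M) ?_ hW.aestronglyMeasurable (Eventually.of_forall hM)
        exact (integrable_exp_neg_mul_sq (by linarith [hp1 k])).ofReal
      have hFnorm : ∀ k, ∫ s, ‖F k s‖ ≤ |c k| * (M * ∫ s : ℝ, Real.exp (-s ^ 2)) := by
        intro k
        rw [← integral_const_mul, ← integral_const_mul]
        refine integral_mono (hFint k).norm ((hgauss.const_mul _).const_mul _) fun s => ?_
        simp only [hF, norm_mul, Complex.norm_real, Real.norm_eq_abs, Real.abs_exp]
        refine mul_le_mul_of_nonneg_left ?_ (abs_nonneg _)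
        rw [mul_comm]
        refine mul_le_mul (hM s) (Real.exp_le_exp.2 ?_) (Real.exp_pos _).le hM0
        nlinarith [sq_nonneg s, hp1 k]
      have hcsum : Summable fun k => |c k| := by
        simp_rw [hcabs]
        exact (summable_nat_add_iff 1).2 (Real.summable_pow_div_factorial _)
      have hsum : Summable fun k => ∫ s, ‖F k s‖ :=
        Summable.of_nonneg_of_le (fun k => integral_nonneg fun s => norm_nonneg _) hFnorm
          (hcsum.mul_right _)
      have hser := hasSum_integral_of_summable_integral_norm hFint hsum
      have hpt : ∀ s, ∑' k, F k s = (f n s : ℂ) * W s := by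
        intro s
        have h := (Complex.hasSum_ofReal.2 (hasSum_one_sub_exp_neg
          (Real.exp ((n + 1 : ℝ) * (r ^ 2 - s ^ 2))))).mul_right (W s)
        refine HasSum.tsum_eq (h.congr_fun fun k => ?_)
        simp only [hF, hc]
        rw [← mul_assoc, ← Complex.ofReal_mul]
        congr 2
        rw [← Real.exp_nat_mul, div_mul_eq_mul_div, mul_assoc, ← Real.exp_add]
        push_cast; congr 3; ring
      simp_rw [hpt] at hser
      rw [← hser.tsum_eq]
      -- The hypothesis with `p = (k + 1) (n + 1)` changes `r²` in the exponent of the coefficient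
      -- into `r² - L² < 0`. The sum of these bounds is again an exponential series, and it tends to
      -- `0` as `n → ∞`.
      have hterm : ∀ k, ‖∫ s, F k s‖ ≤
          |C| * (Real.exp ((n + 1 : ℝ) * (r ^ 2 - L ^ 2)) ^ (k + 1) / (k + 1).factorial) := by
        intro k
        simp only [hF]
        rw [integral_const_mul, norm_mul, Complex.norm_real, Real.norm_eq_abs, hcabs]
        have h1 := (hC _ (hp1 k)).trans (mul_le_mul_of_nonneg_right (le_abs_self C) (Real.exp_pos _).le)
        refine (mul_le_mul_of_nonneg_left h1 (by positivity)).trans_eq ?_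
        rw [← Real.exp_nat_mul, ← Real.exp_nat_mul, div_mul_eq_mul_div, mul_left_comm,
          ← Real.exp_add, mul_div_assoc]
        push_cast; congr 3; ring
      have hE := NormedSpace.expSeries_div_hasSum_exp
        (Real.exp ((n + 1 : ℝ) * (r ^ 2 - L ^ 2)))
      rw [← Real.exp_eq_exp_ℝ] at hE
      have hE2 := ((hasSum_nat_add_iff' 1).2 hE).mul_left |C|
      simp only [Finset.range_one, Finset.sum_singleton, pow_zero, Nat.factorial_zero,
        Nat.cast_one, div_one] at hE2
      exact tsum_of_norm_bounded hE2 hterm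
    have hlim2 : Tendsto (fun n : ℕ =>
        |C| * (Real.exp (Real.exp ((n + 1 : ℝ) * (r ^ 2 - L ^ 2))) - 1)) atTop (𝓝 0) := by
      have hn1 : Tendsto (fun n : ℕ => (n + 1 : ℝ)) atTop atTop :=
        tendsto_natCast_atTop_atTop.atTop_add tendsto_const_nhds
      have hlt : r ^ 2 - L ^ 2 < 0 := by nlinarith
      have h1 := (Real.continuous_exp.tendsto _).comp
        (Real.tendsto_exp_atBot.comp (hn1.atTop_mul_const_of_neg hlt))
      have h2 := (h1.sub_const 1).const_mul |C|
      simpa using h2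
    have h0 := tendsto_nhds_unique hlim1 (squeeze_zero_norm hbd hlim2)
    rw [integral_indicator measurableSet_Icc] at h0
    rw [intervalIntegral.integral_of_le (by linarith), ← integral_Icc_eq_integral_Ioc, h0]
  have hintg : ∀ a b, IntervalIntegrable W volume a b := fun a b => hW.intervalIntegrable a b
  -- Evenness halves the symmetric interval; differentiating in the endpoint `r` then gives the
  -- vanishing of `W` itself.
  have key2 : ∀ r : ℝ, 0 < r → r < L → ∫ s in (0 : ℝ)..r, W s = 0 := by
    intro r hr hrL
    have h1 := key r hr hrL
    rw [← intervalIntegral.integral_add_adjacent_intervals (hintg (-r) 0) (hintg 0 r)] at h1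
    have h2 : ∫ s in (-r)..0, W s = ∫ s in (0 : ℝ)..r, W s := by
      have := intervalIntegral.integral_comp_neg (a := (0 : ℝ)) (b := r) W
      simp only [heven, neg_zero] at this
      exact this.symm
    rw [h2, ← two_mul] at h1
    simpa using h1
  have key3 : ∀ r : ℝ, 0 < r → r < L → W r = 0 := by
    intro r hr hrL
    have h1 : HasDerivAt (fun u => ∫ s in (0 : ℝ)..u, W s) (W r) r :=
      intervalIntegral.integral_hasDerivAt_right (hintg 0 r)
        (hW.stronglyMeasurableAtFilter _ _) hW.continuousAt
    have h2 : (fun u => ∫ s in (0 : ℝ)..u, W s) =ᶠ[𝓝 r] fun _ => 0 := by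
      filter_upwards [Ioo_mem_nhds hr hrL] with u hu
      exact key2 u hu.1 hu.2
    exact (h1.congr_of_eventuallyEq h2.symm).unique (hasDerivAt_const r 0)
  have hW' : W s = W |s| := by
    rcases abs_choice s with h | h <;> rw [h]
    exact (heven s).symm
  rw [hW']
  rcases (abs_nonneg s).eq_or_lt with h | h
  · have hcl : (0 : ℝ) ∈ closure (Ioo 0 L) := by
      rw [closure_Ioo hL.ne]; exact ⟨le_rfl, hL.le⟩
    have : EqOn W (fun _ => 0) (closure (Ioo 0 L)) :=
      EqOn.closure (fun r hr => key3 r hr.1 hr.2) hW continuous_const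
    rw [← h]; exact this hcl
  · exact key3 _ h hs

end LaplaceUniqueness

/-! ### Integration by parts for `(1 - d²/ds²)^m` against cosines -/

section IntegrationByParts

/-- `g` is `k` times differentiable, and its derivatives of order up to `k` are integrable. -/
def IntegrableDerivs : ℕ → (ℝ → ℝ) → Prop
  | 0, g => Continuous g ∧ Integrable g
  | k + 1, g => Differentiable ℝ g ∧ Integrable g ∧ IntegrableDerivs k (deriv g)

theorem IntegrableDerivs.integrable {k : ℕ} {g : ℝ → ℝ} (h : IntegrableDerivs k g) :
    Integrable g := by
  cases k with
  | zero => exact h.2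
  | succ k => exact h.2.1

theorem IntegrableDerivs.continuous {k : ℕ} {g : ℝ → ℝ} (h : IntegrableDerivs k g) :
    Continuous g := by
  cases k with
  | zero => exact h.1
  | succ k => exact h.1.continuous

theorem IntegrableDerivs.pred {k : ℕ} {g : ℝ → ℝ} (h : IntegrableDerivs (k + 1) g) :
    IntegrableDerivs k g := by
  induction k generalizing g with
  | zero => exact ⟨h.1.continuous, h.2.1⟩
  | succ k ih => exact ⟨h.1, h.2.1, ih h.2.2⟩

theorem IntegrableDerivs.sub {k : ℕ} {f g : ℝ → ℝ} (hf : IntegrableDerivs k f)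
    (hg : IntegrableDerivs k g) : IntegrableDerivs k (fun s => f s - g s) := by
  induction k generalizing f g with
  | zero => exact ⟨hf.1.sub hg.1, hf.2.sub hg.2⟩
  | succ k ih =>
    refine ⟨hf.1.sub hg.1, hf.2.1.sub hg.2.1, ?_⟩
    have : deriv (fun s => f s - g s) = fun s => deriv f s - deriv g s := by
      ext s; exact deriv_fun_sub (hf.1 s) (hg.1 s)
    rw [this]
    exact ih hf.2.2 hg.2.2

theorem integrableDerivs_of_hasCompactSupport {k : ℕ} {g : ℝ → ℝ} (hg : ContDiff ℝ k g)
    (hs : HasCompactSupport g) : IntegrableDerivs k g := by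
  induction k generalizing g with
  | zero => exact ⟨hg.continuous, hg.continuous.integrable_of_hasCompactSupport hs⟩
  | succ k ih =>
    push_cast at hg
    obtain ⟨h1, -, h2⟩ := contDiff_succ_iff_deriv.1 hg
    exact ⟨h1, hg.continuous.integrable_of_hasCompactSupport hs, ih h2 hs.deriv⟩

/-- The polynomial factor makes the class of functions stable under differentiation, so that the
induction closes; only `P = 1` is needed later. -/
theorem integrableDerivs_polynomial_mul_exp {t : ℝ} (ht : 0 < t) (k : ℕ) (P : Polynomial ℝ) :
    IntegrableDerivs k fun s => P.eval s * Real.exp (-s ^ 2 / (4 * t)) := by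
  have hintg : ∀ P : Polynomial ℝ, Integrable fun s => P.eval s * Real.exp (-s ^ 2 / (4 * t)) := by
    intro P
    have hb : 0 < 1 / (4 * t) := by positivity
    induction P using Polynomial.induction_on' with
    | add p q hp hq => 
      refine (Integrable.add hp hq).congr (Eventually.of_forall fun s => ?_)
      simp [add_mul]
    | monomial n a =>
      have h := (integrable_rpow_mul_exp_neg_mul_sq hb (s := (n : ℝ))
        (lt_of_lt_of_le (by norm_num) n.cast_nonneg)).const_mul a
      refine h.congr (Eventually.of_forall fun s => ?_)
      simp only [Polynomial.eval_monomial, Real.rpow_natCast, mul_assoc]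
      congr 3
      ring
  have hd : ∀ (P : Polynomial ℝ) (s : ℝ),
      HasDerivAt (fun s => P.eval s * Real.exp (-s ^ 2 / (4 * t)))
        ((Polynomial.derivative P - Polynomial.C (1 / (2 * t)) * Polynomial.X * P).eval s *
          Real.exp (-s ^ 2 / (4 * t))) s := by
    intro P s
    have h1 := ((hasDerivAt_pow 2 s).neg.div_const (4 * t)).exp
    refine ((P.hasDerivAt s).mul h1).congr_deriv ?_
    simp only [Polynomial.eval_sub, Polynomial.eval_mul, Polynomial.eval_C, Polynomial.eval_X,
      Pi.neg_apply]
    push_cast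
    field_simp
    ring
  induction k generalizing P with
  | zero => exact ⟨by fun_prop, hintg P⟩
  | succ k ih =>
    refine ⟨fun s => (hd P s).differentiableAt, hintg P, ?_⟩
    rw [show deriv (fun s => P.eval s * Real.exp (-s ^ 2 / (4 * t))) = _ from
      funext fun s => (hd P s).deriv]
    exact ih _

theorem IntegrableDerivs.one_sub_deriv_sq {k : ℕ} {g : ℝ → ℝ} (hg : IntegrableDerivs (k + 2) g) :
    IntegrableDerivs k (fun s => g s - deriv (deriv g) s) :=
  hg.pred.pred.sub hg.2.2.2.2

/-- Two integrations by parts. Integrability of the functions and of their derivatives makes the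
boundary terms at infinity disappear. -/
theorem IntegrableDerivs.integral_one_sub_deriv_sq_mul_cos {k : ℕ} {g : ℝ → ℝ}
    (hg : IntegrableDerivs (k + 2) g) (ν : ℝ) :
    ∫ s, (g s - deriv (deriv g) s) * Real.cos (s * ν) =
      (1 + ν ^ 2) * ∫ s, g s * Real.cos (s * ν) := by
  have hcos : ∀ s, HasDerivAt (fun s => Real.cos (s * ν)) (-Real.sin (s * ν) * ν) s := fun s => by
    simpa using ((hasDerivAt_id s).mul_const ν).cos
  have hsin : ∀ s, HasDerivAt (fun s => Real.sin (s * ν)) (Real.cos (s * ν) * ν) s := fun s => by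
    simpa using ((hasDerivAt_id s).mul_const ν).sin
  have bc : ∀ {f : ℝ → ℝ}, Integrable f → Integrable fun s => f s * Real.cos (s * ν) := fun hf =>
    hf.mul_bdd (c := 1) (Continuous.aestronglyMeasurable (by fun_prop))
      (Eventually.of_forall fun s => Real.abs_cos_le_one _)
  have bs : ∀ {f : ℝ → ℝ}, Integrable f → Integrable fun s => f s * Real.sin (s * ν) := fun hf =>
    hf.mul_bdd (c := 1) (Continuous.aestronglyMeasurable (by fun_prop))
      (Eventually.of_forall fun s => Real.abs_sin_le_one _)
  have i0 := hg.integrable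
  have i1 := hg.2.2.integrable
  have i2 := hg.2.2.2.2.integrable
  have p1 := integral_mul_deriv_eq_deriv_mul_of_integrable
    (u := fun s => Real.cos (s * ν)) (v := deriv g)
    (u' := fun s => -Real.sin (s * ν) * ν) (v' := deriv (deriv g))
    (fun s _ => hcos s) (fun s _ => (hg.2.2.1 s).hasDerivAt)
    (by simpa [mul_comm, Pi.mul_def] using bc i2)
    (by simpa [mul_comm, mul_assoc, mul_left_comm, Pi.mul_def] using ((bs i1).mul_const ν).neg)
    (by simpa [mul_comm, Pi.mul_def] using bc i1)
  have p2 := integral_mul_deriv_eq_deriv_mul_of_integrable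
    (u := fun s => Real.sin (s * ν)) (v := g)
    (u' := fun s => Real.cos (s * ν) * ν) (v' := deriv g)
    (fun s _ => hsin s) (fun s _ => (hg.1 s).hasDerivAt)
    (by simpa [mul_comm, Pi.mul_def] using bs i1)
    (by simpa [mul_comm, mul_assoc, mul_left_comm, Pi.mul_def] using (bc i0).mul_const ν)
    (by simpa [mul_comm, Pi.mul_def] using bs i0)
  simp only [sub_mul]
  rw [integral_sub (bc i0) (bc i2)]
  have e1 : ∫ s, deriv (deriv g) s * Real.cos (s * ν) = ν * ∫ s, deriv g s * Real.sin (s * ν) := by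
    rw [← integral_const_mul]
    calc ∫ s, deriv (deriv g) s * Real.cos (s * ν)
        = ∫ s, Real.cos (s * ν) * deriv (deriv g) s := by simp only [mul_comm]
      _ = _ := by
        rw [p1, ← integral_neg]
        refine integral_congr_ae (Eventually.of_forall fun s => ?_)
        simp only; ring
  have e2 : ∫ s, deriv g s * Real.sin (s * ν) = -ν * ∫ s, g s * Real.cos (s * ν) := by
    rw [← integral_const_mul]
    calc ∫ s, deriv g s * Real.sin (s * ν)
        = ∫ s, Real.sin (s * ν) * deriv g s := by simp only [mul_comm]
      _ = _ := by
        rw [p2, ← integral_neg]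
        refine integral_congr_ae (Eventually.of_forall fun s => ?_)
        simp only; ring
  rw [e1, e2]
  ring

/-- Each application of `1 - d²/ds²` multiplies the cosine transform by `1 + ν²`. This gain of decay
in the spectral parameter is paid for by the `L¹` norm of the differentiated weight. -/
theorem IntegrableDerivs.oneSubDerivSq {m : ℕ} {g : ℝ → ℝ} (hg : IntegrableDerivs (2 * m) g) :
    Integrable (oneSubDerivSq m g) ∧ ∀ ν : ℝ, (1 + ν ^ 2) ^ m * ∫ s, g s * Real.cos (s * ν) =
      ∫ s, NotFeeling.oneSubDerivSq m g s * Real.cos (s * ν) := by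
  induction m generalizing g with
  | zero => exact ⟨hg.integrable, fun ν => by simp [NotFeeling.oneSubDerivSq]⟩
  | succ m ih =>
    have h := ih (g := fun s => g s - deriv (deriv g) s) (IntegrableDerivs.one_sub_deriv_sq hg)
    refine ⟨h.1, fun ν => ?_⟩
    have h2 := h.2 ν
    rw [IntegrableDerivs.integral_one_sub_deriv_sq_mul_cos hg] at h2
    rw [pow_succ, mul_assoc, h2]
    rfl

/-- The weight is the Gaussian minus `(1 - θ)` times the Gaussian. The first has integrable
derivatives of all orders, the second is compactly supported and of class `C^{2m}`. -/
theorem integrableDerivs_cutoff {m : ℕ} {θ : ℝ → ℝ} (hθ : ContDiff ℝ (2 * m : ℕ) θ)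
    (hs : HasCompactSupport fun s => 1 - θ s) {t : ℝ} (ht : 0 < t) :
    IntegrableDerivs (2 * m) fun s => θ s * Real.exp (-s ^ 2 / (4 * t)) := by
  have h1 := integrableDerivs_polynomial_mul_exp ht (2 * m) 1
  have h2 : IntegrableDerivs (2 * m) fun s => (1 - θ s) * Real.exp (-s ^ 2 / (4 * t)) :=
    integrableDerivs_of_hasCompactSupport
      ((contDiff_const.sub hθ).mul (by fun_prop)) hs.mul_right
  convert h1.sub h2 using 2 with s
  simp only [Polynomial.eval_one]
  ring

end IntegrationByParts
end

/-! ### The heat equation and the commutator with a cutoff function -/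

section

open Filter Topology

section HeatKernelCalculus

variable {d : ℕ}

theorem laplacian_mul {f g : EuclideanSpace ℝ (Fin d) → ℝ} (hf : ContDiff ℝ 2 f)
    (hg : ContDiff ℝ 2 g) (z : EuclideanSpace ℝ (Fin d)) :
    Laplacian.laplacian (fun z => f z * g z) z = f z * Laplacian.laplacian g z +
      2 * ∑ i, fderiv ℝ f z (EuclideanSpace.basisFun (Fin d) ℝ i) *
        fderiv ℝ g z (EuclideanSpace.basisFun (Fin d) ℝ i) + g z * Laplacian.laplacian f z := by
  have hf1 : Differentiable ℝ f := hf.differentiable (by norm_num)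
  have hg1 : Differentiable ℝ g := hg.differentiable (by norm_num)
  have hf2 : Differentiable ℝ (fderiv ℝ f) :=
    (hf.fderiv_right (m := 1) (by norm_num)).differentiable (by norm_num)
  have hg2 : Differentiable ℝ (fderiv ℝ g) :=
    (hg.fderiv_right (m := 1) (by norm_num)).differentiable (by norm_num)
  have h1 : fderiv ℝ (fun z => f z * g z) = fun z => f z • fderiv ℝ g z + g z • fderiv ℝ f z := by
    ext1 z; exact fderiv_fun_mul (hf1 z) (hg1 z)
  simp only [InnerProductSpace.laplacian_eq_iteratedFDeriv_orthonormalBasis _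
    (EuclideanSpace.basisFun (Fin d) ℝ), iteratedFDeriv_two_apply, h1]
  rw [fderiv_fun_add ((hf1 z).fun_smul (hg2 z)) ((hg1 z).fun_smul (hf2 z)),
    fderiv_fun_smul (hf1 z) (hg2 z), fderiv_fun_smul (hg1 z) (hf2 z)]
  simp only [Matrix.cons_val_zero, Matrix.cons_val_one, _root_.add_apply,
    _root_.smul_apply, ContinuousLinearMap.smulRight_apply, smul_eq_mul]
  simp only [Finset.mul_sum, ← Finset.sum_add_distrib]
  refine Finset.sum_congr rfl fun i _ => ?_
  ring

/-- The scalar heat kernel of `ℝᵈ`. -/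
def heatKernel (τ : ℝ) (z : EuclideanSpace ℝ (Fin d)) : ℝ :=
  (4 * Real.pi * τ) ^ (-(d : ℝ) / 2) * Real.exp (-‖z‖ ^ 2 / (4 * τ))

/-- The time derivative of the heat kernel. -/
def heatKernelDeriv (τ : ℝ) (z : EuclideanSpace ℝ (Fin d)) : ℝ :=
  (‖z‖ ^ 2 / (4 * τ ^ 2) - d / (2 * τ)) * heatKernel τ z

theorem heatKernel_nonneg {τ : ℝ} (hτ : 0 ≤ τ) (z : EuclideanSpace ℝ (Fin d)) :
    0 ≤ heatKernel τ z := by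
  unfold heatKernel
  positivity

theorem heatKernel_sub_comm (τ : ℝ) (x y : EuclideanSpace ℝ (Fin d)) :
    heatKernel τ (x - y) = heatKernel τ (y - x) := by
  unfold heatKernel; rw [norm_sub_rev]

theorem continuousOn_heatKernel :
    ContinuousOn (Function.uncurry (heatKernel (d := d))) (Ioi 0 ×ˢ univ) := by
  rintro ⟨τ, z⟩ ⟨hτ, -⟩
  have hτ' : τ ≠ 0 := (mem_Ioi.1 hτ).ne'
  refine ContinuousAt.continuousWithinAt ?_
  unfold Function.uncurry heatKernel
  refine ContinuousAt.mul (ContinuousAt.rpow_const (by fun_prop) (Or.inl ?_)) ?_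
  · simpa using hτ'
  · have : 4 * (τ, z).1 ≠ 0 := by simpa using hτ'
    fun_prop (disch := assumption)

theorem continuousOn_heatKernelDeriv :
    ContinuousOn (Function.uncurry (heatKernelDeriv (d := d))) (Ioi 0 ×ˢ univ) := by
  refine ContinuousOn.mul ?_ continuousOn_heatKernel
  rintro ⟨τ, z⟩ ⟨hτ, -⟩
  have hτ' : τ ≠ 0 := (mem_Ioi.1 hτ).ne'
  have h1 : 4 * (τ, z).1 ^ 2 ≠ 0 := by simpa using hτ'
  have h2 : 2 * (τ, z).1 ≠ 0 := by simpa using hτ'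
  refine ContinuousAt.continuousWithinAt ?_
  fun_prop (disch := assumption)

theorem hasDerivAt_heatKernel {τ : ℝ} (hτ : 0 < τ) (z : EuclideanSpace ℝ (Fin d)) :
    HasDerivAt (fun τ => heatKernel τ z) (heatKernelDeriv τ z) τ := by
  have h4 : 0 < 4 * Real.pi * τ := by positivity
  have h1 : HasDerivAt (fun τ => (4 * Real.pi * τ) ^ (-(d : ℝ) / 2))
      (-(d : ℝ) / 2 / τ * (4 * Real.pi * τ) ^ (-(d : ℝ) / 2)) τ := by
    have := ((hasDerivAt_id τ).const_mul (4 * Real.pi)).rpow_const (p := -(d : ℝ) / 2)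
      (Or.inl h4.ne')
    refine this.congr_deriv ?_
    simp only [id_eq, mul_one]
    rw [Real.rpow_sub_one h4.ne']
    field_simp
  have h2 : HasDerivAt (fun τ => Real.exp (-‖z‖ ^ 2 / (4 * τ)))
      (Real.exp (-‖z‖ ^ 2 / (4 * τ)) * (‖z‖ ^ 2 / (4 * τ ^ 2))) τ := by
    have := ((hasDerivAt_const τ (-‖z‖ ^ 2)).div ((hasDerivAt_id τ).const_mul 4)
      (by simpa using hτ.ne')).exp
    refine this.congr_deriv ?_
    simp only [id_eq]
    congr 1
    field_simp
    ring
  refine (h1.mul h2).congr_deriv ?_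
  unfold heatKernelDeriv heatKernel
  ring

theorem contDiff_heatKernel (τ : ℝ) (x : EuclideanSpace ℝ (Fin d)) {n : WithTop ℕ∞} :
    ContDiff ℝ n fun z => heatKernel τ (z - x) := by
  unfold heatKernel
  exact contDiff_const.mul
    (((contDiff_id.sub contDiff_const).norm_sq ℝ).neg.div_const _).exp

theorem hasFDerivAt_heatKernel {τ : ℝ} (hτ : τ ≠ 0) (x z : EuclideanSpace ℝ (Fin d)) :
    HasFDerivAt (fun z => heatKernel τ (z - x))
      (-(heatKernel τ (z - x) / (2 * τ)) • innerSL ℝ (z - x)) z := by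
  have h0 : HasFDerivAt (fun z : EuclideanSpace ℝ (Fin d) => z - x)
    (ContinuousLinearMap.id ℝ _) z := (hasFDerivAt_id z).sub_const x
  have h := ((h0.norm_sq.neg.mul_const (4 * τ)⁻¹).exp).const_mul
    ((4 * Real.pi * τ) ^ (-(d : ℝ) / 2))
  unfold heatKernel
  simp only [div_eq_mul_inv] at h ⊢
  refine h.congr_fderiv ?_
  ext v
  simp
  field_simp
  ring

/-- The heat equation, `heatKernelDeriv` being the time derivative by `hasDerivAt_heatKernel`.
Summing the squares of the coordinates gives the term with `‖z‖²`, and the trace of the identity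
gives the term with `d`. -/
theorem laplacian_heatKernel {τ : ℝ} (hτ : τ ≠ 0) (x z : EuclideanSpace ℝ (Fin d)) :
    Laplacian.laplacian (fun z : EuclideanSpace ℝ (Fin d) => heatKernel τ (z - x)) z = heatKernelDeriv τ (z - x) := by
  have h1 : fderiv ℝ (fun z => heatKernel τ (z - x)) =
      fun z => (-(heatKernel τ (z - x) / (2 * τ))) • innerSL ℝ (z - x) := by
    ext1 z; exact (hasFDerivAt_heatKernel hτ x z).fderiv
  have h2 : HasFDerivAt (fun z : EuclideanSpace ℝ (Fin d) => innerSL ℝ (z - x))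
      (innerSL ℝ (E := EuclideanSpace ℝ (Fin d))) z :=
    (innerSL ℝ (E := EuclideanSpace ℝ (Fin d))).hasFDerivAt.comp z ((hasFDerivAt_id z).sub_const x)
  have h3 := (((hasFDerivAt_heatKernel hτ x z).mul_const (2 * τ)⁻¹).neg).smul h2
  simp only [InnerProductSpace.laplacian_eq_iteratedFDeriv_orthonormalBasis _
    (EuclideanSpace.basisFun (Fin d) ℝ), iteratedFDeriv_two_apply, h1]
  simp only [div_eq_mul_inv]
  erw [h3.fderiv]
  have hsum : ∑ i, inner ℝ (z - x) (EuclideanSpace.basisFun (Fin d) ℝ i) *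
      inner ℝ (z - x) (EuclideanSpace.basisFun (Fin d) ℝ i) = ‖z - x‖ ^ 2 := by
    have := (EuclideanSpace.basisFun (Fin d) ℝ).sum_inner_mul_inner (z - x) (z - x)
    rw [real_inner_self_eq_norm_sq] at this
    rw [← this]
    refine Finset.sum_congr rfl fun i _ => ?_
    rw [real_inner_comm (z - x)]
  have hterm : ∀ i : Fin d, inner ℝ (EuclideanSpace.basisFun (Fin d) ℝ i)
      (EuclideanSpace.basisFun (Fin d) ℝ i) = (1 : ℝ) := by
    intro i
    rw [real_inner_self_eq_norm_sq]; simp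
  calc _ = ∑ i : Fin d, (-(heatKernel τ (z - x) / (2 * τ)) +
        heatKernel τ (z - x) / (4 * τ ^ 2) *
        (inner ℝ (z - x) (EuclideanSpace.basisFun (Fin d) ℝ i) *
      inner ℝ (z - x) (EuclideanSpace.basisFun (Fin d) ℝ i))) := by
        refine Finset.sum_congr rfl fun i _ => ?_
        have h4 : (innerSL ℝ (EuclideanSpace.basisFun (Fin d) ℝ i))
          (EuclideanSpace.basisFun (Fin d) ℝ i) = (1 : ℝ) := hterm i
        simp only [Matrix.cons_val_zero, Matrix.cons_val_one, _root_.add_apply, _root_.neg_apply,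
          _root_.smul_apply, ContinuousLinearMap.smulRight_apply, smul_eq_mul, Pi.neg_apply]
        erw [h4]
        simp only [innerSL_apply_apply]
        field_simp
        ring
    _ = _ := by
        rw [Finset.sum_add_distrib, ← Finset.mul_sum, hsum]
        simp [heatKernelDeriv]
        field_simp
        ring

/-- The commutator term `χ Δp - Δ(χ p)`, for the heat kernel `p` with pole `x`. -/
def commutatorTerm (χ : EuclideanSpace ℝ (Fin d) → ℝ) (τ : ℝ) (x z : EuclideanSpace ℝ (Fin d)) : ℝ :=
  (fderiv ℝ χ z (z - x) / τ - Laplacian.laplacian χ z) * heatKernel τ (z - x)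

/-- The gradient of the kernel is `-(z - x) / (2 τ)` times the kernel, so the cross term of the
product rule becomes the radial derivative of `χ` divided by `τ`. What is not a time derivative
contains derivatives of `χ`, and so vanishes where `χ` is locally constant. -/
theorem laplacian_mul_heatKernel {χ : EuclideanSpace ℝ (Fin d) → ℝ} (hχ : ContDiff ℝ 2 χ)
    {τ : ℝ} (hτ : τ ≠ 0) (x z : EuclideanSpace ℝ (Fin d)) :
    -Laplacian.laplacian (fun z => χ z * heatKernel τ (z - x)) z =
      commutatorTerm χ τ x z - χ z * heatKernelDeriv τ (z - x) := by
  rw [laplacian_mul hχ (contDiff_heatKernel τ x), laplacian_heatKernel hτ,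
    (hasFDerivAt_heatKernel hτ x z).fderiv]
  have hsum : ∑ i, fderiv ℝ χ z (EuclideanSpace.basisFun (Fin d) ℝ i) *
      inner ℝ (z - x) (EuclideanSpace.basisFun (Fin d) ℝ i) = fderiv ℝ χ z (z - x) := by
    conv_rhs => rw [← (EuclideanSpace.basisFun (Fin d) ℝ).sum_repr (z - x)]
    rw [map_sum]
    refine Finset.sum_congr rfl fun i _ => ?_
    rw [map_smul, (EuclideanSpace.basisFun (Fin d) ℝ).repr_apply_apply, real_inner_comm (z - x),
      smul_eq_mul, mul_comm]
  have h2 : ∑ i, fderiv ℝ χ z (EuclideanSpace.basisFun (Fin d) ℝ i) *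
      ((-(heatKernel τ (z - x) / (2 * τ))) • innerSL ℝ (z - x))
        (EuclideanSpace.basisFun (Fin d) ℝ i) =
      -(heatKernel τ (z - x) / (2 * τ)) * fderiv ℝ χ z (z - x) := by
    rw [← hsum, Finset.mul_sum]
    refine Finset.sum_congr rfl fun i _ => ?_
    rw [_root_.smul_apply, innerSL_apply_apply, smul_eq_mul]
    ring
  rw [h2]
  unfold commutatorTerm
  field_simp
  ring

end HeatKernelCalculus
end

/-! ### Bounds for the heat kernel and for the commutator -/

section

open Filter Topology

section HeatKernelBounds

variable {d : ℕ}

theorem integral_heatKernel {τ : ℝ} (hτ : 0 < τ) :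
    ∫ z : EuclideanSpace ℝ (Fin d), heatKernel τ z = 1 := by
  have hb : 0 < 1 / (4 * τ) := by positivity
  have h := GaussianFourier.integral_rexp_neg_mul_sq_norm (V := EuclideanSpace ℝ (Fin d)) hb
  unfold heatKernel
  rw [integral_const_mul]
  have e : ∀ z : EuclideanSpace ℝ (Fin d), Real.exp (-‖z‖ ^ 2 / (4 * τ)) =
      Real.exp (-(1 / (4 * τ)) * ‖z‖ ^ 2) := fun z => by congr 1; ring
  simp_rw [e]
  rw [h, finrank_euclideanSpace_fin, show Real.pi / (1 / (4 * τ)) = 4 * Real.pi * τ by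
    field_simp, ← Real.rpow_add (by positivity)]
  simp [neg_div]

theorem integrable_heatKernel {τ : ℝ} (hτ : 0 < τ) :
    Integrable (heatKernel τ : EuclideanSpace ℝ (Fin d) → ℝ) := by
  -- A function that is not integrable has integral `0` by convention, while the value here is `1`.
  by_contra h
  have := integral_heatKernel (d := d) hτ
  rw [integral_undef h] at this
  exact zero_ne_one this

theorem heatKernel_le {τ : ℝ} (hτ : 0 < τ) (z : EuclideanSpace ℝ (Fin d)) :
    heatKernel τ z ≤ (4 * Real.pi * τ) ^ (-(d : ℝ) / 2) := by
  unfold heatKernel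
  refine mul_le_of_le_one_right (by positivity) (Real.exp_le_one_iff.2 ?_)
  rw [neg_div]
  exact neg_nonpos.2 (by positivity)

/-- The factor `‖z‖` is at most `2 √τ exp (‖z‖² / (8 τ))`, and this exponential uses up half of the
Gaussian exponent, which amounts to doubling the time. -/
theorem heatKernel_mul_norm_le {τ : ℝ} (hτ : 0 < τ) (z : EuclideanSpace ℝ (Fin d)) :
    heatKernel τ z * ‖z‖ ≤ 2 * 2 ^ ((d : ℝ) / 2) * √τ * heatKernel (2 * τ) z := by
  have hs : 0 < √τ := Real.sqrt_pos.2 hτ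
  have h1 : ‖z‖ ≤ 2 * √τ * Real.exp (‖z‖ ^ 2 / (8 * τ)) := by
    have h2 := Real.add_one_le_exp (‖z‖ ^ 2 / (8 * τ))
    have h3 : ‖z‖ ≤ 2 * √τ * (‖z‖ ^ 2 / (8 * τ) + 1) := by
      have h4 : √τ * √τ = τ := Real.mul_self_sqrt hτ.le
      have h5 : ‖z‖ ^ 2 / (8 * τ) = (‖z‖ / √τ) ^ 2 / 8 := by
        rw [div_pow, Real.sq_sqrt hτ.le]; field_simp
      have h6 : ‖z‖ = √τ * (‖z‖ / √τ) := by field_simp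
      rw [h5]
      set u := ‖z‖ / √τ
      rw [h6]
      nlinarith [sq_nonneg (u - 2)]
    exact h3.trans (by gcongr)
  have h2 : heatKernel τ z = 2 ^ ((d : ℝ) / 2) * heatKernel (2 * τ) z *
      Real.exp (-(‖z‖ ^ 2 / (8 * τ))) := by
    unfold heatKernel
    have hpow : (2 : ℝ) ^ ((d : ℝ) / 2) * (4 * Real.pi * (2 * τ)) ^ (-(d : ℝ) / 2) =
        (4 * Real.pi * τ) ^ (-(d : ℝ) / 2) := by
      rw [show 4 * Real.pi * (2 * τ) = 2 * (4 * Real.pi * τ) by ring,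
        Real.mul_rpow (x := 2) (by norm_num) (by positivity), ← mul_assoc,
        ← Real.rpow_add (by norm_num), neg_div, add_neg_cancel, Real.rpow_zero, one_mul]
    rw [← mul_assoc, hpow, mul_assoc _ (Real.exp _), ← Real.exp_add]
    congr 2
    field_simp
    ring
  calc heatKernel τ z * ‖z‖ ≤ heatKernel τ z * (2 * √τ * Real.exp (‖z‖ ^ 2 / (8 * τ))) :=
        mul_le_mul_of_nonneg_left h1 (heatKernel_nonneg hτ.le z)
    _ = 2 ^ ((d : ℝ) / 2) * heatKernel (2 * τ) z * (2 * √τ) *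
        (Real.exp (-(‖z‖ ^ 2 / (8 * τ))) * Real.exp (‖z‖ ^ 2 / (8 * τ))) := by rw [h2]; ring
    _ = _ := by rw [← Real.exp_add, neg_add_cancel, Real.exp_zero]; ring

/-- The heat flow of a Lipschitz function converges uniformly to it. -/
theorem abs_integral_mul_heatKernel_sub_le {η : EuclideanSpace ℝ (Fin d) → ℝ} {K : NNReal}
    (hη : LipschitzWith K η) (hc : HasCompactSupport η) {τ : ℝ} (hτ : 0 < τ)
    (z : EuclideanSpace ℝ (Fin d)) :
    |(∫ x, η x * heatKernel τ (z - x)) - η z| ≤ K * (2 * 2 ^ ((d : ℝ) / 2)) * √τ := by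
  have hp := (integrable_heatKernel (d := d) hτ)
  have hp2 := (integrable_heatKernel (d := d) (show 0 < 2 * τ by positivity))
  have e1 : ∫ x, η x * heatKernel τ (z - x) = ∫ y, η (z - y) * heatKernel τ y := by
    rw [← integral_sub_left_eq_self _ _ z]
    simp
  have e2 : η z = ∫ y : EuclideanSpace ℝ (Fin d), η z * heatKernel τ y := by
    rw [integral_const_mul, integral_heatKernel hτ, mul_one]
  obtain ⟨M, hM⟩ := hc.exists_bound_of_continuous hη.continuous
  have i1 : Integrable fun y => η (z - y) * heatKernel τ y :=
    hp.bdd_mul (c := M) (hη.continuous.comp (continuous_const.sub continuous_id)).aestronglyMeasurable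
      (Eventually.of_forall fun y => hM _)
  rw [e1]
  conv_lhs => rw [e2]
  rw [← integral_sub i1 (hp.const_mul _), ← Real.norm_eq_abs]
  refine (norm_integral_le_of_norm_le (hp2.const_mul (K * (2 * 2 ^ ((d : ℝ) / 2) * √τ)))
    (Eventually.of_forall fun y => ?_)).trans_eq ?_
  · rw [← sub_mul, norm_mul, Real.norm_of_nonneg (heatKernel_nonneg hτ.le y)]
    have h1 : ‖η (z - y) - η z‖ ≤ K * ‖y‖ := by
      have := hη.dist_le_mul (z - y) z
      rwa [dist_eq_norm, dist_eq_norm, sub_sub_cancel_left, norm_neg] at this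
    calc ‖η (z - y) - η z‖ * heatKernel τ y ≤ K * ‖y‖ * heatKernel τ y :=
          mul_le_mul_of_nonneg_right h1 (heatKernel_nonneg hτ.le y)
      _ = K * (heatKernel τ y * ‖y‖) := by ring
      _ ≤ K * (2 * 2 ^ ((d : ℝ) / 2) * √τ * heatKernel (2 * τ) y) :=
          mul_le_mul_of_nonneg_left (heatKernel_mul_norm_le hτ y) K.2
      _ = _ := by ring
  · rw [integral_const_mul, integral_heatKernel (by positivity)]
    ring

theorem exists_rpow_le_mul_exp {s c : ℝ} (hs : 0 ≤ s) (hc : 0 < c) :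
    ∃ C : ℝ, 0 ≤ C ∧ ∀ u : ℝ, 0 ≤ u → u ^ s ≤ C * Real.exp (c * u) := by
  obtain ⟨n, hn⟩ := exists_nat_ge s
  refine ⟨1 + n.factorial / c ^ n, by positivity, fun u hu => ?_⟩
  have h1 : u ^ s ≤ 1 + u ^ n := by
    rcases le_total u 1 with h | h
    · exact (Real.rpow_le_one hu h hs).trans (by linarith [pow_nonneg hu n])
    · calc u ^ s ≤ u ^ (n : ℝ) := Real.rpow_le_rpow_of_exponent_le h hn
        _ = u ^ n := Real.rpow_natCast u n
        _ ≤ _ := by linarith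
  have h2 := Real.pow_div_factorial_le_exp (c * u) (by positivity) n
  have h3 : u ^ n = (n.factorial / c ^ n) * ((c * u) ^ n / n.factorial) := by
    rw [mul_pow]; field_simp
  have h4 : 1 ≤ Real.exp (c * u) := Real.one_le_exp (by positivity)
  have h5 : (n.factorial / c ^ n) * ((c * u) ^ n / n.factorial) ≤
      (n.factorial / c ^ n) * Real.exp (c * u) := mul_le_mul_of_nonneg_left h2 (by positivity)
  rw [add_mul]
  linarith

/-- Off-diagonal Gaussian decay of the heat kernel, with room for negative powers of the time. -/
theorem exists_heatKernel_le {a b : ℝ} (hb : 0 ≤ b) (hab : b < a) :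
    ∃ C : ℝ, 0 ≤ C ∧ ∀ τ : ℝ, 0 < τ → ∀ z : EuclideanSpace ℝ (Fin d), a ≤ ‖z‖ →
      (1 / τ + 1) * heatKernel τ z ≤ C * Real.exp (-b ^ 2 / (4 * τ)) := by
  -- The surplus of `a` over `b`: the factor `exp (-a² / (4 τ))` equals `exp (-κ / τ) exp (-b² / (4
  -- τ))`, and `exp (-κ / τ)` absorbs every power of `1 / τ`.
  set κ := (a ^ 2 - b ^ 2) / 4 with hκ
  have hκ0 : 0 < κ := by rw [hκ]; nlinarith
  obtain ⟨C1, hC1, h1⟩ := exists_rpow_le_mul_exp (s := 1 + (d : ℝ) / 2) (by positivity) hκ0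
  obtain ⟨C2, hC2, h2⟩ := exists_rpow_le_mul_exp (s := (d : ℝ) / 2) (by positivity) hκ0
  refine ⟨(4 * Real.pi) ^ (-(d : ℝ) / 2) * (C1 + C2), by positivity, fun τ hτ z hz => ?_⟩
  have hu : 0 < 1 / τ := by positivity
  have e1 : (4 * Real.pi * τ) ^ (-(d : ℝ) / 2) =
      (4 * Real.pi) ^ (-(d : ℝ) / 2) * (1 / τ) ^ ((d : ℝ) / 2) := by
    rw [Real.mul_rpow (by positivity) hτ.le, one_div, Real.inv_rpow hτ.le, ← Real.rpow_neg hτ.le,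
      neg_div]
  have e2 : Real.exp (-‖z‖ ^ 2 / (4 * τ)) ≤ Real.exp (-(κ * (1 / τ))) * Real.exp (-b ^ 2 / (4 * τ)) := by
    rw [← Real.exp_add]
    refine Real.exp_le_exp.2 ?_
    have : a ^ 2 ≤ ‖z‖ ^ 2 := by nlinarith
    rw [hκ]
    have e3 : -((a ^ 2 - b ^ 2) / 4 * (1 / τ)) + -b ^ 2 / (4 * τ) = -a ^ 2 / (4 * τ) := by
      field_simp; ring
    rw [e3]
    gcongr
  have h3 := h1 (1 / τ) hu.le
  have h4 := h2 (1 / τ) hu.le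
  rw [Real.rpow_add hu, Real.rpow_one] at h3
  unfold heatKernel
  rw [e1]
  calc (1 / τ + 1) * ((4 * Real.pi) ^ (-(d : ℝ) / 2) * (1 / τ) ^ ((d : ℝ) / 2) *
        Real.exp (-‖z‖ ^ 2 / (4 * τ)))
      = (4 * Real.pi) ^ (-(d : ℝ) / 2) * (1 / τ * (1 / τ) ^ ((d : ℝ) / 2) + (1 / τ) ^ ((d : ℝ) / 2)) *
        Real.exp (-‖z‖ ^ 2 / (4 * τ)) := by ring
    _ ≤ (4 * Real.pi) ^ (-(d : ℝ) / 2) * (C1 * Real.exp (κ * (1 / τ)) + C2 * Real.exp (κ * (1 / τ))) *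
        (Real.exp (-(κ * (1 / τ))) * Real.exp (-b ^ 2 / (4 * τ))) := by gcongr
    _ = (4 * Real.pi) ^ (-(d : ℝ) / 2) * (C1 + C2) * (Real.exp (κ * (1 / τ)) * Real.exp (-(κ * (1 / τ)))) *
        Real.exp (-b ^ 2 / (4 * τ)) := by ring
    _ = _ := by rw [← Real.exp_add, add_neg_cancel, Real.exp_zero, mul_one]

theorem continuous_laplacian {χ : EuclideanSpace ℝ (Fin d) → ℝ} (hχ : ContDiff ℝ ∞ χ) :
    Continuous (Laplacian.laplacian χ) := by
  have : Laplacian.laplacian χ = fun z => ∑ i, iteratedFDeriv ℝ 2 χ z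
      ![EuclideanSpace.basisFun (Fin d) ℝ i, EuclideanSpace.basisFun (Fin d) ℝ i] := by
    ext z
    rw [InnerProductSpace.laplacian_eq_iteratedFDeriv_orthonormalBasis _
      (EuclideanSpace.basisFun (Fin d) ℝ)]
  rw [this]
  have h := hχ.continuous_iteratedFDeriv (m := 2) (by norm_cast)
  fun_prop

theorem laplacian_eq_zero_of_notMem_tsupport {F : Type*} [NormedAddCommGroup F] [NormedSpace ℝ F]
    {χ : EuclideanSpace ℝ (Fin d) → F} {z : EuclideanSpace ℝ (Fin d)} (hz : z ∉ tsupport χ) :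
    Laplacian.laplacian χ z = 0 := by
  have h : χ =ᶠ[𝓝 z] fun _ => 0 := notMem_tsupport_iff_eventuallyEq.1 hz
  rw [(InnerProductSpace.laplacian_congr_nhds h).self_of_nhds]
  simp

/-- The commutator vanishes unless `z` is at distance at least `a` from the pole, where the kernel
has Gaussian size. The strict inequality `b < a` pays for the factor `1 / τ` in front of the
gradient and for the normalization of the kernel. -/
theorem exists_commutatorTerm_le {χ : EuclideanSpace ℝ (Fin d) → ℝ} (hχ : ContDiff ℝ ∞ χ)
    (hc : HasCompactSupport χ) {V : Set (EuclideanSpace ℝ (Fin d))} (hV : Bornology.IsBounded V)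
    {a b : ℝ} (hb : 0 ≤ b) (hab : b < a)
    (hsep : ∀ x ∈ V, ∀ z, ‖z - x‖ < a → fderiv ℝ χ z = 0 ∧ Laplacian.laplacian χ z = 0) :
    ∃ C : ℝ, 0 ≤ C ∧ ∀ τ : ℝ, 0 < τ → ∀ x ∈ V, ∀ z,
      |commutatorTerm χ τ x z| ≤ C * Real.exp (-b ^ 2 / (4 * τ)) := by
  obtain ⟨C, hC, h⟩ := exists_heatKernel_le (d := d) hb hab
  obtain ⟨R, hR0, hR⟩ := (hV.union hc.isBounded).exists_pos_norm_le
  obtain ⟨M1, hM1⟩ := (hc.fderiv (𝕜 := ℝ)).exists_bound_of_continuous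
    (hχ.continuous_fderiv (by simp))
  have hcl : HasCompactSupport (Laplacian.laplacian χ) := by
    refine HasCompactSupport.intro hc fun z hz => laplacian_eq_zero_of_notMem_tsupport hz
  obtain ⟨M2, hM2⟩ := hcl.exists_bound_of_continuous (continuous_laplacian hχ)
  have hM10 : 0 ≤ M1 := (norm_nonneg _).trans (hM1 0)
  have hM20 : 0 ≤ M2 := (norm_nonneg _).trans (hM2 0)
  set M := M1 * (2 * R) + M2
  refine ⟨M * C, by positivity, fun τ hτ x hx z => ?_⟩
  rcases lt_or_ge ‖z - x‖ a with hlt | hge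
  · obtain ⟨h1, h2⟩ := hsep x hx z hlt
    rw [commutatorTerm, h1, h2]
    simp only [_root_.zero_apply, zero_div, sub_zero, zero_mul, abs_zero]
    positivity
  · have h1 : |fderiv ℝ χ z (z - x)| ≤ M1 * (2 * R) := by
      by_cases hz : z ∈ tsupport χ
      · refine ((fderiv ℝ χ z).le_of_opNorm_le (hM1 z) _).trans ?_
        refine mul_le_mul_of_nonneg_left ?_ hM10
        have := norm_sub_le z x
        linarith [hR x (Or.inl hx), hR z (Or.inr hz)]
      · have : fderiv ℝ χ z = 0 := by
          have := (tsupport_fderiv_subset ℝ (f := χ))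
          exact image_eq_zero_of_notMem_tsupport fun h => hz (this h)
        rw [this]; simp only [_root_.zero_apply, abs_zero]; positivity
    have h2 : |Laplacian.laplacian χ z| ≤ M2 := hM2 z
    have h3 : |fderiv ℝ χ z (z - x) / τ - Laplacian.laplacian χ z| ≤ M * (1 / τ + 1) := by
      refine (abs_sub _ _).trans ?_
      rw [abs_div, abs_of_pos hτ]
      have h4 : |fderiv ℝ χ z (z - x)| / τ ≤ M1 * (2 * R) * (1 / τ) := by
        rw [div_eq_mul_one_div]; gcongr
      have h5 : 0 ≤ M1 * (2 * R) := by positivity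
      have h6 : 0 ≤ M2 * (1 / τ) := by positivity
      nlinarith
    rw [commutatorTerm, abs_mul, abs_of_nonneg (heatKernel_nonneg hτ.le _)]
    calc _ ≤ M * (1 / τ + 1) * heatKernel τ (z - x) :=
          mul_le_mul_of_nonneg_right h3 (heatKernel_nonneg hτ.le _)
      _ = M * ((1 / τ + 1) * heatKernel τ (z - x)) := by ring
      _ ≤ M * (C * Real.exp (-b ^ 2 / (4 * τ))) :=
          mul_le_mul_of_nonneg_left (h τ hτ _ hge) (by positivity)
      _ = _ := by ring

theorem continuousOn_mul_heatKernel {χ : EuclideanSpace ℝ (Fin d) → ℝ} (hχ : Continuous χ) :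
    ContinuousOn (Function.uncurry fun (p : EuclideanSpace ℝ (Fin d) × ℝ) z =>
      χ z * heatKernel p.2 (z - p.1)) ((univ ×ˢ Ioi 0) ×ˢ univ) :=
  (hχ.comp continuous_snd).continuousOn.mul (continuousOn_heatKernel.comp
    (f := fun q : (EuclideanSpace ℝ (Fin d) × ℝ) × EuclideanSpace ℝ (Fin d) =>
      (q.1.2, q.2 - q.1.1)) (by fun_prop) fun q hq => ⟨hq.1.2, mem_univ _⟩)

theorem continuousOn_mul_heatKernelDeriv {χ : EuclideanSpace ℝ (Fin d) → ℝ} (hχ : Continuous χ) :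
    ContinuousOn (Function.uncurry fun (p : EuclideanSpace ℝ (Fin d) × ℝ) z =>
      χ z * heatKernelDeriv p.2 (z - p.1)) ((univ ×ˢ Ioi 0) ×ˢ univ) :=
  (hχ.comp continuous_snd).continuousOn.mul (continuousOn_heatKernelDeriv.comp
    (f := fun q : (EuclideanSpace ℝ (Fin d) × ℝ) × EuclideanSpace ℝ (Fin d) =>
      (q.1.2, q.2 - q.1.1)) (by fun_prop) fun q hq => ⟨hq.1.2, mem_univ _⟩)

theorem continuousOn_commutatorTerm {χ : EuclideanSpace ℝ (Fin d) → ℝ} (hχ : ContDiff ℝ ∞ χ) :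
    ContinuousOn (Function.uncurry fun (p : EuclideanSpace ℝ (Fin d) × ℝ) z =>
      commutatorTerm χ p.2 p.1 z) ((univ ×ˢ Ioi 0) ×ˢ univ) := by
  refine ContinuousOn.mul (ContinuousOn.sub (ContinuousOn.div ?_ ?_ ?_) ?_)
    (continuousOn_heatKernel.comp
    (f := fun q : (EuclideanSpace ℝ (Fin d) × ℝ) × EuclideanSpace ℝ (Fin d) =>
      (q.1.2, q.2 - q.1.1)) (by fun_prop) fun q hq => ⟨hq.1.2, mem_univ _⟩)
  · have := hχ.continuous_fderiv (by simp)
    exact Continuous.continuousOn (by fun_prop)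
  · fun_prop
  · rintro q ⟨⟨-, hq⟩, -⟩
    exact (mem_Ioi.1 hq).ne'
  · exact ((continuous_laplacian hχ).comp continuous_snd).continuousOn

end HeatKernelBounds
end

/-! ### Functions on a compact set mapped into a Hilbert space -/

section

open Filter Topology ContinuousMap TopologicalSpace

section Push

variable {d : ℕ} {H : Type*} [NormedAddCommGroup H] [InnerProductSpace ℂ H]
variable {Q : Compacts (EuclideanSpace ℝ (Fin d))} (e : C(Q, ℝ) →L[ℝ] H)

/-- The image under `e` of the restriction to `Q` of a function. -/
def push (f : EuclideanSpace ℝ (Fin d) → ℝ) : H :=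
  e (mkD ((Q : Set (EuclideanSpace ℝ (Fin d))).domRestrict f) 0)

/-- Joint continuity is continuity in the supremum norm over the compact set `Q`. The default value
`0` in `push` does not enter, since every `F p` is continuous on `Q`. -/
theorem continuousOn_push {P : Type*} [TopologicalSpace P] {s : Set P}
    {F : P → EuclideanSpace ℝ (Fin d) → ℝ}
    (hF : ContinuousOn (Function.uncurry F) (s ×ˢ univ)) :
    ContinuousOn (fun p => push e (F p)) s :=
  e.continuous.comp_continuousOn
    (continuousOn_mkD_restrict_of_uncurry F 0 (hF.mono (prod_mono subset_rfl (subset_univ _))))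

theorem push_sub {f g : EuclideanSpace ℝ (Fin d) → ℝ} (hf : Continuous f) (hg : Continuous g) :
    push e (fun z => f z - g z) = push e f - push e g := by
  unfold push
  rw [← map_sub]
  congr 1
  ext z
  rw [ContinuousMap.sub_apply, mkD_apply_of_continuousOn (f := fun z => f z - g z)
    (hf.sub hg).continuousOn,
    mkD_apply_of_continuousOn hf.continuousOn, mkD_apply_of_continuousOn hg.continuousOn]

theorem norm_push_le {f : EuclideanSpace ℝ (Fin d) → ℝ} {C : ℝ} (hf : Continuous f)
    (hC0 : 0 ≤ C) (hC : ∀ z ∈ Q, |f z| ≤ C) : ‖push e f‖ ≤ ‖e‖ * C := by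
  refine e.le_opNorm_of_le ((ContinuousMap.norm_le _ hC0).2 fun z => ?_)
  rw [mkD_apply_of_continuousOn hf.continuousOn]
  exact hC z z.2

theorem hasDerivAt_push {s : Set ℝ} (hs : IsOpen s) {F F' : ℝ → EuclideanSpace ℝ (Fin d) → ℝ}
    (hF : ContinuousOn (Function.uncurry F) (s ×ˢ univ))
    (hF' : ContinuousOn (Function.uncurry F') (s ×ˢ univ))
    (hd : ∀ τ ∈ s, ∀ z, HasDerivAt (fun τ => F τ z) (F' τ z) τ) {τ : ℝ} (hτ : τ ∈ s) :
    HasDerivAt (fun τ => push e (F τ)) (push e (F' τ)) τ := by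
  have hsub : s ×ˢ (Q : Set (EuclideanSpace ℝ (Fin d))) ⊆ s ×ˢ univ :=
    prod_mono subset_rfl (subset_univ _)
  have hcont : ∀ {G : ℝ → EuclideanSpace ℝ (Fin d) → ℝ},
      ContinuousOn (Function.uncurry G) (s ×ˢ univ) →
      ∀ σ ∈ s, ContinuousOn (G σ) Q := fun {G} hG σ hσ =>
    (hG.mono hsub).comp (Continuous.prodMk_right σ).continuousOn fun z hz => ⟨hσ, hz⟩
  refine e.hasFDerivAt.comp_hasDerivAt τ ?_
  refine hasDerivAt_continuousMap (γ' := fun τ => mkD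
    ((Q : Set (EuclideanSpace ℝ (Fin d))).domRestrict (F' τ)) 0)
    ((continuousOn_mkD_restrict_of_uncurry F' 0 (hF'.mono hsub)).continuousAt (hs.mem_nhds hτ)) ?_
  filter_upwards [hs.mem_nhds hτ] with σ hσ k
  rw [mkD_apply_of_continuousOn (hcont hF' σ hσ)]
  refine (hd σ hσ k).congr_of_eventuallyEq ?_
  filter_upwards [hs.mem_nhds hσ] with ρ hρ
  rw [mkD_apply_of_continuousOn (hcont hF ρ hρ)]

/-- The integral is taken in the Banach space of continuous functions on `Q`, commutes with `e`, and
is identified there by evaluating at points. -/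
theorem integral_smul_push [CompleteSpace H] {η : EuclideanSpace ℝ (Fin d) → ℝ} (hη : Continuous η)
    (hc : HasCompactSupport η) {F : EuclideanSpace ℝ (Fin d) → EuclideanSpace ℝ (Fin d) → ℝ}
    (hF : Continuous (Function.uncurry F)) :
    ∫ x, η x • push e (F x) = push e (fun z => ∫ x, η x * F x z) := by
  have hFx : ∀ x, Continuous (F x) := fun x => hF.comp (Continuous.prodMk_right x)
  have hcont : Continuous fun x => η x •
      mkD ((Q : Set (EuclideanSpace ℝ (Fin d))).domRestrict (F x)) 0 :=
    hη.smul (continuous_mkD_restrict_of_uncurry F 0 hF.continuousOn)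
  have hintg := hcont.integrable_of_hasCompactSupport (μ := volume) hc.smul_right
  unfold push
  simp_rw [← map_smul]
  rw [e.integral_comp_comm hintg]
  congr 1
  have hval : ∀ z : Q, (∫ x, η x • mkD ((Q : Set (EuclideanSpace ℝ (Fin d))).domRestrict (F x)) 0) z =
      ∫ x, η x * F x z := by
    intro z
    rw [ContinuousMap.integral_apply hintg]
    refine integral_congr_ae (Eventually.of_forall fun x => ?_)
    simp only [ContinuousMap.smul_apply, smul_eq_mul]
    rw [mkD_apply_of_continuousOn (hFx x).continuousOn]
  have hcz : ContinuousOn (fun z => ∫ x, η x * F x z) Q := by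
    rw [continuousOn_iff_continuous_domRestrict]
    exact (ContinuousMap.continuous _).congr hval
  ext z
  rw [hval, mkD_apply_of_continuousOn hcz]

end Push

/-! ### The cut off heat kernel as an approximate solution of the heat equation -/

section Parametrix

variable {d : ℕ} {H : Type*} [NormedAddCommGroup H] [InnerProductSpace ℂ H]
variable {A : H →ₗ.[ℂ] H}
variable {Q : Compacts (EuclideanSpace ℝ (Fin d))} {e : C(Q, ℝ) →L[ℝ] H}
variable {χ : EuclideanSpace ℝ (Fin d) → ℝ}

/-- The operator `A` acts as the Laplacian on the image of the smooth functions with support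
in `Q`. -/
def ActsAsLaplacian (A : H →ₗ.[ℂ] H) (e : C(Q, ℝ) →L[ℝ] H) : Prop :=
  ∀ f : EuclideanSpace ℝ (Fin d) → ℝ, ContDiff ℝ ∞ f → tsupport f ⊆ Q →
    (push e f, push e fun z => -Laplacian.laplacian f z) ∈ A.graph

variable (e χ) in
/-- The localized heat kernel with pole `x`, as an element of the Hilbert space. -/
def localHeat (x : EuclideanSpace ℝ (Fin d)) (τ : ℝ) : H :=
  push e fun z => χ z * heatKernel τ (z - x)

variable (e χ) in
/-- The failure of the localized heat kernel to solve the heat equation. -/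
def localDefect (x : EuclideanSpace ℝ (Fin d)) (τ : ℝ) : H :=
  push e (commutatorTerm χ τ x)

theorem continuousOn_localHeat (hχ : ContDiff ℝ ∞ χ) :
    ContinuousOn (Function.uncurry (localHeat e χ)) (univ ×ˢ Ioi 0) :=
  continuousOn_push e (continuousOn_mul_heatKernel hχ.continuous)

theorem continuousOn_localDefect (hχ : ContDiff ℝ ∞ χ) :
    ContinuousOn (Function.uncurry (localDefect e χ)) (univ ×ˢ Ioi 0) :=
  continuousOn_push e (continuousOn_commutatorTerm hχ)

theorem continuousOn_localHeat_right (hχ : ContDiff ℝ ∞ χ) (x : EuclideanSpace ℝ (Fin d)) :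
    ContinuousOn (localHeat e χ x) (Ioi 0) :=
  ContinuousOn.uncurry_left x (mem_univ x) (continuousOn_localHeat hχ)

theorem continuousOn_localDefect_right (hχ : ContDiff ℝ ∞ χ) (x : EuclideanSpace ℝ (Fin d)) :
    ContinuousOn (localDefect e χ x) (Ioi 0) :=
  ContinuousOn.uncurry_left x (mem_univ x) (continuousOn_localDefect hχ)

theorem continuous_localHeat_left (hχ : ContDiff ℝ ∞ χ) {τ : ℝ} (hτ : 0 < τ) :
    Continuous fun x => localHeat e χ x τ := by
  rw [← continuousOn_univ]
  exact ContinuousOn.uncurry_right τ (mem_Ioi.2 hτ) (continuousOn_localHeat hχ)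

/-- The graph statement reads `z' + A z = localDefect`: the cut off kernel solves the heat equation
of `A` with the commutator as source. It holds for every `A` that extends the Laplacian on test
functions, since the cut off kernel is itself a test function. -/
theorem exists_hasDerivAt_localHeat (hA : ActsAsLaplacian A e) (hχ : ContDiff ℝ ∞ χ)
    (hQ : tsupport χ ⊆ Q) (x : EuclideanSpace ℝ (Fin d)) {τ : ℝ} (hτ : 0 < τ) :
    ∃ z' : H, HasDerivAt (localHeat e χ x) z' τ ∧
      (localHeat e χ x τ, localDefect e χ x τ - z') ∈ A.graph := by
  refine ⟨push e fun z => χ z * heatKernelDeriv τ (z - x), ?_, ?_⟩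
  · have hmap : ContinuousOn (fun q : ℝ × EuclideanSpace ℝ (Fin d) => ((x, q.1), q.2))
      (Ioi 0 ×ˢ univ) := by fun_prop
    exact hasDerivAt_push e (F := fun τ z => χ z * heatKernel τ (z - x))
      (F' := fun τ z => χ z * heatKernelDeriv τ (z - x)) isOpen_Ioi
      ((continuousOn_mul_heatKernel hχ.continuous).comp hmap fun q hq => ⟨⟨mem_univ _, hq.1⟩, hq.2⟩)
      ((continuousOn_mul_heatKernelDeriv hχ.continuous).comp hmap
        fun q hq => ⟨⟨mem_univ _, hq.1⟩, hq.2⟩)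
      (fun σ hσ z => (hasDerivAt_heatKernel hσ (z - x)).const_mul (χ z)) hτ
  · have hc1 : Continuous (commutatorTerm χ τ x) := by
      rw [← continuousOn_univ]
      exact (continuousOn_commutatorTerm hχ).comp
        (f := fun z => ((x, τ), z)) (by fun_prop) fun z hz => ⟨⟨mem_univ _, hτ⟩, hz⟩
    have hc2 : Continuous fun z => χ z * heatKernelDeriv τ (z - x) := by
      rw [← continuousOn_univ]
      exact (continuousOn_mul_heatKernelDeriv hχ.continuous).comp
        (f := fun z => ((x, τ), z)) (by fun_prop) fun z hz => ⟨⟨mem_univ _, hτ⟩, hz⟩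
    rw [localDefect, ← push_sub e hc1 hc2]
    have h := hA (fun z => χ z * heatKernel τ (z - x)) (hχ.mul (contDiff_heatKernel τ x))
      ((tsupport_mul_subset_left).trans hQ)
    simp only [laplacian_mul_heatKernel (hχ.of_le (by norm_cast)) hτ.ne'] at h
    exact h

/-- The smeared localized heat kernel converges to the smearing function as `τ → 0`. -/
theorem tendsto_integral_localHeat [CompleteSpace H] (hχ : ContDiff ℝ ∞ χ) {η : EuclideanSpace ℝ (Fin d) → ℝ}
    (hη : ContDiff ℝ 1 η) (hc : HasCompactSupport η)
    (hχη : ∀ z, χ z * η z = η z) :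
    Tendsto (fun τ => ∫ x, η x • localHeat e χ x τ) (𝓝[>] 0) (𝓝 (push e η)) := by
  obtain ⟨K, hK⟩ := hη.lipschitzWith_of_hasCompactSupport hc (by norm_num)
  obtain ⟨M, hM⟩ := Q.isCompact.exists_bound_of_continuousOn hχ.continuous.continuousOn
  -- The compact set may be empty, and then `M` need not be nonnegative.
  set M' := max M 0
  rw [tendsto_iff_norm_sub_tendsto_zero]
  have hlim : Tendsto (fun τ : ℝ => ‖e‖ * (M' * (K * (2 * 2 ^ ((d : ℝ) / 2)) * √τ))) (𝓝[>] 0) (𝓝 0) := by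
    have : Continuous fun τ : ℝ => ‖e‖ * (M' * (K * (2 * 2 ^ ((d : ℝ) / 2)) * √τ)) := by fun_prop
    have h := (this.tendsto 0).mono_left (nhdsWithin_le_nhds (s := Ioi 0))
    simpa using h
  refine squeeze_zero' (Eventually.of_forall fun _ => norm_nonneg _) ?_ hlim
  filter_upwards [self_mem_nhdsWithin] with τ hτ
  have hτ' : 0 < τ := hτ
  have hF : Continuous (Function.uncurry fun x z : EuclideanSpace ℝ (Fin d) =>
      χ z * heatKernel τ (z - x)) := by
    rw [← continuousOn_univ]
    exact (continuousOn_mul_heatKernel hχ.continuous).comp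
      (f := fun q : EuclideanSpace ℝ (Fin d) × EuclideanSpace ℝ (Fin d) => ((q.1, τ), q.2))
      (by fun_prop) fun z hz => ⟨⟨mem_univ _, hτ⟩, mem_univ _⟩
  have e1 := integral_smul_push e hη.continuous hc hF
  have e2 : (fun z => ∫ x, η x * (χ z * heatKernel τ (z - x))) =
      fun z => χ z * ∫ x, η x * heatKernel τ (z - x) := by
    ext z
    rw [← integral_const_mul]
    refine integral_congr_ae (Eventually.of_forall fun x => ?_)
    simp only
    ring
  rw [e2] at e1
  simp only [localHeat]
  have hker : Continuous fun z => ∫ x, η x * heatKernel τ (z - x) := by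
    refine continuous_parametric_integral_of_continuous (μ := volume) (s := tsupport η)
      (f := fun z x => η x * heatKernel τ (z - x)) ?_ ?_ |>.congr ?_
    · have h1 : Continuous fun w : EuclideanSpace ℝ (Fin d) => heatKernel τ w := by
        rw [← continuousOn_univ]
        exact continuousOn_heatKernel.comp (f := fun w => (τ, w)) (by fun_prop)
          fun z hz => ⟨hτ, hz⟩
      have := hη.continuous
      unfold Function.uncurry
      fun_prop
    · exact hc
    · intro z
      refine setIntegral_eq_integral_of_forall_compl_eq_zero fun x hx => ?_
      rw [image_eq_zero_of_notMem_tsupport hx, zero_mul]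
  rw [e1, ← push_sub e (f := fun z => χ z * ∫ x, η x * heatKernel τ (z - x))
    (hχ.continuous.mul hker) hη.continuous]
  refine norm_push_le e ((hχ.continuous.mul hker).sub hη.continuous) (by positivity) fun z hz => ?_
  have h1 := abs_integral_mul_heatKernel_sub_le hK hc hτ' z
  have h2 : χ z * (∫ x, η x * heatKernel τ (z - x)) - η z =
      χ z * ((∫ x, η x * heatKernel τ (z - x)) - η z) := by rw [mul_sub, hχη]
  rw [h2, abs_mul]
  exact mul_le_mul ((hM z hz).trans (le_max_left _ _)) h1 (abs_nonneg _) (le_max_right _ _)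

end Parametrix
end

/-! ### Duhamel's formula -/

section

open Filter Topology TopologicalSpace

section Duhamel

theorem intervalIntegrable_of_continuousOn_Ioo {F : Type*} [NormedAddCommGroup F] {f : ℝ → F}
    {a b C : ℝ} (hab : a ≤ b) (hf : ContinuousOn f (Ioo a b)) (hC : ∀ x ∈ Ioo a b, ‖f x‖ ≤ C) :
    IntervalIntegrable f volume a b := by
  rw [intervalIntegrable_iff_integrableOn_Ioo_of_le hab]
  exact Integrable.of_bound (hf.aestronglyMeasurable measurableSet_Ioo) C
    ((ae_restrict_iff' measurableSet_Ioo).2 (Eventually.of_forall hC))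

theorem integrable_smul_of_tsupport_subset {X F : Type*} [TopologicalSpace X] [MeasurableSpace X]
    [OpensMeasurableSpace X] {μ : Measure X} [IsFiniteMeasureOnCompacts μ] [T2Space X]
    [NormedAddCommGroup F] [NormedSpace ℝ F] [SecondCountableTopologyEither X F]
    {V : Set X} (hV : IsOpen V) {η : X → ℝ}
    (hη : Continuous η) (hc : HasCompactSupport η) (hs : tsupport η ⊆ V) {g : X → F}
    (hg : ContinuousOn g V) : Integrable (fun x => η x • g x) μ := by
  refine Continuous.integrable_of_hasCompactSupport ?_ hc.smul_right
  exact (hη.continuousOn.smul hg).continuous_of_tsupport_subset hV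
    ((tsupport_smul_subset_left _ _).trans hs)

variable {d : ℕ} {H : Type*} [NormedAddCommGroup H] [InnerProductSpace ℂ H] [CompleteSpace H]
variable {A : H →ₗ.[ℂ] H}
variable {Q : Compacts (EuclideanSpace ℝ (Fin d))} {e : C(Q, ℝ) →L[ℝ] H}
variable {χ : EuclideanSpace ℝ (Fin d) → ℝ}

theorem continuousOn_heatSemigroup_sub (hA : IsNonnegSelfAdjoint A) (t : ℝ) :
    ContinuousOn (fun τ => heatSemigroup A (t - τ)) (Iio t) :=
  (continuousOn_heatSemigroup hA).comp (by fun_prop) fun τ hτ =>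
    mem_Ioi.2 (sub_pos.2 (mem_Iio.1 hτ))

theorem continuousOn_heatSemigroup_localDefect (hA : IsNonnegSelfAdjoint A) (hχ : ContDiff ℝ ∞ χ)
    (x : EuclideanSpace ℝ (Fin d)) (t : ℝ) :
    ContinuousOn (fun τ => heatSemigroup A (t - τ) (localDefect e χ x τ)) (Ioo 0 t) :=
  ((continuousOn_heatSemigroup_sub hA t).mono fun _ h => h.2).clm_apply
    ((continuousOn_localDefect_right hχ x).mono fun _ h => h.1)

/-- Duhamel's formula for the localized heat kernel, away from the initial time. -/
theorem inner_localHeat_sub_inner_localHeat (hA : IsNonnegSelfAdjoint A)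
    (he : ActsAsLaplacian A e) (hχ : ContDiff ℝ ∞ χ) (hQ : tsupport χ ⊆ Q)
    {x : EuclideanSpace ℝ (Fin d)} {C : ℝ} (hC : ∀ τ, 0 < τ → ‖localDefect e χ x τ‖ ≤ C)
    {ε t : ℝ} (hε : 0 < ε) (hεt : ε < t) (f : H) :
    inner ℂ f (localHeat e χ x t) - inner ℂ (heatSemigroup A (t - ε) f) (localHeat e χ x ε) =
      ∫ τ in ε..t, inner ℂ f (heatSemigroup A (t - τ) (localDefect e χ x τ)) := by
  symm
  -- At `τ = t` the semigroup reaches time `0`, where it is only strongly continuous. The version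
  -- with one-sided limits at the endpoints avoids differentiability there.
  refine intervalIntegral.integral_eq_sub_of_hasDerivAt_of_tendsto
    (f := fun τ => inner ℂ (heatSemigroup A (t - τ) f) (localHeat e χ x τ)) hεt ?_ ?_ ?_ ?_
  · intro τ hτ
    have hτ0 : 0 < τ := hε.trans hτ.1
    obtain ⟨z', hz, hg⟩ := exists_hasDerivAt_localHeat he hχ hQ x hτ0
    have h := hasDerivAt_inner_heatSemigroup hA hτ.2 f hz hg
    rwa [add_sub_cancel, inner_heatSemigroup_left] at h
  · refine intervalIntegrable_of_continuousOn_Ioo (C := ‖f‖ * C) hεt.le ?_ ?_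
    · exact continuousOn_const.inner
        ((continuousOn_heatSemigroup_localDefect hA hχ x t).mono fun τ h => ⟨hε.trans h.1, h.2⟩)
    · intro τ hτ
      refine (norm_inner_le_norm _ _).trans (mul_le_mul_of_nonneg_left ?_ (norm_nonneg _))
      exact (norm_heatSemigroup_apply_le hA (sub_pos.2 hτ.2).le _).trans (hC τ (hε.trans hτ.1))
  · have h1 : ContinuousAt (fun τ => heatSemigroup A (t - τ)) ε :=
      (continuousOn_heatSemigroup_sub hA t).continuousAt (Iio_mem_nhds hεt)
    have h2 : ContinuousAt (localHeat e χ x) ε :=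
      (continuousOn_localHeat_right hχ x).continuousAt (Ioi_mem_nhds hε)
    exact ((h1.clm_apply continuousAt_const).inner h2).tendsto.mono_left nhdsWithin_le_nhds
  · have h2 : ContinuousAt (localHeat e χ x) t :=
      (continuousOn_localHeat_right hχ x).continuousAt (Ioi_mem_nhds (hε.trans hεt))
    have h3 : Tendsto (fun τ => t - τ) (𝓝[<] t) (𝓝[>] 0) := by
      refine tendsto_nhdsWithin_iff.2 ⟨?_, ?_⟩
      · have : Continuous fun τ : ℝ => t - τ := by fun_prop
        simpa using (this.tendsto t).mono_left nhdsWithin_le_nhds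
      · filter_upwards [self_mem_nhdsWithin] with τ hτ
        exact sub_pos.2 (mem_Iio.1 hτ)
    exact ((tendsto_heatSemigroup_zero hA f).comp h3).inner (h2.tendsto.mono_left nhdsWithin_le_nhds)

variable (A e χ) in
/-- The correction term in Duhamel's formula. -/
def duhamelTerm (x : EuclideanSpace ℝ (Fin d)) (t : ℝ) : H :=
  ∫ τ in (0 : ℝ)..t, heatSemigroup A (t - τ) (localDefect e χ x τ)

variable (A e χ) in
/-- The kernel of `exp (-t A)` with pole `x`, as an element of the Hilbert space. -/
def localKernel (x : EuclideanSpace ℝ (Fin d)) (t : ℝ) : H :=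
  localHeat e χ x t - duhamelTerm A e χ x t

theorem intervalIntegrable_duhamelTerm (hA : IsNonnegSelfAdjoint A) (hχ : ContDiff ℝ ∞ χ)
    {x : EuclideanSpace ℝ (Fin d)} {C : ℝ} (hC : ∀ τ, 0 < τ → ‖localDefect e χ x τ‖ ≤ C)
    {t : ℝ} (ht : 0 ≤ t) :
    IntervalIntegrable (fun τ => heatSemigroup A (t - τ) (localDefect e χ x τ)) volume 0 t :=
  intervalIntegrable_of_continuousOn_Ioo (C := C) ht
    (continuousOn_heatSemigroup_localDefect hA hχ x t) fun τ hτ =>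
      (norm_heatSemigroup_apply_le hA (sub_pos.2 hτ.2).le _).trans (hC τ hτ.1)

theorem inner_duhamelTerm (hA : IsNonnegSelfAdjoint A) (hχ : ContDiff ℝ ∞ χ)
    {x : EuclideanSpace ℝ (Fin d)} {C : ℝ} (hC : ∀ τ, 0 < τ → ‖localDefect e χ x τ‖ ≤ C)
    {t : ℝ} (ht : 0 ≤ t) (f : H) :
    inner ℂ f (duhamelTerm A e χ x t) =
      ∫ τ in (0 : ℝ)..t, inner ℂ f (heatSemigroup A (t - τ) (localDefect e χ x τ)) := by
  have h := intervalIntegrable_duhamelTerm (e := e) hA hχ hC ht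
  unfold duhamelTerm
  rw [intervalIntegral.integral_of_le ht, intervalIntegral.integral_of_le ht]
  exact (integral_inner h.1 f).symm

/-- The semigroup is contractive and `exp (-b² / (4 τ))` increases with `τ`, so the bound for the
source at the final time serves for the whole interval. -/
theorem norm_duhamelTerm_le (hA : IsNonnegSelfAdjoint A)
    {x : EuclideanSpace ℝ (Fin d)} {C b : ℝ} (hC0 : 0 ≤ C)
    (hC : ∀ τ, 0 < τ → ‖localDefect e χ x τ‖ ≤ C * Real.exp (-b ^ 2 / (4 * τ)))
    {t : ℝ} (ht : 0 < t) :
    ‖duhamelTerm A e χ x t‖ ≤ C * t * Real.exp (-b ^ 2 / (4 * t)) := by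
  have h : ∀ τ ∈ Set.uIoc 0 t, ‖heatSemigroup A (t - τ) (localDefect e χ x τ)‖ ≤
      C * Real.exp (-b ^ 2 / (4 * t)) := by
    intro τ hτ
    rw [uIoc_of_le ht.le] at hτ
    have hdef : ‖localDefect e χ x τ‖ ≤ C * Real.exp (-b ^ 2 / (4 * t)) := by
      refine (hC τ hτ.1).trans (mul_le_mul_of_nonneg_left (Real.exp_le_exp.2 ?_) hC0)
      have h1 := hτ.1
      rw [neg_div, neg_div, neg_le_neg_iff]
      exact div_le_div_of_nonneg_left (sq_nonneg b) (by linarith) (by linarith [hτ.2])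
    exact (norm_heatSemigroup_apply_le hA (sub_nonneg.2 hτ.2) _).trans hdef
  refine (intervalIntegral.norm_integral_le_of_norm_le_const h).trans_eq ?_
  rw [sub_zero, abs_of_pos ht]
  ring

/-- The substitution `τ = t θ` makes the domain of integration independent of `t`; dominated
convergence then applies with a constant bound. -/
theorem continuousOn_duhamelTerm (hA : IsNonnegSelfAdjoint A) (hχ : ContDiff ℝ ∞ χ)
    {V : Set (EuclideanSpace ℝ (Fin d))} {C : ℝ}
    (hC : ∀ x ∈ V, ∀ τ, 0 < τ → ‖localDefect e χ x τ‖ ≤ C) :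
    ContinuousOn (Function.uncurry (duhamelTerm A e χ)) (V ×ˢ Ioi 0) := by
  have hsub : ∀ p ∈ V ×ˢ Ioi (0 : ℝ), Function.uncurry (duhamelTerm A e χ) p =
      p.2 • ∫ θ in Ioo (0 : ℝ) 1, heatSemigroup A (p.2 * (1 - θ)) (localDefect e χ p.1 (p.2 * θ)) := by
    intro p _
    have h := intervalIntegral.smul_integral_comp_mul_left (a := 0) (b := 1)
      (fun τ => heatSemigroup A (p.2 - τ) (localDefect e χ p.1 τ)) p.2
    rw [mul_zero, mul_one] at h
    simp only [Function.uncurry, duhamelTerm]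
    rw [← h, intervalIntegral.integral_of_le zero_le_one, integral_Ioc_eq_integral_Ioo]
    simp only [mul_sub, mul_one]
  refine ContinuousOn.congr (ContinuousOn.smul continuousOn_snd ?_) hsub
  refine continuousOn_of_dominated (bound := fun _ => C) ?_ ?_ (by simp) ?_
  · intro p hp
    have hp2 : 0 < p.2 := hp.2
    refine ContinuousOn.aestronglyMeasurable ?_ measurableSet_Ioo
    refine ContinuousOn.clm_apply ?_ ?_
    · exact (continuousOn_heatSemigroup hA).comp (by fun_prop) fun θ hθ =>
        mul_pos hp2 (sub_pos.2 hθ.2)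
    · exact (continuousOn_localDefect_right hχ p.1).comp (by fun_prop) fun θ hθ =>
        mul_pos hp2 hθ.1
  · intro p hp
    have hp2 : 0 < p.2 := hp.2
    refine (ae_restrict_iff' measurableSet_Ioo).2 (Eventually.of_forall fun θ hθ => ?_)
    exact (norm_heatSemigroup_apply_le hA (mul_pos hp2 (sub_pos.2 hθ.2)).le _).trans
      (hC p.1 hp.1 _ (mul_pos hp2 hθ.1))
  · refine (ae_restrict_iff' measurableSet_Ioo).2 (Eventually.of_forall fun θ hθ => ?_)
    refine ContinuousOn.clm_apply ?_ ?_
    · exact (continuousOn_heatSemigroup hA).comp (by fun_prop) fun p hp =>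
        mul_pos (mem_Ioi.1 hp.2) (sub_pos.2 hθ.2)
    · exact (continuousOn_localDefect hχ).comp
        (f := fun p : EuclideanSpace ℝ (Fin d) × ℝ => (p.1, p.2 * θ)) (by fun_prop)
        fun p hp => ⟨mem_univ _, mul_pos (mem_Ioi.1 hp.2) hθ.1⟩

theorem continuousOn_localKernel (hA : IsNonnegSelfAdjoint A) (hχ : ContDiff ℝ ∞ χ)
    {V : Set (EuclideanSpace ℝ (Fin d))} {C : ℝ}
    (hC : ∀ x ∈ V, ∀ τ, 0 < τ → ‖localDefect e χ x τ‖ ≤ C) :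
    ContinuousOn (Function.uncurry (localKernel A e χ)) (V ×ˢ Ioi 0) :=
  ((continuousOn_localHeat hχ).mono (prod_mono (subset_univ _) subset_rfl)).sub
    (continuousOn_duhamelTerm hA hχ hC)

theorem continuousOn_localKernel_left (hA : IsNonnegSelfAdjoint A) (hχ : ContDiff ℝ ∞ χ)
    {V : Set (EuclideanSpace ℝ (Fin d))} {C : ℝ}
    (hC : ∀ x ∈ V, ∀ τ, 0 < τ → ‖localDefect e χ x τ‖ ≤ C) {t : ℝ} (ht : 0 < t) :
    ContinuousOn (fun x => localKernel A e χ x t) V :=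
  ContinuousOn.uncurry_right t (mem_Ioi.2 ht) (continuousOn_localKernel hA hχ hC)

/-- The heat semigroup acts on functions supported near the pole through `localKernel`. -/
theorem inner_heatSemigroup_push (hA : IsNonnegSelfAdjoint A)
    (he : ActsAsLaplacian A e) (hχ : ContDiff ℝ ∞ χ) (hQ : tsupport χ ⊆ Q)
    {V : Set (EuclideanSpace ℝ (Fin d))} (hV : IsOpen V) {C : ℝ}
    (hC : ∀ x ∈ V, ∀ τ, 0 < τ → ‖localDefect e χ x τ‖ ≤ C) (hχV : ∀ x ∈ V, χ x = 1)
    {η : EuclideanSpace ℝ (Fin d) → ℝ}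
    (hη : ContDiff ℝ 1 η) (hc : HasCompactSupport η) (hs : tsupport η ⊆ V)
    {t : ℝ} (ht : 0 < t) (f : H) :
    inner ℂ f (heatSemigroup A t (push e η)) = ∫ x, η x • inner ℂ f (localKernel A e χ x t) := by
  have hχη : ∀ z, χ z * η z = η z := by
    intro z
    by_cases hz : z ∈ tsupport η
    · rw [hχV z (hs hz), one_mul]
    · rw [image_eq_zero_of_notMem_tsupport hz, mul_zero]
  have hlim := tendsto_integral_localHeat (e := e) hχ hη hc hχη
  have hev : ∀ᶠ ε : ℝ in 𝓝[>] 0, 0 < ε ∧ ε < t :=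
    Ioo_mem_nhdsGT ht
  have hZ : ∀ τ, 0 < τ → Integrable fun x => η x • localHeat e χ x τ := fun τ hτ =>
    integrable_smul_of_tsupport_subset hV hη.continuous hc hs
      (continuous_localHeat_left hχ hτ).continuousOn
  have hZf : ∀ (g : H) τ, 0 < τ → Integrable fun x => η x • inner ℂ g (localHeat e χ x τ) :=
    fun g τ hτ => integrable_smul_of_tsupport_subset hV hη.continuous hc hs
      (continuousOn_const.inner (continuous_localHeat_left hχ hτ).continuousOn)
  have hDf : Integrable fun x => η x • inner ℂ f (duhamelTerm A e χ x t) :=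
    integrable_smul_of_tsupport_subset hV hη.continuous hc hs
      (continuousOn_const.inner (ContinuousOn.uncurry_right t (mem_Ioi.2 ht)
        (continuousOn_duhamelTerm hA hχ hC)))
  have hinner : ∀ (g : H) τ, 0 < τ → ∫ x, η x • inner ℂ g (localHeat e χ x τ) =
      inner ℂ g (∫ x, η x • localHeat e χ x τ) := by
    intro g τ hτ
    rw [← integral_inner (hZ τ hτ)]
    refine integral_congr_ae (Eventually.of_forall fun x => ?_)
    simp only [inner_smul_right_eq_smul]
  -- the smeared Duhamel formula on `[ε, t]`
  have hD : ∀ ε, 0 < ε → ε < t → ∫ x, η x •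
      ∫ τ in ε..t, inner ℂ f (heatSemigroup A (t - τ) (localDefect e χ x τ)) =
      ∫ x, (η x • inner ℂ f (localHeat e χ x t) -
        η x • inner ℂ (heatSemigroup A (t - ε) f) (localHeat e χ x ε)) := by
    intro ε hε hεt
    refine integral_congr_ae (Eventually.of_forall fun x => ?_)
    by_cases hx : x ∈ tsupport η
    · simp only
      rw [← inner_localHeat_sub_inner_localHeat hA he hχ hQ (hC x (hs hx)) hε hεt f, smul_sub]
    · simp [image_eq_zero_of_notMem_tsupport hx]
  -- The cut off kernel at a fixed pole need not converge in the Hilbert space as `ε → 0`, but its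
  -- average against `η` does. The averaged Duhamel integral is evaluated as `ε → 0` in two ways;
  -- here by dominated convergence.
  have hL1 : Tendsto (fun ε => ∫ x, η x •
      ∫ τ in ε..t, inner ℂ f (heatSemigroup A (t - τ) (localDefect e χ x τ))) (𝓝[>] 0)
      (𝓝 (∫ x, η x • inner ℂ f (duhamelTerm A e χ x t))) := by
    refine tendsto_integral_filter_of_dominated_convergence (fun x => |η x| * (‖f‖ * C * t)) ?_ ?_ ?_ ?_
    · filter_upwards [hev] with ε hε
      refine (((hZf f t ht).sub (hZf (heatSemigroup A (t - ε) f) ε hε.1)).aestronglyMeasurable).congr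
        (Eventually.of_forall fun x => ?_)
      by_cases hx : x ∈ tsupport η
      · simp only [Pi.sub_apply]
        rw [← inner_localHeat_sub_inner_localHeat hA he hχ hQ (hC x (hs hx)) hε.1 hε.2 f, smul_sub]
      · simp [image_eq_zero_of_notMem_tsupport hx]
    · filter_upwards [hev] with ε hε
      refine Eventually.of_forall fun x => ?_
      by_cases hx : x ∈ tsupport η
      · rw [norm_smul, Real.norm_eq_abs]
        refine mul_le_mul_of_nonneg_left ?_ (abs_nonneg _)
        have hC0 : 0 ≤ C := (norm_nonneg _).trans (hC x (hs hx) 1 one_pos)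
        have hb : ∀ τ ∈ Set.uIoc ε t, ‖inner ℂ f (heatSemigroup A (t - τ) (localDefect e χ x τ))‖ ≤
            ‖f‖ * C := by
          intro τ hτ
          rw [uIoc_of_le hε.2.le] at hτ
          refine (norm_inner_le_norm _ _).trans (mul_le_mul_of_nonneg_left ?_ (norm_nonneg _))
          exact (norm_heatSemigroup_apply_le hA (sub_nonneg.2 hτ.2) _).trans
            (hC x (hs hx) τ (hε.1.trans hτ.1))
        refine (intervalIntegral.norm_integral_le_of_norm_le_const hb).trans ?_
        rw [abs_of_pos (sub_pos.2 hε.2)]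
        exact mul_le_mul_of_nonneg_left (by linarith [hε.1]) (by positivity)
      · simp [image_eq_zero_of_notMem_tsupport hx]
    · exact (hη.continuous.abs.integrable_of_hasCompactSupport hc.norm).mul_const _
    · refine Eventually.of_forall fun x => ?_
      by_cases hx : x ∈ tsupport η
      · refine Tendsto.const_smul ?_ _
        have hI : IntervalIntegrable
            (fun τ => inner ℂ f (heatSemigroup A (t - τ) (localDefect e χ x τ))) volume 0 t := by
          have := intervalIntegrable_duhamelTerm (e := e) hA hχ (hC x (hs hx)) ht.le
          rw [intervalIntegrable_iff] at this ⊢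
          exact this.const_inner f
        rw [inner_duhamelTerm hA hχ (hC x (hs hx)) ht.le]
        have hcont := intervalIntegral.continuousOn_primitive_interval_left (μ := volume)
          (f := fun τ => inner ℂ f (heatSemigroup A (t - τ) (localDefect e χ x τ))) (a := 0) (b := t)
          (by rwa [← intervalIntegrable_iff'])
        have h0 := (hcont 0 left_mem_uIcc).tendsto
        refine h0.mono_left ?_
        rw [uIcc_of_le ht.le, ← nhdsWithin_Ioo_eq_nhdsGT ht]
        exact nhdsWithin_mono _ Ioo_subset_Icc_self
      · simp [image_eq_zero_of_notMem_tsupport hx]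
  -- Second evaluation of the same limit, from the boundary terms of Duhamel's formula: at the lower
  -- endpoint the averaged kernel tends to `push e η`, and the semigroup is continuous at `t > 0`.
  have hL2 : Tendsto (fun ε => ∫ x, η x •
      ∫ τ in ε..t, inner ℂ f (heatSemigroup A (t - τ) (localDefect e χ x τ))) (𝓝[>] 0)
      (𝓝 ((∫ x, η x • inner ℂ f (localHeat e χ x t)) - inner ℂ (heatSemigroup A t f) (push e η))) := by
    have hS : Tendsto (fun ε => heatSemigroup A (t - ε) f) (𝓝[>] 0) (𝓝 (heatSemigroup A t f)) := by
      have h1 : ContinuousAt (fun τ => heatSemigroup A (t - τ) f) 0 :=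
        ((continuousOn_heatSemigroup_sub hA t).continuousAt (Iio_mem_nhds ht)).clm_apply
          continuousAt_const
      have h2 := h1.tendsto.mono_left (nhdsWithin_le_nhds (s := Ioi 0))
      rwa [sub_zero] at h2
    have h3 := tendsto_const_nhds (x := ∫ x, η x • inner ℂ f (localHeat e χ x t)) (f := 𝓝[>] (0 : ℝ))
    refine (h3.sub (hS.inner hlim)).congr' ?_
    filter_upwards [hev] with ε hε
    rw [hD ε hε.1 hε.2, integral_sub (hZf f t ht) (hZf _ ε hε.1), hinner _ ε hε.1]
  have hfin := tendsto_nhds_unique hL1 hL2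
  have hk : ∫ x, η x • inner ℂ f (localKernel A e χ x t) =
      (∫ x, η x • inner ℂ f (localHeat e χ x t)) -
        ∫ x, η x • inner ℂ f (duhamelTerm A e χ x t) := by
    rw [← integral_sub (hZf f t ht) hDf]
    refine integral_congr_ae (Eventually.of_forall fun x => ?_)
    simp only [localKernel, inner_sub_right, smul_sub]
  rw [hk, hfin, inner_heatSemigroup_left]
  ring

end Duhamel
end

/-! ### Vector multiples of scalar functions in `L²(U; ℂᴺ)` -/

section

open Filter Topology TopologicalSpace

section Embedding

/-- Continuous real-linear maps from the continuous functions on a compact set to a complex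
Hilbert space. -/
abbrev FunctionEmbedding {X : Type*} [TopologicalSpace X] (H : Type*) [NormedAddCommGroup H]
    [InnerProductSpace ℂ H] (Q : Compacts X) : Type _ :=
  C(Q, ℝ) →L[ℝ] H

/-- A bounded additive map that is homogeneous for real scalars, as a `FunctionEmbedding`. -/
def FunctionEmbedding.mk' {X H : Type*} [TopologicalSpace X] [NormedAddCommGroup H]
    [InnerProductSpace ℂ H] {Q : Compacts X} (T : C(Q, ℝ) → H) (C : ℝ)
    (hadd : ∀ f g, T (f + g) = T f + T g) (hsmul : ∀ (r : ℝ) f, T (r • f) = (r : ℂ) • T f)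
    (hC : ∀ f, ‖T f‖ ≤ C * ‖f‖) : FunctionEmbedding H Q :=
  LinearMap.mkContinuous
    { toFun := T
      map_add' := hadd
      map_smul' := fun r f => by rw [hsmul, RingHom.id_apply, Complex.coe_smul] } C hC

variable {d N : ℕ} {U : Set (EuclideanSpace ℝ (Fin d))}
variable {Q : Compacts (EuclideanSpace ℝ (Fin d))}

/-- The extension by zero of a function on a compact set. -/
def extendZero (f : C(Q, ℝ)) : EuclideanSpace ℝ (Fin d) → ℝ :=
  Function.extend Subtype.val f 0

theorem extendZero_of_mem (f : C(Q, ℝ)) {z : EuclideanSpace ℝ (Fin d)} (hz : z ∈ Q) :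
    extendZero f z = f ⟨z, hz⟩ :=
  Subtype.val_injective.extend_apply f 0 (⟨z, hz⟩ : Q)

theorem extendZero_of_notMem (f : C(Q, ℝ)) {z : EuclideanSpace ℝ (Fin d)} (hz : z ∉ Q) :
    extendZero f z = 0 :=
  Function.extend_apply' _ _ _ fun ⟨a, ha⟩ => hz (ha ▸ a.2)

theorem measurable_extendZero (f : C(Q, ℝ)) : Measurable (extendZero f) :=
  (MeasurableEmbedding.subtype_coe Q.isCompact.measurableSet).measurable_extend f.continuous.measurable
    measurable_const

theorem abs_extendZero_le (f : C(Q, ℝ)) (z : EuclideanSpace ℝ (Fin d)) : |extendZero f z| ≤ ‖f‖ := by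
  by_cases hz : z ∈ Q
  · rw [extendZero_of_mem f hz]
    exact f.norm_coe_le_norm _
  · rw [extendZero_of_notMem f hz, abs_zero]
    exact norm_nonneg _

theorem memLp_extendZero (f : C(Q, ℝ)) (v : EuclideanSpace ℂ (Fin N)) :
    MemLp (fun z => (extendZero f z : ℂ) • v) 2 (volume.restrict U) := by
  refine MemLp.restrict U ?_
  have hmeas : Measurable fun z => (extendZero f z : ℂ) • v :=
    (Complex.measurable_ofReal.comp (measurable_extendZero f)).smul_const v
  have hind : (Q : Set (EuclideanSpace ℝ (Fin d))).indicator (fun z => (extendZero f z : ℂ) • v) =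
      fun z => (extendZero f z : ℂ) • v := by
    refine indicator_eq_self.2 fun z hz => ?_
    by_contra hz'
    refine hz ?_
    simp only
    rw [extendZero_of_notMem f hz', Complex.ofReal_zero, zero_smul]
  rw [← hind, memLp_indicator_iff_restrict Q.isCompact.measurableSet]
  have : IsFiniteMeasure (volume.restrict (Q : Set (EuclideanSpace ℝ (Fin d)))) :=
    ⟨by rw [Measure.restrict_apply_univ]; exact Q.isCompact.measure_lt_top⟩
  refine MemLp.of_bound hmeas.aestronglyMeasurable (‖f‖ * ‖v‖) (Eventually.of_forall fun z => ?_)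
  rw [norm_smul, Complex.norm_real]
  exact mul_le_mul_of_nonneg_right (abs_extendZero_le f z) (norm_nonneg _)

theorem inner_toLp_extendZero (hQ : (Q : Set (EuclideanSpace ℝ (Fin d))) ⊆ U) (hU : MeasurableSet U)
    (f g : C(Q, ℝ)) (v w : EuclideanSpace ℂ (Fin N)) :
    inner ℂ (memLp_extendZero (U := U) f v).toLp (memLp_extendZero g w).toLp =
      inner ℂ v w * ((∫ z in (Q : Set (EuclideanSpace ℝ (Fin d))),
        extendZero f z * extendZero g z : ℝ) : ℂ) := by
  rw [L2.inner_def]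
  have h1 : ∫ z in U, inner ℂ (((memLp_extendZero f v).toLp _ : L2 U N) z)
      (((memLp_extendZero g w).toLp _ : L2 U N) z) =
      ∫ z in U, inner ℂ v w * ((extendZero f z * extendZero g z : ℝ) : ℂ) := by
    refine integral_congr_ae ?_
    filter_upwards [(memLp_extendZero (U := U) f v).coeFn_toLp,
      (memLp_extendZero (U := U) g w).coeFn_toLp] with z h1 h2
    rw [h1, h2, inner_smul_left, inner_smul_right, Complex.conj_ofReal]
    push_cast
    ring
  rw [h1, integral_const_mul, integral_complex_ofReal]
  congr 2
  refine setIntegral_eq_of_subset_of_forall_sdiff_eq_zero hU hQ fun z hz => ?_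
  rw [extendZero_of_notMem f hz.2, zero_mul]

/-- The embedding `f ↦ f v` of the continuous functions on a compact subset `Q` of `U` into
`L²(U; ℂᴺ)`. -/
def vectorEmbedding (hQ : (Q : Set (EuclideanSpace ℝ (Fin d))) ⊆ U) (hU : MeasurableSet U)
    (v : EuclideanSpace ℂ (Fin N)) : FunctionEmbedding (L2 U N) Q :=
  FunctionEmbedding.mk' (fun f => (memLp_extendZero f v).toLp)
    (‖v‖ * √(volume.real (Q : Set (EuclideanSpace ℝ (Fin d)))))
    (fun f g => by
      refine Lp.ext ?_
      filter_upwards [(memLp_extendZero (U := U) (f + g) v).coeFn_toLp,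
        (memLp_extendZero (U := U) f v).coeFn_toLp, (memLp_extendZero (U := U) g v).coeFn_toLp,
        Lp.coeFn_add (memLp_extendZero (U := U) f v).toLp (memLp_extendZero (U := U) g v).toLp]
        with z h h1 h2 h3
      rw [h, h3, Pi.add_apply, h1, h2, ← add_smul, ← Complex.ofReal_add]
      congr 2
      by_cases hz : z ∈ Q
      · simp [extendZero_of_mem _ hz]
      · simp [extendZero_of_notMem _ hz])
    (fun r f => by
      refine Lp.ext ?_
      filter_upwards [(memLp_extendZero (U := U) (r • f) v).coeFn_toLp,
        (memLp_extendZero (U := U) f v).coeFn_toLp,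
        Lp.coeFn_smul (r : ℂ) (memLp_extendZero (U := U) f v).toLp] with z h h1 h3
      rw [h, h3, Pi.smul_apply, h1, smul_smul, ← Complex.ofReal_mul]
      congr 2
      by_cases hz : z ∈ Q
      · simp [extendZero_of_mem _ hz]
      · simp [extendZero_of_notMem _ hz])
    (fun f => by
      have h := inner_toLp_extendZero hQ hU f f v v
      have h' : ‖(memLp_extendZero (U := U) f v).toLp‖ ^ 2 =
          ‖v‖ ^ 2 * ∫ z in (Q : Set (EuclideanSpace ℝ (Fin d))), extendZero f z * extendZero f z := by
        rw [@norm_sq_eq_re_inner ℂ, h, @norm_sq_eq_re_inner ℂ _ _ _ _ v]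
        exact Complex.re_mul_ofReal _ _
      have hintg : ‖∫ z in (Q : Set (EuclideanSpace ℝ (Fin d))), extendZero f z * extendZero f z‖ ≤
          ‖f‖ ^ 2 * volume.real (Q : Set (EuclideanSpace ℝ (Fin d))) := by
        refine norm_setIntegral_le_of_norm_le_const Q.isCompact.measure_lt_top fun z _ => ?_
        rw [norm_mul, Real.norm_eq_abs, sq]
        exact mul_self_le_mul_self (abs_nonneg _) (abs_extendZero_le f z)
      refine abs_le_of_sq_le_sq' ?_ (by positivity) |>.2
      rw [h', mul_pow, mul_pow, Real.sq_sqrt measureReal_nonneg, mul_assoc]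
      refine mul_le_mul_of_nonneg_left ?_ (sq_nonneg _)
      rw [mul_comm]
      exact (le_abs_self _).trans hintg)

theorem vectorEmbedding_apply (hQ : (Q : Set (EuclideanSpace ℝ (Fin d))) ⊆ U) (hU : MeasurableSet U)
    (v : EuclideanSpace ℂ (Fin N)) (f : C(Q, ℝ)) :
    vectorEmbedding hQ hU v f = (memLp_extendZero f v).toLp :=
  rfl

/-- The vectors factor out of the pairing. This reduces the matrix-valued problem to a scalar one,
with `inner ℂ v w` as a constant coefficient. -/
theorem inner_push_vectorEmbedding (hQ : (Q : Set (EuclideanSpace ℝ (Fin d))) ⊆ U)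
    (hU : MeasurableSet U) (v w : EuclideanSpace ℂ (Fin N)) {f g : EuclideanSpace ℝ (Fin d) → ℝ}
    (hf : Continuous f) (hg : Continuous g) :
    inner ℂ (push (vectorEmbedding hQ hU v) f) (push (vectorEmbedding hQ hU w) g) =
      inner ℂ v w * ((∫ z in (Q : Set (EuclideanSpace ℝ (Fin d))), f z * g z : ℝ) : ℂ) := by
  unfold push
  rw [vectorEmbedding_apply, vectorEmbedding_apply, inner_toLp_extendZero hQ hU]
  congr 2
  refine setIntegral_congr_fun Q.isCompact.measurableSet fun z hz => ?_
  rw [extendZero_of_mem _ hz, extendZero_of_mem _ hz,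
    ContinuousMap.mkD_apply_of_continuousOn hf.continuousOn,
    ContinuousMap.mkD_apply_of_continuousOn hg.continuousOn]

theorem push_vectorEmbedding_ae_eq (hQ : (Q : Set (EuclideanSpace ℝ (Fin d))) ⊆ U)
    (hU : MeasurableSet U) (v : EuclideanSpace ℂ (Fin N)) {f : EuclideanSpace ℝ (Fin d) → ℝ}
    (hf : Continuous f) (hs : ∀ z ∉ Q, f z = 0) :
    (push (vectorEmbedding hQ hU v) f : L2 U N) =ᵐ[volume.restrict U] fun z => (f z : ℂ) • v := by
  rw [push, vectorEmbedding_apply]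
  refine (MemLp.coeFn_toLp _).trans (Eventually.of_forall fun z => ?_)
  simp only
  congr 2
  by_cases hz : z ∈ Q
  · rw [extendZero_of_mem _ hz, ContinuousMap.mkD_apply_of_continuousOn hf.continuousOn]
  · rw [extendZero_of_notMem _ hz, hs z hz]

theorem isTestFunction_smul {f : EuclideanSpace ℝ (Fin d) → ℝ} (hf : ContDiff ℝ ∞ f)
    (hc : HasCompactSupport f) (hs : tsupport f ⊆ U) (v : EuclideanSpace ℂ (Fin N)) :
    IsTestFunction U fun z => (f z : ℂ) • v := by
  refine ⟨(Complex.ofRealCLM.contDiff.comp hf).smul contDiff_const, ?_, ?_⟩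
  · exact (hc.comp_left (g := fun r : ℝ => (r : ℂ)) Complex.ofReal_zero).smul_right
  · refine (closure_mono ?_).trans hs
    intro z hz hz'
    exact hz (by simp [hz'])

theorem laplacian_ofReal_smul {f : EuclideanSpace ℝ (Fin d) → ℝ} (hf : ContDiff ℝ 2 f)
    (v : EuclideanSpace ℂ (Fin N)) (z : EuclideanSpace ℝ (Fin d)) :
    Laplacian.laplacian (fun z => (f z : ℂ) • v) z = (Laplacian.laplacian f z : ℂ) • v := by
  let l : ℝ →L[ℝ] EuclideanSpace ℂ (Fin N) := (ContinuousLinearMap.id ℝ ℝ).smulRight v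
  have h := hf.contDiffAt.laplacian_CLM_comp_left (l := l) (x := z)
  have h1 : (l ∘ f) = fun z => (f z : ℂ) • v := by
    ext z
    simp [l]
  rw [h1] at h
  rw [h]
  ext i
  simp [l]

/-- A smooth scalar function supported in `Q ⊆ U`, multiplied by a fixed vector, is a test function,
so the hypothesis on the extension applies to it. -/
theorem actsAsLaplacian_vectorEmbedding {A : L2 U N →ₗ.[ℂ] L2 U N} (hext : ExtendsLaplacian U A)
    (hQ : (Q : Set (EuclideanSpace ℝ (Fin d))) ⊆ U) (hU : MeasurableSet U)
    (v : EuclideanSpace ℂ (Fin N)) : ActsAsLaplacian A (vectorEmbedding hQ hU v) := by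
  intro f hf hs
  have h2 : ContDiff ℝ 2 f := hf.of_le (by norm_cast)
  refine hext (fun z => (f z : ℂ) • v) (isTestFunction_smul hf
    (HasCompactSupport.of_support_subset_isCompact Q.isCompact ((subset_tsupport f).trans hs))
    (hs.trans hQ) v) _ _ ?_ ?_
  · exact push_vectorEmbedding_ae_eq hQ hU v hf.continuous
      fun z hz => image_eq_zero_of_notMem_tsupport fun h => hz (hs h)
  · refine (push_vectorEmbedding_ae_eq hQ hU v (continuous_laplacian hf).neg
      fun z hz => ?_).trans (Eventually.of_forall fun z => ?_)
    · rw [Pi.neg_apply, laplacian_eq_zero_of_notMem_tsupport fun h => hz (hs h), neg_zero]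
    · simp only
      rw [laplacian_ofReal_smul h2, Pi.neg_apply, Complex.ofReal_neg, neg_smul]

end Embedding
end

/-! ### From local Hilbert space valued kernels to continuous integral kernels -/

section

open Filter Topology TopologicalSpace

section LocalKernels

variable {d N : ℕ} {U : Set (EuclideanSpace ℝ (Fin d))}

/-- On the open set `V`, the operator `T` applied to scalar multiples of `v` is given by the
continuous Hilbert space valued function `κ`. -/
def IsLocalKernel (T : L2 U N →L[ℂ] L2 U N) (v : EuclideanSpace ℂ (Fin N))
    (V : Set (EuclideanSpace ℝ (Fin d))) (κ : EuclideanSpace ℝ (Fin d) → L2 U N) : Prop :=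
  ContinuousOn κ V ∧ ∀ η : EuclideanSpace ℝ (Fin d) → ℝ, ContDiff ℝ ∞ η → HasCompactSupport η →
    tsupport η ⊆ V → ∀ u : L2 U N, u =ᵐ[volume.restrict U] (fun x => (η x : ℂ) • v) →
      ∀ f : L2 U N, inner ℂ f (T u) = ∫ x, (η x : ℂ) * inner ℂ f (κ x)

/-- Self-adjointness moves `T` onto `f`, and the fundamental lemma of the calculus of variations
removes the test function. Thus `T f` is given on `V` by pairing `f` with a continuous curve of
vectors. -/
theorem IsLocalKernel.ae_eq {T : L2 U N →L[ℂ] L2 U N} (hT : IsSelfAdjoint T)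
    {v : EuclideanSpace ℂ (Fin N)} {V : Set (EuclideanSpace ℝ (Fin d))} (hV : IsOpen V) (hVU : V ⊆ U)
    {κ : EuclideanSpace ℝ (Fin d) → L2 U N} (hκ : IsLocalKernel T v V κ) (f : L2 U N) :
    ∀ᵐ x ∂volume.restrict U, x ∈ V → inner ℂ v (T f x) = inner ℂ (κ x) f := by
  have h1 : LocallyIntegrable (fun x => inner ℂ (T f x) v) (volume.restrict U) :=
    ((Lp.memLp (T f)).inner_const v).locallyIntegrable (by norm_num)
  have h2 : LocallyIntegrableOn (fun x => inner ℂ f (κ x)) V (volume.restrict U) :=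
    (continuousOn_const.inner hκ.1).locallyIntegrableOn hV.measurableSet
  have key := hV.ae_eq_zero_of_integral_contDiff_smul_eq_zero (μ := volume.restrict U)
    ((h1.locallyIntegrableOn V).sub h2) ?_
  · filter_upwards [key] with x hx hxV
    have := hx hxV
    rw [Pi.sub_apply, sub_eq_zero] at this
    rw [← inner_conj_symm, this, inner_conj_symm]
  · intro η hη hc hs
    have hmem : MemLp (fun x => (η x : ℂ) • v) 2 (volume.restrict U) :=
      (isTestFunction_smul hη hc (hs.trans hVU) v).1.continuous.memLp_of_hasCompactSupport
        (isTestFunction_smul hη hc (hs.trans hVU) v).2.1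
    have h := hκ.2 η hη hc hs hmem.toLp hmem.coeFn_toLp f
    have hsymm : inner ℂ f (T hmem.toLp) = inner ℂ (T f) hmem.toLp :=
      ((ContinuousLinearMap.isSelfAdjoint_iff_isSymmetric.1 hT) f hmem.toLp).symm
    rw [hsymm, L2.inner_def] at h
    have h3 : ∫ x in U, inner ℂ (T f x) (hmem.toLp _ x) = ∫ x in U, η x • inner ℂ (T f x) v := by
      refine integral_congr_ae ?_
      filter_upwards [hmem.coeFn_toLp] with x hx
      rw [hx, inner_smul_right, Complex.real_smul]
    have h4 : ∫ x in U, η x • inner ℂ f (κ x) = ∫ x, (η x : ℂ) * inner ℂ f (κ x) := by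
      rw [setIntegral_eq_integral_of_forall_compl_eq_zero]
      · simp
      · intro x hx
        rw [image_eq_zero_of_notMem_tsupport fun h => hx (hVU (hs h)), zero_smul]
    have i1 : Integrable (fun x => η x • inner ℂ (T f x) v) (volume.restrict U) := by
      have := h1.integrable_smul_left_of_hasCompactSupport hη.continuous hc
      exact this
    have i2 : Integrable (fun x => η x • inner ℂ f (κ x)) (volume.restrict U) :=
      integrable_smul_of_tsupport_subset hV hη.continuous hc hs (continuousOn_const.inner hκ.1)
    simp only [Pi.sub_apply, smul_sub]
    rw [integral_sub i1 i2, ← h3, h, h4, sub_self]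

/-- Two local kernels agree almost everywhere on an overlap after pairing with any `f`, hence
everywhere by continuity. The local kernels therefore glue, the global one being the diagonal choice
`κ x x`. -/
theorem exists_global_kernel (hU : IsOpen U) {T : L2 U N →L[ℂ] L2 U N} (hT : IsSelfAdjoint T)
    {v : EuclideanSpace ℂ (Fin N)}
    (hloc : ∀ x₀ ∈ U, ∃ V, IsOpen V ∧ x₀ ∈ V ∧ V ⊆ U ∧ ∃ κ, IsLocalKernel T v V κ) :
    ∃ κ : EuclideanSpace ℝ (Fin d) → L2 U N, ContinuousOn κ U ∧
      ∀ f : L2 U N, ∀ᵐ x ∂volume.restrict U, inner ℂ v (T f x) = inner ℂ (κ x) f := by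
  choose! V hVo hxV hVU κ hκ using hloc
  have hcons : ∀ x₀ ∈ U, ∀ x₁ ∈ U, ∀ x ∈ V x₀ ∩ V x₁, κ x₀ x = κ x₁ x := by
    intro x₀ h₀ x₁ h₁ x hx
    refine ext_inner_right ℂ fun f => ?_
    have hopen := (hVo x₀ h₀).inter (hVo x₁ h₁)
    refine Measure.eqOn_open_of_ae_eq (μ := volume) (U := V x₀ ∩ V x₁)
      (f := fun x => inner ℂ (κ x₀ x) f) (g := fun x => inner ℂ (κ x₁ x) f) ?_ hopen
      (((hκ x₀ h₀).1.mono inter_subset_left).inner continuousOn_const)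
      (((hκ x₁ h₁).1.mono inter_subset_right).inner continuousOn_const) hx
    have hle : volume.restrict (V x₀ ∩ V x₁) ≤ volume.restrict U :=
      Measure.restrict_mono_set _ (inter_subset_left.trans (hVU x₀ h₀))
    filter_upwards [(hκ x₀ h₀).ae_eq hT (hVo x₀ h₀) (hVU x₀ h₀) f |>.filter_mono (ae_mono hle),
      (hκ x₁ h₁).ae_eq hT (hVo x₁ h₁) (hVU x₁ h₁) f |>.filter_mono (ae_mono hle),
      ae_restrict_mem hopen.measurableSet] with y hy0 hy1 hy
    rw [← hy0 hy.1, ← hy1 hy.2]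
  have heq : ∀ x₀ ∈ U, EqOn (fun x => κ x x) (κ x₀) (V x₀) := fun x₀ h₀ x hx =>
    hcons x (hVU x₀ h₀ hx) x₀ h₀ x ⟨hxV x (hVU x₀ h₀ hx), hx⟩
  refine ⟨fun x => κ x x, fun x₀ h₀ => ?_, fun f => ?_⟩
  · have : ContinuousAt (κ x₀) x₀ := (hκ x₀ h₀).1.continuousAt ((hVo x₀ h₀).mem_nhds (hxV x₀ h₀))
    refine (this.congr ?_).continuousWithinAt
    filter_upwards [(hVo x₀ h₀).mem_nhds (hxV x₀ h₀)] with x hx using (heq x₀ h₀ hx).symm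
  · rw [ae_restrict_iff' hU.measurableSet, ae_iff]
    -- The neighbourhoods form an uncountable family, so the exceptional null sets cannot simply be
    -- united; local nullity suffices because the topology is second countable.
    refine measure_null_of_locally_null _ fun x₀ hx₀ => ?_
    have h₀ : x₀ ∈ U := by
      by_contra h
      exact hx₀ fun h' => absurd h' h
    refine ⟨V x₀ ∩ {x | ¬(x ∈ U → inner ℂ v (T f x) = inner ℂ (κ x x) f)},
      inter_mem (mem_nhdsWithin_of_mem_nhds ((hVo x₀ h₀).mem_nhds (hxV x₀ h₀)))
        self_mem_nhdsWithin, ?_⟩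
    have h := (hκ x₀ h₀).ae_eq hT (hVo x₀ h₀) (hVU x₀ h₀) f
    rw [ae_restrict_iff' hU.measurableSet, ae_iff] at h
    refine measure_mono_null ?_ h
    rintro x ⟨hxV', hx⟩ hall
    exact hx fun hxU => (hall hxU hxV').trans (by rw [← heq x₀ h₀ hxV'])

/-- The matrix element is `⟨T φ, T ψ⟩`, and each factor `T` is given by pairing with the continuous
vectors `κ i x`. The inner products `⟨κ i x, κ j y⟩` are therefore the entries of the kernel,
jointly continuous because `κ` is continuous in norm. -/
theorem exists_isIntegralKernel_mul_self (hU : IsOpen U) {T : L2 U N →L[ℂ] L2 U N}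
    (hT : IsSelfAdjoint T)
    (hloc : ∀ v, ∀ x₀ ∈ U, ∃ V, IsOpen V ∧ x₀ ∈ V ∧ V ⊆ U ∧ ∃ κ, IsLocalKernel T v V κ) :
    ∃ K, IsIntegralKernel U (T * T) K := by
  let b := EuclideanSpace.basisFun (Fin N) ℂ
  choose κ hκc hκ using fun i => exists_global_kernel hU hT (hloc (b i))
  have hsymm : ∀ f g, inner ℂ (T f) g = inner ℂ f (T g) := fun f g =>
    (ContinuousLinearMap.isSelfAdjoint_iff_isSymmetric.1 hT) f g
  have hTf : ∀ f : L2 U N, ∀ᵐ x ∂volume.restrict U, T f x = ∑ i, inner ℂ (κ i x) f • b i := by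
    intro f
    filter_upwards [ae_all_iff.2 fun i => hκ i f] with x hx
    simp_rw [← hx]
    exact (b.sum_repr' _).symm
  refine ⟨fun x y => ∑ i, ∑ j, inner ℂ (κ i x) (κ j y) • InnerProductSpace.rankOne ℂ (b i) (b j),
    ?_, ?_⟩
  · refine continuousOn_finsetSum _ fun i _ => continuousOn_finsetSum _ fun j _ => ?_
    have h1 : ContinuousOn (fun p : EuclideanSpace ℝ (Fin d) × EuclideanSpace ℝ (Fin d) => κ i p.1)
        (U ×ˢ U) := (hκc i).comp continuousOn_fst fun p hp => hp.1
    have h2 : ContinuousOn (fun p : EuclideanSpace ℝ (Fin d) × EuclideanSpace ℝ (Fin d) => κ j p.2)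
        (U ×ˢ U) := (hκc j).comp continuousOn_snd fun p hp => hp.2
    exact (ContinuousOn.inner (𝕜 := ℂ) h1 h2).smul continuousOn_const
  · intro φ ψ _ _ u w hu hw
    have hstep : ∀ g : L2 U N, inner ℂ g (T w) =
        ∫ y in U, ∑ j, inner ℂ g (κ j y) * inner ℂ (b j) (ψ y) := by
      intro g
      rw [← hsymm, L2.inner_def]
      refine integral_congr_ae ?_
      filter_upwards [hTf g, hw] with y hy hwy
      rw [hy, hwy, sum_inner]
      refine Finset.sum_congr rfl fun j _ => ?_
      rw [inner_smul_left, inner_conj_symm]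
    have hintg : ∀ g : L2 U N, Integrable
        (fun y => ∑ j, inner ℂ g (κ j y) * inner ℂ (b j) (ψ y)) (volume.restrict U) := by
      intro g
      refine (L2.integrable_inner (𝕜 := ℂ) (T g) w).congr ?_
      filter_upwards [hTf g, hw] with y hy hwy
      rw [hy, hwy, sum_inner]
      refine Finset.sum_congr rfl fun j _ => ?_
      rw [inner_smul_left, inner_conj_symm]
    change inner ℂ u (T (T w)) = _
    rw [L2.inner_def]
    refine integral_congr_ae ?_
    filter_upwards [hTf (T w), hu] with x hx hux
    rw [hx, hux, inner_sum]
    have h1 : ∀ i, inner ℂ (φ x) (inner ℂ (κ i x) (T w) • b i) =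
        ∫ y in U, inner ℂ (φ x) (b i) * ∑ j, inner ℂ (κ i x) (κ j y) * inner ℂ (b j) (ψ y) := by
      intro i
      rw [integral_const_mul, ← hstep, inner_smul_right, mul_comm]
    simp_rw [h1]
    rw [← integral_finsetSum _ fun i _ => (hintg (κ i x)).const_mul _]
    refine integral_congr_ae (Eventually.of_forall fun y => ?_)
    simp only [_root_.sum_apply, _root_.smul_apply,
      InnerProductSpace.rankOne_apply, inner_sum, inner_smul_right, Finset.mul_sum]
    refine Finset.sum_congr rfl fun i _ => Finset.sum_congr rfl fun j _ => ?_
    ring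

end LocalKernels
end

/-! ### Cutoff functions and the `L²` size of the heat kernel -/

section

open Filter Topology TopologicalSpace

section KernelExistence

variable {d : ℕ}

/-- A cutoff function around `x₀` whose commutator terms are exponentially small. -/
theorem exists_cutoff (x₀ : EuclideanSpace ℝ (Fin d)) {b ε r : ℝ} (hb : 0 ≤ b) (hε : 0 < ε)
    (hr : b + 2 * ε < r) :
    ∃ χ : EuclideanSpace ℝ (Fin d) → ℝ, ContDiff ℝ ∞ χ ∧ tsupport χ ⊆ Metric.closedBall x₀ r ∧
      (∀ z, 0 ≤ χ z ∧ χ z ≤ 1) ∧ (∀ z ∈ Metric.ball x₀ (b + 2 * ε), χ z = 1) ∧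
        ∃ C, 0 ≤ C ∧ ∀ τ, 0 < τ → ∀ x ∈ Metric.ball x₀ ε, ∀ z,
          |commutatorTerm χ τ x z| ≤ C * Real.exp (-b ^ 2 / (4 * τ)) := by
  let χ : ContDiffBump x₀ := ⟨b + 2 * ε, r, by linarith, hr⟩
  have hone : ∀ z ∈ Metric.ball x₀ (b + 2 * ε), (χ : EuclideanSpace ℝ (Fin d) → ℝ) =ᶠ[𝓝 z] 1 := by
    intro z hz
    filter_upwards [Metric.isOpen_ball.mem_nhds hz] with w hw
    exact χ.one_of_mem_closedBall (Metric.ball_subset_closedBall hw)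
  refine ⟨χ, χ.contDiff, χ.tsupport_eq.subset, fun z => ⟨χ.nonneg, χ.le_one⟩,
    fun z hz => (hone z hz).eq_of_nhds, ?_⟩
  · refine exists_commutatorTerm_le (a := b + ε) χ.contDiff χ.hasCompactSupport
      Metric.isBounded_ball hb (by linarith) fun x hx z hz => ?_
    -- A pole within `ε` of the centre and a point within `b + ε` of the pole: such a point lies in
    -- the ball on which the cutoff equals one.
    have hz' : z ∈ Metric.ball x₀ (b + 2 * ε) := by
      rw [Metric.mem_ball, dist_eq_norm] at *
      have := norm_add_le (z - x) (x - x₀)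
      rw [sub_add_sub_cancel] at this
      linarith
    have h := hone z hz'
    constructor
    · rw [h.fderiv_eq, show (1 : EuclideanSpace ℝ (Fin d) → ℝ) = fun _ => 1 from rfl, fderiv_fun_const]
      rfl
    · rw [(InnerProductSpace.laplacian_congr_nhds h).eq_of_nhds]
      exact congrFun (InnerProductSpace.laplacian_const (c := (1 : ℝ))) z

variable {N : ℕ} {U : Set (EuclideanSpace ℝ (Fin d))}
variable {Q : Compacts (EuclideanSpace ℝ (Fin d))}

/-- The square of the norm is at most the supremum of the heat kernel times its integral, which is
of order `t^(-d/2)`; the root gives `t^(-d/4)`, and this exponent decides which fractional powers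
have kernels. -/
theorem norm_localHeat_vectorEmbedding_le (hQ : (Q : Set (EuclideanSpace ℝ (Fin d))) ⊆ U)
    (hU : MeasurableSet U) (v : EuclideanSpace ℂ (Fin N)) {χ : EuclideanSpace ℝ (Fin d) → ℝ}
    (hχ : Continuous χ) (hχ1 : ∀ z, |χ z| ≤ 1) (x : EuclideanSpace ℝ (Fin d)) {t : ℝ} (ht : 0 < t) :
    ‖localHeat (vectorEmbedding hQ hU v) χ x t‖ ≤
      ‖v‖ * (4 * Real.pi) ^ (-(d : ℝ) / 4) * t ^ (-(d : ℝ) / 4) := by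
  have hcont : Continuous fun z => χ z * heatKernel t (z - x) :=
    hχ.mul (contDiff_heatKernel (n := 0) t x).continuous
  have h := inner_push_vectorEmbedding hQ hU v v hcont hcont
  have hsq : ‖localHeat (vectorEmbedding hQ hU v) χ x t‖ ^ 2 = ‖v‖ ^ 2 *
      ∫ z in (Q : Set (EuclideanSpace ℝ (Fin d))),
        (χ z * heatKernel t (z - x)) * (χ z * heatKernel t (z - x)) := by
    rw [@norm_sq_eq_re_inner ℂ, localHeat, h, @norm_sq_eq_re_inner ℂ _ _ _ _ v]
    exact Complex.re_mul_ofReal _ _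
  have hintg : Integrable fun z => heatKernel t (z - x) := (integrable_heatKernel ht).comp_sub_right x
  have hle : ∫ z in (Q : Set (EuclideanSpace ℝ (Fin d))),
      (χ z * heatKernel t (z - x)) * (χ z * heatKernel t (z - x)) ≤
      (4 * Real.pi * t) ^ (-(d : ℝ) / 2) := by
    calc _ ≤ ∫ z in (Q : Set (EuclideanSpace ℝ (Fin d))),
        (4 * Real.pi * t) ^ (-(d : ℝ) / 2) * heatKernel t (z - x) := by
          refine setIntegral_mono ?_ (hintg.integrableOn.const_mul _) fun z => ?_
          · exact (hcont.mul hcont).continuousOn.integrableOn_compact Q.isCompact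
          · have h1 := heatKernel_le ht (z - x)
            have h0 : 0 ≤ heatKernel t (z - x) := heatKernel_nonneg ht.le _
            have h2 : χ z * χ z ≤ 1 := by
              have := mul_self_le_mul_self (abs_nonneg _) (hχ1 z)
              rwa [abs_mul_abs_self, one_mul] at this
            calc χ z * heatKernel t (z - x) * (χ z * heatKernel t (z - x)) =
                  (χ z * χ z) * (heatKernel t (z - x) * heatKernel t (z - x)) := by ring
              _ ≤ 1 * (heatKernel t (z - x) * heatKernel t (z - x)) :=
                  mul_le_mul_of_nonneg_right h2 (by positivity)
              _ ≤ _ := by rw [one_mul]; exact mul_le_mul_of_nonneg_right h1 h0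
      _ = (4 * Real.pi * t) ^ (-(d : ℝ) / 2) *
          ∫ z in (Q : Set (EuclideanSpace ℝ (Fin d))), heatKernel t (z - x) :=
          integral_const_mul _ _
      _ ≤ (4 * Real.pi * t) ^ (-(d : ℝ) / 2) * 1 := by
          refine mul_le_mul_of_nonneg_left ?_ (by positivity)
          refine (setIntegral_le_integral hintg (Eventually.of_forall fun z =>
            heatKernel_nonneg ht.le _)).trans_eq ?_
          rw [integral_sub_right_eq_self (fun z => heatKernel t z) x]
          exact integral_heatKernel ht
      _ = _ := mul_one _
  refine abs_le_of_sq_le_sq' ?_ (by positivity) |>.2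
  rw [hsq, mul_assoc, mul_pow, ← Real.mul_rpow (by positivity) ht.le, ← Real.rpow_natCast _ 2,
    ← Real.rpow_natCast (_ ^ _) 2, ← Real.rpow_mul (by positivity)]
  refine mul_le_mul_of_nonneg_left (hle.trans_eq ?_) (by positivity)
  congr 1
  push_cast
  ring

end KernelExistence

/-! ### Kernels of fractional powers as Laplace transforms of heat kernels -/

section ResolventKernel

variable {d : ℕ} {H : Type*} [NormedAddCommGroup H] [InnerProductSpace ℂ H] [CompleteSpace H]
variable {A : H →ₗ.[ℂ] H}
variable {Q : Compacts (EuclideanSpace ℝ (Fin d))} {e : C(Q, ℝ) →L[ℝ] H}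
variable {χ : EuclideanSpace ℝ (Fin d) → ℝ}

variable (A e χ) in
/-- The kernel of `(1 + A)^(-α)` with pole `x`, as an element of the Hilbert space. -/
def resolventKernel (α : ℝ) (x : EuclideanSpace ℝ (Fin d)) : H :=
  (Real.Gamma α)⁻¹ • ∫ t in Ioi (0 : ℝ), (t ^ (α - 1) * Real.exp (-t)) • localKernel A e χ x t

theorem norm_localKernel_le (hA : IsNonnegSelfAdjoint A) {x : EuclideanSpace ℝ (Fin d)} {C M : ℝ}
    (hC : ∀ τ, 0 < τ → ‖localDefect e χ x τ‖ ≤ C)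
    (hM : ∀ τ, 0 < τ → ‖localHeat e χ x τ‖ ≤ M * τ ^ (-(d : ℝ) / 4)) {t : ℝ} (ht : 0 < t) :
    ‖localKernel A e χ x t‖ ≤ M * t ^ (-(d : ℝ) / 4) + C * t := by
  have hC0 : 0 ≤ C := (norm_nonneg _).trans (hC 1 one_pos)
  have h := norm_duhamelTerm_le (e := e) (χ := χ) (x := x) (b := 0) hA hC0 (by simpa using hC) ht
  have h' : ‖duhamelTerm A e χ x t‖ ≤ C * t := by simpa using h
  exact (norm_sub_le _ _).trans (add_le_add (hM t ht) h')

/-- A dominating function for the integral defining `resolventKernel`. -/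
theorem integrableOn_resolvent_bound {α : ℝ} (hα : (d : ℝ) / 4 < α) (M C : ℝ) :
    IntegrableOn (fun t : ℝ => (t ^ (α - 1) * Real.exp (-t)) * (M * t ^ (-(d : ℝ) / 4) + C * t))
      (Ioi 0) := by
  have h1 := (Real.GammaIntegral_convergent (s := α - d / 4) (by linarith)).const_mul M
  have hα0 : 0 < α := lt_of_le_of_lt (by positivity) hα
  have h2 := (Real.GammaIntegral_convergent (s := α + 1) (by linarith)).const_mul C
  refine (h1.add h2).congr ?_
  refine (ae_restrict_iff' measurableSet_Ioi).2 (Eventually.of_forall fun t ht => ?_)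
  have ht' : (0 : ℝ) < t := ht
  have e1 : t ^ (α - d / 4 - 1) = t ^ (α - 1) * t ^ (-(d : ℝ) / 4) := by
    rw [← Real.rpow_add ht']; congr 1; ring
  have e2 : t ^ (α + 1 - 1) = t ^ (α - 1) * t := by
    rw [← Real.rpow_add_one ht'.ne']; congr 1; ring
  simp only [Pi.add_apply, e1, e2]
  ring

section
variable {V : Set (EuclideanSpace ℝ (Fin d))} {C M α : ℝ}

theorem continuousOn_resolvent_integrand (hA : IsNonnegSelfAdjoint A) (hχ : ContDiff ℝ ∞ χ)
    (hC : ∀ x ∈ V, ∀ τ, 0 < τ → ‖localDefect e χ x τ‖ ≤ C) :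
    ContinuousOn (Function.uncurry fun (x : EuclideanSpace ℝ (Fin d)) (t : ℝ) =>
      (t ^ (α - 1) * Real.exp (-t)) • localKernel A e χ x t) (V ×ˢ Ioi 0) := by
  have h1 : ContinuousOn (fun p : EuclideanSpace ℝ (Fin d) × ℝ => p.2 ^ (α - 1) * Real.exp (-p.2))
      (V ×ˢ Ioi 0) :=
    (ContinuousOn.rpow_const continuousOn_snd fun p hp =>
      Or.inl (ne_of_gt (mem_Ioi.1 hp.2))).mul (by fun_prop)
  exact h1.smul (continuousOn_localKernel hA hχ hC)

theorem norm_resolvent_integrand_le (hA : IsNonnegSelfAdjoint A)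
    (hC : ∀ x ∈ V, ∀ τ, 0 < τ → ‖localDefect e χ x τ‖ ≤ C)
    (hM : ∀ x ∈ V, ∀ τ, 0 < τ → ‖localHeat e χ x τ‖ ≤ M * τ ^ (-(d : ℝ) / 4))
    {x : EuclideanSpace ℝ (Fin d)} (hx : x ∈ V) {t : ℝ} (ht : 0 < t) :
    ‖(t ^ (α - 1) * Real.exp (-t)) • localKernel A e χ x t‖ ≤
      (t ^ (α - 1) * Real.exp (-t)) * (M * t ^ (-(d : ℝ) / 4) + C * t) := by
  rw [norm_smul, Real.norm_of_nonneg (by positivity)]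
  exact mul_le_mul_of_nonneg_left (norm_localKernel_le hA (hC x hx) (hM x hx) ht) (by positivity)

/-- Dominated convergence. At small times the integrand is of order `t^(α - 1 - d/4)`, integrable
because `α > d / 4`; at large times `exp (-t)` beats the linear growth of the Duhamel term. -/
theorem continuousOn_resolventKernel (hA : IsNonnegSelfAdjoint A) (hχ : ContDiff ℝ ∞ χ)
    (hα : (d : ℝ) / 4 < α) (hC : ∀ x ∈ V, ∀ τ, 0 < τ → ‖localDefect e χ x τ‖ ≤ C)
    (hM : ∀ x ∈ V, ∀ τ, 0 < τ → ‖localHeat e χ x τ‖ ≤ M * τ ^ (-(d : ℝ) / 4)) :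
    ContinuousOn (resolventKernel A e χ α) V := by
  refine ContinuousOn.const_smul ?_ _
  have hcont := continuousOn_resolvent_integrand (α := α) hA hχ hC
  refine continuousOn_of_dominated ?_ ?_ (integrableOn_resolvent_bound hα M C) ?_
  · intro x hx
    exact (ContinuousOn.uncurry_left x hx hcont).aestronglyMeasurable measurableSet_Ioi
  · intro x hx
    exact (ae_restrict_iff' measurableSet_Ioi).2 (Eventually.of_forall fun _ ht =>
      norm_resolvent_integrand_le hA hC hM hx ht)
  · refine (ae_restrict_iff' measurableSet_Ioi).2 (Eventually.of_forall fun t ht => ?_)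
    exact ContinuousOn.uncurry_right t ht hcont

theorem integrableOn_resolvent_integrand (hA : IsNonnegSelfAdjoint A) (hχ : ContDiff ℝ ∞ χ)
    (hα : (d : ℝ) / 4 < α) (hC : ∀ x ∈ V, ∀ τ, 0 < τ → ‖localDefect e χ x τ‖ ≤ C)
    (hM : ∀ x ∈ V, ∀ τ, 0 < τ → ‖localHeat e χ x τ‖ ≤ M * τ ^ (-(d : ℝ) / 4))
    {x : EuclideanSpace ℝ (Fin d)} (hx : x ∈ V) :
    IntegrableOn (fun t : ℝ => (t ^ (α - 1) * Real.exp (-t)) • localKernel A e χ x t) (Ioi 0) :=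
  (integrableOn_resolvent_bound hα M C).mono'
    ((ContinuousOn.uncurry_left x hx
      (continuousOn_resolvent_integrand hA hχ hC)).aestronglyMeasurable measurableSet_Ioi)
    ((ae_restrict_iff' measurableSet_Ioi).2 (Eventually.of_forall fun _ ht =>
      norm_resolvent_integrand_le hA hC hM hx ht))

/-- `(1 + A)^(-α)` acts on functions supported near the pole through `resolventKernel`. -/
theorem inner_invOneAddRpow_push (hA : IsNonnegSelfAdjoint A)
    (he : ActsAsLaplacian A e) (hχ : ContDiff ℝ ∞ χ) (hQ : tsupport χ ⊆ Q)
    (hV : IsOpen V) (hα : (d : ℝ) / 4 < α)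
    (hC : ∀ x ∈ V, ∀ τ, 0 < τ → ‖localDefect e χ x τ‖ ≤ C)
    (hM : ∀ x ∈ V, ∀ τ, 0 < τ → ‖localHeat e χ x τ‖ ≤ M * τ ^ (-(d : ℝ) / 4))
    (hχV : ∀ x ∈ V, χ x = 1) {η : EuclideanSpace ℝ (Fin d) → ℝ}
    (hη : ContDiff ℝ 1 η) (hc : HasCompactSupport η) (hs : tsupport η ⊆ V) (f : H) :
    inner ℂ f (invOneAddRpow A α (push e η)) =
      ∫ x, η x • inner ℂ f (resolventKernel A e χ α x) := by
  have hα0 : 0 < α := lt_of_le_of_lt (by positivity) hα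
  have hΓ : (Real.Gamma α : ℂ) ≠ 0 := by exact_mod_cast (Real.Gamma_pos_of_pos hα0).ne'
  have h := integral_rpow_mul_inner_heatSemigroup hA hα0 f (push e η)
  refine mul_left_cancel₀ hΓ ?_
  rw [← h]
  have hsupp : ∀ g : EuclideanSpace ℝ (Fin d) → ℂ, ∫ x, η x • g x = ∫ x in V, η x • g x := by
    intro g
    rw [setIntegral_eq_integral_of_forall_compl_eq_zero]
    intro x hx
    rw [image_eq_zero_of_notMem_tsupport fun h => hx (hs h), zero_smul]
  have hL : ∫ t in Ioi (0 : ℝ), ((t ^ (α - 1) * Real.exp (-t) : ℝ) : ℂ) *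
      inner ℂ f (heatSemigroup A t (push e η)) =
      ∫ t in Ioi (0 : ℝ), ∫ x in V,
        η x • inner ℂ f ((t ^ (α - 1) * Real.exp (-t)) • localKernel A e χ x t) := by
    refine setIntegral_congr_fun measurableSet_Ioi fun t ht => ?_
    rw [inner_heatSemigroup_push hA he hχ hQ hV hC hχV hη hc hs ht f, hsupp, ← integral_const_mul]
    refine integral_congr_ae (Eventually.of_forall fun x => ?_)
    simp only
    rw [inner_smul_right_eq_smul, ← Complex.real_smul, smul_comm]
  have hR : (Real.Gamma α : ℂ) * ∫ x, η x • inner ℂ f (resolventKernel A e χ α x) =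
      ∫ x in V, ∫ t in Ioi (0 : ℝ),
        η x • inner ℂ f ((t ^ (α - 1) * Real.exp (-t)) • localKernel A e χ x t) := by
    rw [hsupp, ← integral_const_mul]
    refine setIntegral_congr_fun hV.measurableSet fun x hx => ?_
    rw [integral_smul, integral_inner (integrableOn_resolvent_integrand hA hχ hα hC hM hx),
      resolventKernel, inner_smul_right_eq_smul, Complex.real_smul, Complex.real_smul, Complex.real_smul]
    push_cast
    field_simp
  rw [hL, hR]
  refine integral_integral_swap ?_
  have hηi : Integrable (fun x => |η x|) (volume.restrict V) :=
    (hη.continuous.abs.integrable_of_hasCompactSupport hc.norm).restrict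
  refine Integrable.mono' (g := fun p : ℝ × EuclideanSpace ℝ (Fin d) =>
    ((p.1 ^ (α - 1) * Real.exp (-p.1)) * (M * p.1 ^ (-(d : ℝ) / 4) + C * p.1)) * (‖f‖ * |η p.2|)) ?_ ?_ ?_
  · exact (integrableOn_resolvent_bound hα M C).mul_prod (hηi.const_mul ‖f‖)
  · rw [Measure.prod_restrict]
    refine ContinuousOn.aestronglyMeasurable ?_ (measurableSet_Ioi.prod hV.measurableSet)
    refine ContinuousOn.smul (hη.continuous.comp continuous_snd).continuousOn ?_
    refine continuousOn_const.inner ?_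
    exact (continuousOn_resolvent_integrand (α := α) hA hχ hC).comp
      (f := fun p : ℝ × EuclideanSpace ℝ (Fin d) => (p.2, p.1)) (by fun_prop) fun p hp => ⟨hp.2, hp.1⟩
  · rw [Measure.prod_restrict]
    refine (ae_restrict_iff' (measurableSet_Ioi.prod hV.measurableSet)).2
      (Eventually.of_forall fun p hp => ?_)
    simp only [Function.uncurry]
    rw [norm_smul, Real.norm_eq_abs]
    have h1 := norm_resolvent_integrand_le (α := α) hA hC hM hp.2 hp.1
    have h2 := (norm_inner_le_norm (𝕜 := ℂ) f
      ((p.1 ^ (α - 1) * Real.exp (-p.1)) • localKernel A e χ p.2 p.1)).trans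
      (mul_le_mul_of_nonneg_left h1 (norm_nonneg f))
    refine (mul_le_mul_of_nonneg_left h2 (abs_nonneg _)).trans_eq ?_
    ring

end
end ResolventKernel
end

/-! ### Existence of the heat kernel and of the resolvent kernel -/

section

open Filter Topology TopologicalSpace

section

variable {d : ℕ} {χ : EuclideanSpace ℝ (Fin d) → ℝ}

theorem continuous_commutatorTerm (hχ : ContDiff ℝ ∞ χ) {τ : ℝ} (hτ : 0 < τ)
    (x : EuclideanSpace ℝ (Fin d)) : Continuous (commutatorTerm χ τ x) := by
  rw [← continuousOn_univ]
  exact (continuousOn_commutatorTerm hχ).comp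
    (f := fun z => ((x, τ), z)) (by fun_prop) fun z hz => ⟨⟨mem_univ _, hτ⟩, hz⟩

theorem exists_norm_localDefect_le {H : Type*} [NormedAddCommGroup H] [InnerProductSpace ℂ H]
    {Q : Compacts (EuclideanSpace ℝ (Fin d))} (e : C(Q, ℝ) →L[ℝ] H) (hχ : ContDiff ℝ ∞ χ)
    {V : Set (EuclideanSpace ℝ (Fin d))} {C b : ℝ} (hC0 : 0 ≤ C)
    (hC : ∀ τ, 0 < τ → ∀ x ∈ V, ∀ z, |commutatorTerm χ τ x z| ≤ C * Real.exp (-b ^ 2 / (4 * τ))) :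
    ∃ C', 0 ≤ C' ∧ ∀ x ∈ V, ∀ τ, 0 < τ →
      ‖localDefect e χ x τ‖ ≤ C' * Real.exp (-b ^ 2 / (4 * τ)) := by
  refine ⟨‖e‖ * C, by positivity, fun x hx τ hτ => ?_⟩
  rw [mul_assoc]
  exact norm_push_le e (continuous_commutatorTerm hχ hτ x) (by positivity) fun z _ => hC τ hτ x hx z

theorem isSelfAdjoint_heatSemigroup {H : Type*} [NormedAddCommGroup H] [InnerProductSpace ℂ H]
    [CompleteSpace H] (A : H →ₗ.[ℂ] H) (t : ℝ) : IsSelfAdjoint (heatSemigroup A t) :=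
  cfc_predicate (R := ℝ) _ _

theorem isSelfAdjoint_invOneAddRpow {H : Type*} [NormedAddCommGroup H] [InnerProductSpace ℂ H]
    [CompleteSpace H] (A : H →ₗ.[ℂ] H) (α : ℝ) : IsSelfAdjoint (invOneAddRpow A α) :=
  cfc_predicate (R := ℝ) _ _

theorem heatSemigroup_mul_self {H : Type*} [NormedAddCommGroup H] [InnerProductSpace ℂ H]
    [CompleteSpace H] {A : H →ₗ.[ℂ] H} (hA : IsNonnegSelfAdjoint A) {t : ℝ} (ht : 0 < t) :
    heatSemigroup A (t / 2) * heatSemigroup A (t / 2) = heatSemigroup A t := by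
  have hB := isUnitInterval_invOneAdd hA
  have hc := (continuousOn_heatSymbol_right 0 (half_pos ht)).mono hB.spectrum_subset
  rw [heatSemigroup_eq, heatSemigroup_eq, ← cfc_mul _ _ _ hc hc]
  refine cfc_congr fun b _ => ?_
  unfold heatSymbol
  split_ifs
  · rw [pow_zero, one_mul, one_mul, ← Real.exp_add]
    congr 1
    ring
  · simp

end

section Existence

variable {d N : ℕ} {U : Set (EuclideanSpace ℝ (Fin d))}

/-- Around each point of `U` the parametrix construction applies. -/
theorem exists_parametrix {A : L2 U N →ₗ.[ℂ] L2 U N} (hext : ExtendsLaplacian U A) (hU : IsOpen U)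
    {x₀ : EuclideanSpace ℝ (Fin d)} (hx₀ : x₀ ∈ U) (v : EuclideanSpace ℂ (Fin N)) :
    ∃ (Q : Compacts (EuclideanSpace ℝ (Fin d))) (e : FunctionEmbedding (L2 U N) Q)
      (χ : EuclideanSpace ℝ (Fin d) → ℝ) (V : Set (EuclideanSpace ℝ (Fin d))) (C M : ℝ),
      ActsAsLaplacian A e ∧ ContDiff ℝ ∞ χ ∧ tsupport χ ⊆ Q ∧ IsOpen V ∧ x₀ ∈ V ∧ V ⊆ U ∧
      (∀ x ∈ V, ∀ τ, 0 < τ → ‖localDefect e χ x τ‖ ≤ C) ∧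
      (∀ x ∈ V, ∀ τ, 0 < τ → ‖localHeat e χ x τ‖ ≤ M * τ ^ (-(d : ℝ) / 4)) ∧
      (∀ x ∈ V, χ x = 1) ∧
      ∀ η : EuclideanSpace ℝ (Fin d) → ℝ, Continuous η → tsupport η ⊆ V →
        ∀ u : L2 U N, u =ᵐ[volume.restrict U] (fun x => (η x : ℂ) • v) → u = push e η := by
  obtain ⟨r, hr, hrU⟩ := Metric.nhds_basis_closedBall.mem_iff.1 (hU.mem_nhds hx₀)
  obtain ⟨ε, hε, hεr⟩ : ∃ ε > 0, 0 + 2 * ε < r := ⟨r / 4, by positivity, by linarith⟩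
  obtain ⟨χ, hχ, hχs, hχ01, hone, C, hC0, hC⟩ := exists_cutoff x₀ le_rfl hε hεr
  let Q : Compacts (EuclideanSpace ℝ (Fin d)) := ⟨Metric.closedBall x₀ r, isCompact_closedBall x₀ r⟩
  have hQ : (Q : Set (EuclideanSpace ℝ (Fin d))) ⊆ U := hrU
  let e := vectorEmbedding hQ hU.measurableSet v
  replace hone : ∀ z ∈ Metric.ball x₀ ε, χ z = 1 := fun z hz =>
    hone z (Metric.ball_subset_ball (by linarith) hz)
  have hVQ : Metric.ball x₀ ε ⊆ (Q : Set (EuclideanSpace ℝ (Fin d))) := fun x hx =>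
    hχs (subset_tsupport _ (by rw [Function.mem_support, hone x hx]; exact one_ne_zero))
  obtain ⟨C', -, hC'⟩ := exists_norm_localDefect_le e hχ hC0 hC
  refine ⟨Q, e, χ, Metric.ball x₀ ε, C', ‖v‖ * (4 * Real.pi) ^ (-(d : ℝ) / 4),
    actsAsLaplacian_vectorEmbedding hext hQ hU.measurableSet v, hχ, hχs, Metric.isOpen_ball,
    Metric.mem_ball_self hε, hVQ.trans hQ, fun x hx τ hτ => ?_, fun x _ τ hτ => ?_, hone, ?_⟩
  · simpa using hC' x hx τ hτ
  · exact norm_localHeat_vectorEmbedding_le hQ hU.measurableSet v hχ.continuous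
      (fun z => abs_le.2 ⟨by linarith [(hχ01 z).1], (hχ01 z).2⟩) x hτ
  · intro η hη hs u hu
    refine Lp.ext (hu.trans ?_)
    exact (push_vectorEmbedding_ae_eq hQ hU.measurableSet v hη fun z hz =>
      image_eq_zero_of_notMem_tsupport fun h => hz (hVQ (hs h))).symm

/-- The semigroup law writes the operator as the square of the semigroup at half the time, whose
local kernels are provided by Duhamel's formula. -/
theorem exists_isIntegralKernel_heatSemigroup (hU : IsOpen U) {A : L2 U N →ₗ.[ℂ] L2 U N}
    (hA : IsNonnegSelfAdjoint A) (hext : ExtendsLaplacian U A) {t : ℝ} (ht : 0 < t) :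
    ∃ K, IsIntegralKernel U (heatSemigroup A t) K := by
  rw [← heatSemigroup_mul_self hA ht]
  refine exists_isIntegralKernel_mul_self hU (isSelfAdjoint_heatSemigroup A _) fun v x₀ hx₀ => ?_
  obtain ⟨Q, e, χ, V, C, M, he, hχ, hχs, hV, hxV, hVU, hC, -, hone, hu⟩ :=
    exists_parametrix hext hU hx₀ v
  refine ⟨V, hV, hxV, hVU, fun x => localKernel A e χ x (t / 2),
    continuousOn_localKernel_left hA hχ hC (half_pos ht), fun η hη hc hs u hu' f => ?_⟩
  rw [hu η hη.continuous hs u hu', inner_heatSemigroup_push hA he hχ hχs hV hC hone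
    (hη.of_le (by norm_cast)) hc hs (half_pos ht) f]
  simp only [Complex.real_smul]

/-- The square root has exponent `α = m / 2`, and `α > d / 4` is exactly the hypothesis `m > d / 2`.
-/
theorem exists_isIntegralKernel_invOneAdd_pow (hU : IsOpen U) {A : L2 U N →ₗ.[ℂ] L2 U N}
    (hA : IsNonnegSelfAdjoint A) (hext : ExtendsLaplacian U A) {m : ℕ} (hm : (d : ℝ) / 2 < m) :
    ∃ G, IsIntegralKernel U (invOneAdd A ^ m) G := by
  have hm0 : 0 < m := by
    have : (0 : ℝ) < m := lt_of_le_of_lt (by positivity) hm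
    exact_mod_cast this
  rw [← invOneAddRpow_mul_self hA hm0]
  refine exists_isIntegralKernel_mul_self hU (isSelfAdjoint_invOneAddRpow A _) fun v x₀ hx₀ => ?_
  obtain ⟨Q, e, χ, V, C, M, he, hχ, hχs, hV, hxV, hVU, hC, hM, hone, hu⟩ :=
    exists_parametrix hext hU hx₀ v
  have hα : (d : ℝ) / 4 < m / 2 := by linarith
  refine ⟨V, hV, hxV, hVU, resolventKernel A e χ (m / 2),
    continuousOn_resolventKernel hA hχ hα hC hM, fun η hη hc hs u hu' f => ?_⟩
  rw [hu η hη.continuous hs u hu', inner_invOneAddRpow_push hA he hχ hχs hV hα hC hM hone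
    (hη.of_le (by norm_cast)) hc hs f]
  simp only [Complex.real_smul]

end Existence
end

/-! ### The discrepancy between the heat semigroup and the cut off free evolution -/

section

open Filter Topology TopologicalSpace

section Discrepancy

theorem inner_integral_left {X H : Type*} [MeasurableSpace X] {μ : Measure X}
    [NormedAddCommGroup H] [InnerProductSpace ℂ H] [CompleteSpace H] {f : X → H}
    (hf : Integrable f μ) (g : H) : inner ℂ (∫ x, f x ∂μ) g = ∫ x, inner ℂ (f x) g ∂μ := by
  rw [← inner_conj_symm, ← integral_inner hf, ← integral_conj]
  simp only [inner_conj_symm]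

/-- The derivative is bounded for `τ` in a compact neighbourhood and `x` in the compact support of
`η`, which is the domination needed to differentiate under the integral. -/
theorem hasDerivAt_integral_smul {X F : Type*} [TopologicalSpace X] [MeasurableSpace X]
    [OpensMeasurableSpace X] [T2Space X] {μ : Measure X} [IsFiniteMeasureOnCompacts μ]
    [NormedAddCommGroup F] [NormedSpace ℝ F] [SecondCountableTopologyEither X F] {η : X → ℝ}
    (hη : Continuous η) (hc : HasCompactSupport η) {s : Set ℝ} (hs : IsOpen s) {f f' : ℝ → X → F}
    (hf : ContinuousOn (Function.uncurry f) (s ×ˢ univ))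
    (hf' : ContinuousOn (Function.uncurry f') (s ×ˢ univ))
    (hd : ∀ τ ∈ s, ∀ x, HasDerivAt (fun τ => f τ x) (f' τ x) τ) {τ : ℝ} (hτ : τ ∈ s) :
    HasDerivAt (fun τ => ∫ x, η x • f τ x ∂μ) (∫ x, η x • f' τ x ∂μ) τ := by
  obtain ⟨δ, hδ, hδs⟩ := Metric.nhds_basis_closedBall.mem_iff.1 (hs.mem_nhds hτ)
  have hintg : ∀ {g : ℝ → X → F}, ContinuousOn (Function.uncurry g) (s ×ˢ univ) → ∀ σ ∈ s,
      Integrable (fun x => η x • g σ x) μ := fun {g} hg σ hσ =>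
    integrable_smul_of_tsupport_subset isOpen_univ hη hc (subset_univ _)
      (ContinuousOn.uncurry_left σ hσ hg)
  obtain ⟨C, hC⟩ := ((isCompact_closedBall τ δ).prod hc).exists_bound_of_continuousOn
    (hf'.mono (prod_mono hδs (subset_univ _)))
  refine (hasDerivAt_integral_of_dominated_loc_of_deriv_le (bound := fun x => |η x| * C)
    (F' := fun τ x => η x • f' τ x) (Metric.closedBall_mem_nhds τ hδ) ?_ (hintg hf τ hτ)
    (hintg hf' τ hτ).aestronglyMeasurable ?_ ?_ ?_).2
  · filter_upwards [hs.mem_nhds hτ] with σ hσ using (hintg hf σ hσ).aestronglyMeasurable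
  · refine Eventually.of_forall fun x σ hσ => ?_
    rw [norm_smul, Real.norm_eq_abs]
    by_cases hx : x ∈ tsupport η
    · exact mul_le_mul_of_nonneg_left (hC (σ, x) ⟨hσ, hx⟩) (abs_nonneg _)
    · simp [image_eq_zero_of_notMem_tsupport hx]
  · exact (hη.abs.integrable_of_hasCompactSupport hc.norm).mul_const _
  · exact Eventually.of_forall fun x σ hσ => (hd σ (hδs hσ) x).const_smul (η x)

/-- The inequality `a² / σ + b² / τ ≥ (a + b)² / (σ + τ)`, with equality for `a τ = b σ`. Through it
the distances of the two points to the boundary are added. -/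
theorem exp_neg_mul_exp_neg_le {a b σ τ : ℝ} (hσ : 0 < σ) (hτ : 0 < τ) :
    Real.exp (-a ^ 2 / (4 * σ)) * Real.exp (-b ^ 2 / (4 * τ)) ≤
      Real.exp (-(a + b) ^ 2 / (4 * (σ + τ))) := by
  rw [← Real.exp_add, Real.exp_le_exp, neg_div, neg_div, neg_div, ← neg_add, neg_le_neg_iff,
    div_add_div _ _ (by positivity) (by positivity), div_le_div_iff₀ (by positivity) (by positivity)]
  nlinarith [mul_nonneg (mul_pos hσ hτ).le (sq_nonneg (a * τ - b * σ)), sq_nonneg (a * τ - b * σ)]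

theorem integrable_smul_localHeat {d : ℕ} {H : Type*} [NormedAddCommGroup H] [InnerProductSpace ℂ H]
    {Q : Compacts (EuclideanSpace ℝ (Fin d))} {e : C(Q, ℝ) →L[ℝ] H}
    {χ η : EuclideanSpace ℝ (Fin d) → ℝ} (hχ : ContDiff ℝ ∞ χ) (hη : Continuous η)
    (hc : HasCompactSupport η) {σ : ℝ} (hσ : 0 < σ) :
    Integrable fun x => η x • localHeat e χ x σ :=
  integrable_smul_of_tsupport_subset isOpen_univ hη hc (subset_univ _)
    (continuous_localHeat_left hχ hσ).continuousOn

variable {d : ℕ} {H : Type*} [NormedAddCommGroup H] [InnerProductSpace ℂ H] [CompleteSpace H]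
variable {A : H →ₗ.[ℂ] H}
variable {Q : Compacts (EuclideanSpace ℝ (Fin d))} {e e₂ : C(Q, ℝ) →L[ℝ] H}
variable {χ χ₁ χ₂ : EuclideanSpace ℝ (Fin d) → ℝ}
variable {η η₂ : EuclideanSpace ℝ (Fin d) → ℝ}

variable (A e χ η) in
/-- The difference of the solution of the heat equation with initial value `η` and the cut off
free solution. -/
def freeDiscrepancy (σ : ℝ) : H :=
  heatSemigroup A σ (push e η) - ∫ x, η x • localHeat e χ x σ

theorem continuousOn_freeDiscrepancy (hA : IsNonnegSelfAdjoint A) (hχ : ContDiff ℝ ∞ χ)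
    (hη : Continuous η) (hc : HasCompactSupport η) :
    ContinuousOn (freeDiscrepancy A e χ η) (Ioi 0) := by
  refine ((continuousOn_heatSemigroup hA).clm_apply continuousOn_const).sub ?_
  refine continuousOn_integral_of_compact_support (k := tsupport η) hc ?_ ?_
  · have h1 : ContinuousOn (fun p : ℝ × EuclideanSpace ℝ (Fin d) => η p.2) (Ioi 0 ×ˢ univ) :=
      (hη.comp continuous_snd).continuousOn
    have h2 : ContinuousOn (fun p : ℝ × EuclideanSpace ℝ (Fin d) => localHeat e χ p.2 p.1)
        (Ioi 0 ×ˢ univ) :=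
      (continuousOn_localHeat hχ).comp
        (f := fun p : ℝ × EuclideanSpace ℝ (Fin d) => (p.2, p.1))
        (by fun_prop) fun p hp => ⟨mem_univ _, hp.1⟩
    exact h1.smul h2
  · intro σ x _ hx
    rw [image_eq_zero_of_notMem_tsupport hx, zero_smul]

theorem tendsto_freeDiscrepancy_zero (hA : IsNonnegSelfAdjoint A) (hχ : ContDiff ℝ ∞ χ)
    (hη : ContDiff ℝ 1 η) (hc : HasCompactSupport η) (hχη : ∀ z, χ z * η z = η z) :
    Tendsto (freeDiscrepancy A e χ η) (𝓝[>] 0) (𝓝 0) := by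
  have := (tendsto_heatSemigroup_zero hA (push e η)).sub (tendsto_integral_localHeat (e := e) hχ hη hc hχη)
  rwa [sub_self] at this

/-- The free discrepancy is small of the order of the heat kernel at distance `a`. -/
theorem exists_norm_freeDiscrepancy_le (hA : IsNonnegSelfAdjoint A)
    (he : ActsAsLaplacian A e) (hχ : ContDiff ℝ ∞ χ) (hχ₁ : ContDiff ℝ ∞ χ₁) (hQ : tsupport χ₁ ⊆ Q)
    {V : Set (EuclideanSpace ℝ (Fin d))} (hV : IsOpen V) {C C' a : ℝ} (hC0 : 0 ≤ C) (hC0' : 0 ≤ C')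
    (hC : ∀ x ∈ V, ∀ τ, 0 < τ → ‖localDefect e χ₁ x τ‖ ≤ C * Real.exp (-a ^ 2 / (4 * τ)))
    (hC' : ∀ τ, 0 < τ → ∀ x ∈ V, ∀ z, |(χ z - χ₁ z) * heatKernel τ (z - x)| ≤
      C' * Real.exp (-a ^ 2 / (4 * τ)))
    (hχV : ∀ x ∈ V, χ₁ x = 1)
    (hη : ContDiff ℝ 1 η) (hc : HasCompactSupport η) (hs : tsupport η ⊆ V) :
    ∃ M, 0 ≤ M ∧ ∀ σ, 0 < σ → ‖freeDiscrepancy A e χ η σ‖ ≤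
      M * (1 + σ) * Real.exp (-a ^ 2 / (4 * σ)) := by
  have hCb : ∀ x ∈ V, ∀ τ, 0 < τ → ‖localDefect e χ₁ x τ‖ ≤ C := fun x hx τ hτ =>
    (hC x hx τ hτ).trans (mul_le_of_le_one_right hC0 (Real.exp_le_one_iff.2
      (div_nonpos_of_nonpos_of_nonneg (neg_nonpos.2 (sq_nonneg a)) (by positivity))))
  set I := ∫ x, |η x| with hI
  have hI0 : 0 ≤ I := integral_nonneg fun x => abs_nonneg _
  have hηi : Integrable (fun x => |η x|) := hη.continuous.abs.integrable_of_hasCompactSupport hc.norm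
  refine ⟨I * (‖e‖ * C' + C), by positivity, fun σ hσ => ?_⟩
  set β := (‖e‖ * C' + C) * (1 + σ) * Real.exp (-a ^ 2 / (4 * σ)) with hβ
  -- The difference is the free kernel cut off by `χ - χ₁`, which lives far from the pole, plus the
  -- Duhamel term of the cutoff `χ₁`.
  have hE : ∀ x ∈ V, ‖localHeat e χ x σ - localKernel A e χ₁ x σ‖ ≤ β := by
    intro x hx
    have h1 : ‖localHeat e χ x σ - localHeat e χ₁ x σ‖ ≤
        ‖e‖ * (C' * Real.exp (-a ^ 2 / (4 * σ))) := by
      have hk : Continuous fun z => heatKernel σ (z - x) := (contDiff_heatKernel (n := 0) σ x).continuous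
      have hk1 : Continuous fun z => χ z * heatKernel σ (z - x) := hχ.continuous.mul hk
      have hk2 : Continuous fun z => χ₁ z * heatKernel σ (z - x) := hχ₁.continuous.mul hk
      rw [localHeat, localHeat, ← push_sub e hk1 hk2]
      refine norm_push_le e (hk1.sub hk2) (by positivity) fun z _ => ?_
      rw [← sub_mul]
      exact hC' σ hσ x hx z
    have h2 := norm_duhamelTerm_le hA hC0 (hC x hx) hσ
    calc ‖localHeat e χ x σ - localKernel A e χ₁ x σ‖
        = ‖(localHeat e χ x σ - localHeat e χ₁ x σ) + duhamelTerm A e χ₁ x σ‖ := by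
          rw [localKernel]; congr 1; abel
      _ ≤ ‖e‖ * (C' * Real.exp (-a ^ 2 / (4 * σ))) + C * σ * Real.exp (-a ^ 2 / (4 * σ)) :=
          norm_add_le_of_le h1 h2
      _ = (‖e‖ * C' + C * σ) * Real.exp (-a ^ 2 / (4 * σ)) := by ring
      _ ≤ β := by
          refine mul_le_mul_of_nonneg_right ?_ (Real.exp_nonneg _)
          have : 0 ≤ ‖e‖ * C' := by positivity
          nlinarith
  have hkey : ∀ f : H, ‖inner ℂ f (freeDiscrepancy A e χ η σ)‖ ≤ ‖f‖ * (I * β) := by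
    intro f
    have i1 : Integrable fun x => η x • inner ℂ f (localHeat e χ x σ) :=
      integrable_smul_of_tsupport_subset isOpen_univ hη.continuous hc (subset_univ _)
        (continuousOn_const.inner (continuous_localHeat_left hχ hσ).continuousOn)
    have i2 : Integrable fun x => η x • inner ℂ f (localKernel A e χ₁ x σ) :=
      integrable_smul_of_tsupport_subset hV hη.continuous hc hs
        (continuousOn_const.inner (continuousOn_localKernel_left hA hχ₁ hCb hσ))
    have h1 : inner ℂ f (freeDiscrepancy A e χ η σ) =
        ∫ x, (η x • inner ℂ f (localKernel A e χ₁ x σ) - η x • inner ℂ f (localHeat e χ x σ)) := by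
      rw [freeDiscrepancy, inner_sub_right, inner_heatSemigroup_push hA he hχ₁ hQ hV hCb hχV hη hc hs hσ,
        integral_sub i2 i1, ← integral_inner (integrable_smul_localHeat hχ hη.continuous hc hσ)]
      simp only [inner_smul_right_eq_smul]
    rw [h1]
    refine (norm_integral_le_of_norm_le (g := fun x => |η x| * (‖f‖ * β)) (hηi.mul_const _)
      (Eventually.of_forall fun x => ?_)).trans_eq (by rw [integral_mul_const]; ring)
    by_cases hx : x ∈ tsupport η
    · rw [← smul_sub, ← inner_sub_right, norm_smul, Real.norm_eq_abs]
      refine mul_le_mul_of_nonneg_left ((norm_inner_le_norm _ _).trans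
        (mul_le_mul_of_nonneg_left ?_ (norm_nonneg _))) (abs_nonneg _)
      rw [norm_sub_rev]
      exact hE x (hs hx)
    · simp [image_eq_zero_of_notMem_tsupport hx]
  -- The weak bound is tested on the discrepancy itself.
  have hfin : ‖freeDiscrepancy A e χ η σ‖ ≤ I * β := by
    have h := hkey (freeDiscrepancy A e χ η σ)
    rw [inner_self_eq_norm_sq_to_K, norm_pow, RCLike.norm_ofReal, abs_norm] at h
    rcases (norm_nonneg (freeDiscrepancy A e χ η σ)).eq_or_lt with h0 | h0
    · rw [← h0]
      positivity
    · exact le_of_mul_le_mul_left (by rwa [← pow_two]) h0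
  exact hfin.trans_eq (by rw [hβ]; ring)

/-- The free discrepancy solves the heat equation, weakly on the cut off heat kernels. -/
theorem hasDerivAt_inner_freeDiscrepancy (hA : IsNonnegSelfAdjoint A) (he : ActsAsLaplacian A e)
    (he₂ : ActsAsLaplacian A e₂) {c : ℂ} (hinner : ∀ f g, Continuous f → Continuous g →
      inner ℂ (push e f) (push e₂ g) =
        c * ((∫ z in (Q : Set (EuclideanSpace ℝ (Fin d))), f z * g z : ℝ) : ℂ))
    (hχ : ContDiff ℝ ∞ χ) (hQ : tsupport χ ⊆ Q) (hχ₂ : ContDiff ℝ ∞ χ₂) (hQ₂ : tsupport χ₂ ⊆ Q)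
    (hone : ∀ z ∈ tsupport χ₂, χ =ᶠ[𝓝 z] 1) (hη : Continuous η) (hc : HasCompactSupport η)
    (y : EuclideanSpace ℝ (Fin d)) {t τ : ℝ} (hτ : 0 < τ) (hτt : τ < t) :
    HasDerivAt (fun τ => inner ℂ (freeDiscrepancy A e χ η (t - τ)) (localHeat e₂ χ₂ y τ))
      (inner ℂ (freeDiscrepancy A e χ η (t - τ)) (localDefect e₂ χ₂ y τ)) τ := by
  -- The cutoff `χ` is locally one on the support of `χ₂`, so its commutator vanishes there and is
  -- orthogonal to everything cut off by `χ₂`.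
  have horth : ∀ x σ, 0 < σ → ∀ τ, 0 < τ →
      inner ℂ (localDefect e χ x σ) (localHeat e₂ χ₂ y τ) = 0 := by
    intro x σ hσ τ hτ
    have hk : Continuous fun z => χ₂ z * heatKernel τ (z - y) :=
      hχ₂.continuous.mul (contDiff_heatKernel (n := 0) τ y).continuous
    rw [localDefect, localHeat, hinner _ _ (continuous_commutatorTerm hχ hσ x) hk]
    have : ∀ z, commutatorTerm χ σ x z * (χ₂ z * heatKernel τ (z - y)) = 0 := by
      intro z
      by_cases hz : z ∈ tsupport χ₂
      · have h := hone z hz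
        have h1 : fderiv ℝ χ z = 0 := by
          rw [h.fderiv_eq, show (1 : EuclideanSpace ℝ (Fin d) → ℝ) = fun _ => 1 from rfl,
            fderiv_fun_const]
          rfl
        have h2 : Laplacian.laplacian χ z = 0 := by
          rw [(InnerProductSpace.laplacian_congr_nhds h).eq_of_nhds]
          exact congrFun (InnerProductSpace.laplacian_const (c := (1 : ℝ))) z
        simp [commutatorTerm, h1, h2]
      · simp [image_eq_zero_of_notMem_tsupport hz]
    simp [this]
  have hd : ∀ τ ∈ Ioo 0 t, ∀ x, HasDerivAt
      (fun τ => inner ℂ (localHeat e χ x (t - τ)) (localHeat e₂ χ₂ y τ))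
      (inner ℂ (localHeat e χ x (t - τ)) (localDefect e₂ χ₂ y τ)) τ := by
    intro τ hτ x
    have hσ : 0 < t - τ := sub_pos.2 hτ.2
    obtain ⟨z₁, h1, g1⟩ := exists_hasDerivAt_localHeat he hχ hQ x hσ
    obtain ⟨z₂, h2, g2⟩ := exists_hasDerivAt_localHeat he₂ hχ₂ hQ₂ y hτ.1
    have h1' : HasDerivAt (fun τ => localHeat e χ x (t - τ)) (-z₁) τ := by
      have := h1.scomp τ ((hasDerivAt_id τ).const_sub t)
      simpa [Function.comp_def] using this
    refine (h1'.inner ℂ h2).congr_deriv ?_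
    -- Symmetry of `A` relates the two time derivatives; by the orthogonality only the source of the
    -- second cutoff survives.
    have hg := inner_graph_symm hA g1 g2
    rw [inner_sub_left, inner_sub_right, horth x _ hσ _ hτ.1] at hg
    rw [inner_neg_left]
    linear_combination hg
  have hmapc : ∀ {E : EuclideanSpace ℝ (Fin d) → ℝ → H}, ContinuousOn (E y) (Ioi 0) →
      ContinuousOn (Function.uncurry fun τ x => inner ℂ (localHeat e χ x (t - τ)) (E y τ))
        (Ioo 0 t ×ˢ univ) := by
    intro E hE
    have a1 : ContinuousOn (fun p : ℝ × EuclideanSpace ℝ (Fin d) => localHeat e χ p.2 (t - p.1))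
        (Ioo 0 t ×ˢ univ) :=
      (continuousOn_localHeat hχ).comp
        (f := fun p : ℝ × EuclideanSpace ℝ (Fin d) => (p.2, t - p.1)) (by fun_prop)
        fun p hp => ⟨mem_univ _, sub_pos.2 hp.1.2⟩
    have a2 : ContinuousOn (fun p : ℝ × EuclideanSpace ℝ (Fin d) => E y p.1) (Ioo 0 t ×ˢ univ) :=
      hE.comp continuousOn_fst fun p hp => hp.1.1
    exact a1.inner a2
  have hfree := hasDerivAt_integral_smul (μ := volume) hη hc isOpen_Ioo
    (hmapc (continuousOn_localHeat_right hχ₂ y)) (hmapc (continuousOn_localDefect_right hχ₂ y)) hd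
    ⟨hτ, hτt⟩
  obtain ⟨z', hz, hg⟩ := exists_hasDerivAt_localHeat he₂ hχ₂ hQ₂ y hτ
  have hS := hasDerivAt_inner_heatSemigroup hA hτt (push e η) hz hg
  rw [add_sub_cancel] at hS
  have hsplit : ∀ σ, 0 < σ → ∀ g : H, inner ℂ (freeDiscrepancy A e χ η σ) g =
      inner ℂ (heatSemigroup A σ (push e η)) g - ∫ x, η x • inner ℂ (localHeat e χ x σ) g := by
    intro σ hσ g
    rw [freeDiscrepancy, inner_sub_left, inner_integral_left (integrable_smul_localHeat hχ hη hc hσ)]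
    simp only [inner_smul_left_eq_smul]
  rw [hsplit _ (sub_pos.2 hτt)]
  refine (hS.sub hfree).congr_of_eventuallyEq ?_
  filter_upwards [Iio_mem_nhds hτt] with τ' hτ'
  exact hsplit _ (sub_pos.2 (mem_Iio.1 hτ')) _

end Discrepancy
end

/-! ### Gaussian comparison of heat matrix elements near two points -/

section

open Filter Topology TopologicalSpace

section

variable {d : ℕ} {H : Type*} [NormedAddCommGroup H] [InnerProductSpace ℂ H] [CompleteSpace H]
variable {A : H →ₗ.[ℂ] H}
variable {Q : Compacts (EuclideanSpace ℝ (Fin d))} {e e₂ : C(Q, ℝ) →L[ℝ] H}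
variable {χ χ₁ χ₂ : EuclideanSpace ℝ (Fin d) → ℝ}
variable {η η₂ : EuclideanSpace ℝ (Fin d) → ℝ}

/-- The matrix element of the free heat semigroup between two functions. -/
def freePairing (η η₂ : EuclideanSpace ℝ (Fin d) → ℝ) (t : ℝ) : ℝ :=
  ∫ x, η x * ∫ z, heatKernel t (z - x) * η₂ z

theorem mul_eq_of_eq_one_on_tsupport {V : Set (EuclideanSpace ℝ (Fin d))} (hs : tsupport η ⊆ V)
    (h : ∀ x ∈ V, χ x = 1) (z : EuclideanSpace ℝ (Fin d)) : χ z * η z = η z := by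
  by_cases hz : z ∈ tsupport η
  · rw [h z (hs hz), one_mul]
  · rw [image_eq_zero_of_notMem_tsupport hz, mul_zero]

/-- The matrix elements of the heat semigroups of `A` and of the free Laplacian agree up to an
error of the order of the heat kernel at distance `a + b`. -/
theorem exists_norm_inner_heatSemigroup_sub_le (hA : IsNonnegSelfAdjoint A)
    (he : ActsAsLaplacian A e) (he₂ : ActsAsLaplacian A e₂) {c : ℂ}
    (hinner : ∀ f g, Continuous f → Continuous g → inner ℂ (push e f) (push e₂ g) =
        c * ((∫ z in (Q : Set (EuclideanSpace ℝ (Fin d))), f z * g z : ℝ) : ℂ))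
    (hχ : ContDiff ℝ ∞ χ) (hQ : tsupport χ ⊆ Q) (hχ₁ : ContDiff ℝ ∞ χ₁) (hQ₁ : tsupport χ₁ ⊆ Q)
    (hχ₂ : ContDiff ℝ ∞ χ₂) (hQ₂ : tsupport χ₂ ⊆ Q)
    (hone : ∀ z ∈ tsupport χ₂, χ =ᶠ[𝓝 z] 1)
    {V V₂ : Set (EuclideanSpace ℝ (Fin d))} (hV : IsOpen V) {C C' C₂ a b : ℝ}
    (hC0 : 0 ≤ C) (hC0' : 0 ≤ C') (hC02 : 0 ≤ C₂)
    (hC : ∀ x ∈ V, ∀ τ, 0 < τ → ‖localDefect e χ₁ x τ‖ ≤ C * Real.exp (-a ^ 2 / (4 * τ)))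
    (hC' : ∀ τ, 0 < τ → ∀ x ∈ V, ∀ z, |(χ z - χ₁ z) * heatKernel τ (z - x)| ≤
      C' * Real.exp (-a ^ 2 / (4 * τ)))
    (hC₂ : ∀ x ∈ V₂, ∀ τ, 0 < τ → ‖localDefect e₂ χ₂ x τ‖ ≤ C₂ * Real.exp (-b ^ 2 / (4 * τ)))
    (hχV : ∀ x ∈ V, χ x = 1) (hχ₁V : ∀ x ∈ V, χ₁ x = 1) (hχ₂V : ∀ x ∈ V₂, χ₂ x = 1)
    (hη : ContDiff ℝ 1 η) (hc : HasCompactSupport η) (hs : tsupport η ⊆ V)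
    (hη₂ : ContDiff ℝ 1 η₂) (hc₂ : HasCompactSupport η₂) (hs₂ : tsupport η₂ ⊆ V₂) :
    ∃ M, 0 ≤ M ∧ ∀ t, 0 < t →
      ‖inner ℂ (push e η) (heatSemigroup A t (push e₂ η₂)) - c * (freePairing η η₂ t : ℂ)‖ ≤
        M * (1 + t) * t * Real.exp (-(a + b) ^ 2 / (4 * t)) := by
  obtain ⟨M, hM0, hM⟩ := exists_norm_freeDiscrepancy_le hA he hχ hχ₁ hQ₁ hV hC0 hC0' hC hC' hχ₁V
    hη hc hs
  set I := ∫ x, |η₂ x| with hI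
  have hI0 : 0 ≤ I := integral_nonneg fun x => abs_nonneg _
  have hηi : Integrable (fun x => |η₂ x|) :=
    hη₂.continuous.abs.integrable_of_hasCompactSupport hc₂.norm
  refine ⟨I * (M * C₂), by positivity, fun t ht => ?_⟩
  set β := M * (1 + t) * C₂ * Real.exp (-(a + b) ^ 2 / (4 * t)) with hβ
  have hβ0 : 0 ≤ β := by positivity
  set p := freeDiscrepancy A e χ η with hp
  have hpcont : ContinuousOn p (Ioi 0) := continuousOn_freeDiscrepancy hA hχ hη.continuous hc
  -- The discrepancy at time `t - τ` carries the distance `a` and the defect at time `τ` the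
  -- distance `b`; together they give the distance `a + b` at time `t`, uniformly in `τ`.
  have hderiv : ∀ y ∈ V₂, ∀ τ ∈ Ioo 0 t, ‖inner ℂ (p (t - τ)) (localDefect e₂ χ₂ y τ)‖ ≤ β := by
    intro y hy τ hτ
    have hσ : 0 < t - τ := sub_pos.2 hτ.2
    have h1 := hM (t - τ) hσ
    have h2 := hC₂ y hy τ hτ.1
    have h3 := exp_neg_mul_exp_neg_le (a := a) (b := b) hσ hτ.1
    rw [sub_add_cancel] at h3
    calc ‖inner ℂ (p (t - τ)) (localDefect e₂ χ₂ y τ)‖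
        ≤ (M * (1 + (t - τ)) * Real.exp (-a ^ 2 / (4 * (t - τ)))) *
          (C₂ * Real.exp (-b ^ 2 / (4 * τ))) :=
          (norm_inner_le_norm _ _).trans (mul_le_mul h1 h2 (norm_nonneg _) (by positivity))
      _ = M * (1 + (t - τ)) * C₂ * (Real.exp (-a ^ 2 / (4 * (t - τ))) *
          Real.exp (-b ^ 2 / (4 * τ))) := by ring
      _ ≤ β := by
          refine mul_le_mul ?_ h3 (by positivity) (by positivity)
          refine mul_le_mul_of_nonneg_right (mul_le_mul_of_nonneg_left ?_ hM0) hC02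
          linarith [hτ.1]
  -- The pairing tends to `0` as its time tends to `t`, because the discrepancy starts from `0`.
  -- Integrating the derivative bound backwards from there gives the estimate.
  have hY : ∀ y ∈ V₂, ∀ ε ∈ Ioo 0 t, ‖inner ℂ (p (t - ε)) (localHeat e₂ χ₂ y ε)‖ ≤ β * t := by
    intro y hy ε hε
    have hlim : Tendsto (fun δ => inner ℂ (p (t - δ)) (localHeat e₂ χ₂ y δ)) (𝓝[<] t) (𝓝 0) := by
      have h2 : ContinuousAt (localHeat e₂ χ₂ y) t :=
        (continuousOn_localHeat_right hχ₂ y).continuousAt (Ioi_mem_nhds ht)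
      have h3 : Tendsto (fun τ => t - τ) (𝓝[<] t) (𝓝[>] 0) := by
        refine tendsto_nhdsWithin_iff.2 ⟨?_, ?_⟩
        · have : Continuous fun τ : ℝ => t - τ := by fun_prop
          simpa using (this.tendsto t).mono_left nhdsWithin_le_nhds
        · filter_upwards [self_mem_nhdsWithin] with τ hτ
          exact sub_pos.2 (mem_Iio.1 hτ)
      have h4 := ((tendsto_freeDiscrepancy_zero (e := e) hA hχ hη hc
        (mul_eq_of_eq_one_on_tsupport hs hχV)).comp h3).inner (𝕜 := ℂ)
        (h2.tendsto.mono_left nhdsWithin_le_nhds)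
      rwa [inner_zero_left] at h4
    have hlim2 := (hlim.sub_const (inner ℂ (p (t - ε)) (localHeat e₂ χ₂ y ε))).norm
    rw [zero_sub, norm_neg] at hlim2
    refine le_of_tendsto hlim2 ?_
    filter_upwards [Ioo_mem_nhdsLT hε.2] with δ hδ
    have h := (convex_Ioo 0 t).norm_image_sub_le_of_norm_hasDerivWithin_le
      (f := fun τ => inner ℂ (p (t - τ)) (localHeat e₂ χ₂ y τ))
      (fun τ hτ => (hasDerivAt_inner_freeDiscrepancy hA he he₂ hinner hχ hQ hχ₂ hQ₂ hone
        hη.continuous hc y hτ.1 hτ.2).hasDerivWithinAt)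
      (fun τ hτ => hderiv y hy τ hτ) hε ⟨hε.1.trans hδ.1, hδ.2⟩
    refine h.trans (mul_le_mul_of_nonneg_left ?_ hβ0)
    rw [Real.norm_of_nonneg (by linarith [hδ.1])]
    linarith [hδ.2, hε.1]
  have hsmear : ∀ ε ∈ Ioo 0 t,
      ‖inner ℂ (p (t - ε)) (∫ y, η₂ y • localHeat e₂ χ₂ y ε)‖ ≤ I * (β * t) := by
    intro ε hε
    rw [← integral_inner (integrable_smul_localHeat hχ₂ hη₂.continuous hc₂ hε.1)]
    refine (norm_integral_le_of_norm_le (g := fun x => |η₂ x| * (β * t)) (hηi.mul_const _)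
      (Eventually.of_forall fun y => ?_)).trans_eq (by rw [integral_mul_const])
    rw [inner_smul_right_eq_smul, norm_smul, Real.norm_eq_abs]
    by_cases hy : y ∈ tsupport η₂
    · exact mul_le_mul_of_nonneg_left (hY y (hs₂ hy) ε hε) (abs_nonneg _)
    · simp [image_eq_zero_of_notMem_tsupport hy]
  -- As `ε → 0` the averaged cut off kernels tend to `η₂`.
  have hbound : ‖inner ℂ (p t) (push e₂ η₂)‖ ≤ I * (β * t) := by
    have h1 : Tendsto (fun ε => p (t - ε)) (𝓝[>] 0) (𝓝 (p t)) := by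
      have hpt : ContinuousAt p (t - 0) := hpcont.continuousAt (by simpa using Ioi_mem_nhds ht)
      have hc : ContinuousAt (fun ε => p (t - ε)) 0 :=
        ContinuousAt.comp (f := fun ε => t - ε) hpt (by fun_prop)
      have := hc.tendsto.mono_left (nhdsWithin_le_nhds (s := Ioi 0))
      rwa [sub_zero] at this
    have h2 := (h1.inner (𝕜 := ℂ) (tendsto_integral_localHeat (e := e₂) hχ₂ hη₂ hc₂
      (mul_eq_of_eq_one_on_tsupport hs₂ hχ₂V))).norm
    refine le_of_tendsto h2 ?_
    filter_upwards [Ioo_mem_nhdsGT ht] with ε hε using hsmear ε hε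
  -- The cutoff `χ` equals one on the support of `η₂`, so it drops out of the pairing and the free
  -- matrix element remains.
  have heq : inner ℂ (p t) (push e₂ η₂) =
      inner ℂ (push e η) (heatSemigroup A t (push e₂ η₂)) - c * (freePairing η η₂ t : ℂ) := by
    rw [hp, freeDiscrepancy, inner_sub_left, inner_heatSemigroup_left,
      inner_integral_left (integrable_smul_localHeat hχ hη.continuous hc ht)]
    congr 1
    rw [freePairing, ← integral_complex_ofReal, ← integral_const_mul]
    refine integral_congr_ae (Eventually.of_forall fun x => ?_)
    have hk : Continuous fun z => χ z * heatKernel t (z - x) :=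
      hχ.continuous.mul (contDiff_heatKernel (n := 0) t x).continuous
    simp only
    rw [inner_smul_left_eq_smul, localHeat, hinner _ _ hk hη₂.continuous, Complex.real_smul]
    have hz : ∀ z, χ z * heatKernel t (z - x) * η₂ z = heatKernel t (z - x) * η₂ z := by
      intro z
      have h1 : χ z * η₂ z = η₂ z := by
        by_cases hz : z ∈ tsupport η₂
        · have : z ∈ tsupport χ₂ := subset_tsupport _ (by
            rw [Function.mem_support, hχ₂V z (hs₂ hz)]; exact one_ne_zero)
          rw [(hone z this).eq_of_nhds, Pi.one_apply, one_mul]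
        · rw [image_eq_zero_of_notMem_tsupport hz, mul_zero]
      rw [mul_right_comm, h1, mul_comm]
    simp only [hz]
    rw [setIntegral_eq_integral_of_forall_compl_eq_zero]
    · push_cast
      ring
    · intro z hzQ
      have : z ∉ tsupport η₂ := fun h => hzQ (hQ₂ (subset_tsupport _ (by
        rw [Function.mem_support, hχ₂V z (hs₂ h)]; exact one_ne_zero)))
      rw [image_eq_zero_of_notMem_tsupport this, mul_zero]
  rw [← heq]
  refine hbound.trans_eq ?_
  rw [hβ]
  ring

end

section

variable {d N : ℕ} {U : Set (EuclideanSpace ℝ (Fin d))}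

theorem exists_contDiff_one_nhds {K U : Set (EuclideanSpace ℝ (Fin d))} (hK : IsCompact K)
    (hU : IsOpen U) (hKU : K ⊆ U) :
    ∃ (Q : Compacts (EuclideanSpace ℝ (Fin d))) (χ : EuclideanSpace ℝ (Fin d) → ℝ),
      (Q : Set (EuclideanSpace ℝ (Fin d))) ⊆ U ∧ K ⊆ Q ∧ ContDiff ℝ ∞ χ ∧ tsupport χ ⊆ Q ∧
      (∀ z ∈ K, χ =ᶠ[𝓝 z] 1) ∧ ∀ z, 0 ≤ χ z ∧ χ z ≤ 1 := by
  obtain ⟨L, hL, hKL, hLU⟩ := exists_compact_between hK hU hKU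
  obtain ⟨f, h1, h0, h01⟩ := exists_contMDiffMap_one_nhds_of_subset_interior (n := ⊤)
    (modelWithCornersSelf ℝ (EuclideanSpace ℝ (Fin d))) hK.isClosed hKL
  refine ⟨⟨L, hL⟩, f, hLU, hKL.trans interior_subset, f.contMDiff.contDiff, ?_, fun z hz => ?_, h01⟩
  · exact closure_minimal (fun z hz => by_contra fun hzL => hz (h0 z hzL)) hL.isClosed
  · exact eventually_nhdsSet_iff_forall.1 h1 z hz

/-- The matrix elements of the heat semigroup between functions concentrated near two points agree
with the free ones up to an error of the order of the heat kernel at the sum of the distances of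
the points to the boundary. -/
theorem exists_norm_inner_sub_freePairing_le (hU : IsOpen U) {A : L2 U N →ₗ.[ℂ] L2 U N}
    (hA : IsNonnegSelfAdjoint A) (hext : ExtendsLaplacian U A) {x₀ y₀ : EuclideanSpace ℝ (Fin d)}
    {a b ε r₁ r₂ : ℝ} (ha : 0 ≤ a) (hb : 0 ≤ b) (hε : 0 < ε) (har : a + 2 * ε < r₁)
    (hbr : b + 2 * ε < r₂)
    (hr₁ : Metric.closedBall x₀ r₁ ⊆ U) (hr₂ : Metric.closedBall y₀ r₂ ⊆ U)
    {η η₂ : EuclideanSpace ℝ (Fin d) → ℝ} (hη : ContDiff ℝ ∞ η) (hc : HasCompactSupport η)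
    (hs : tsupport η ⊆ Metric.ball x₀ ε) (hη₂ : ContDiff ℝ ∞ η₂) (hc₂ : HasCompactSupport η₂)
    (hs₂' : tsupport η₂ ⊆ Metric.ball y₀ ε) {v w : EuclideanSpace ℂ (Fin N)} {u₁ u₂ : L2 U N}
    (hu₁ : u₁ =ᵐ[volume.restrict U] (fun x => (η x : ℂ) • v))
    (hu₂ : u₂ =ᵐ[volume.restrict U] (fun x => (η₂ x : ℂ) • w)) :
    ∃ M, 0 ≤ M ∧ ∀ t, 0 < t →
      ‖inner ℂ u₁ (heatSemigroup A t u₂) - inner ℂ v w * (freePairing η η₂ t : ℂ)‖ ≤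
        M * (1 + t) * t * Real.exp (-(a + b) ^ 2 / (4 * t)) := by
  obtain ⟨χ₁, hχ₁, hχs₁, h01₁, hone₁, C₁, hC01, hC₁⟩ := exists_cutoff x₀ ha hε har
  obtain ⟨χ₂, hχ₂, hχs₂, h01₂, hone₂, C₂, hC02, hC₂⟩ := exists_cutoff y₀ hb hε hbr
  -- One compact set and one large cutoff serve both points. Being locally one on both balls, `χ` is
  -- locally one on the supports of `χ₁` and `χ₂`.
  obtain ⟨Q, χ, hQU, hKQ, hχ, hχs, hone, h01⟩ := exists_contDiff_one_nhds
    ((isCompact_closedBall x₀ r₁).union (isCompact_closedBall y₀ r₂)) hU (union_subset hr₁ hr₂)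
  have hs₁ : tsupport χ₁ ⊆ Q := hχs₁.trans (subset_union_left.trans hKQ)
  have hs₂ : tsupport χ₂ ⊆ Q := hχs₂.trans (subset_union_right.trans hKQ)
  obtain ⟨C', hC0', hC'⟩ := exists_heatKernel_le (d := d) ha (show a < a + ε by linarith)
  have hmem₁ : ∀ z, χ₁ z ≠ 0 → z ∈ Metric.closedBall x₀ r₁ := fun z hz =>
    hχs₁ (subset_tsupport _ hz)
  have hmem₂ : ∀ z, χ₂ z ≠ 0 → z ∈ Metric.closedBall y₀ r₂ := fun z hz =>
    hχs₂ (subset_tsupport _ hz)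
  have hball₁ : Metric.ball x₀ ε ⊆ Metric.ball x₀ (a + 2 * ε) :=
    Metric.ball_subset_ball (by linarith)
  have hball₂ : Metric.ball y₀ ε ⊆ Metric.ball y₀ (b + 2 * ε) :=
    Metric.ball_subset_ball (by linarith)
  -- The two cutoffs are both one within `a + 2ε` of `x₀`; farther out the distance to the pole is
  -- at least `a + ε`, and the margin `ε` absorbs the normalization of the kernel.
  have hdiff : ∀ τ, 0 < τ → ∀ x ∈ Metric.ball x₀ ε, ∀ z, |(χ z - χ₁ z) * heatKernel τ (z - x)| ≤
      C' * Real.exp (-a ^ 2 / (4 * τ)) := by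
    intro τ hτ x hx z
    by_cases hz : z ∈ Metric.ball x₀ (a + 2 * ε)
    · have h1 := hone₁ z hz
      have h2 : χ z = 1 := (hone z (Or.inl (hmem₁ z (by rw [h1]; exact one_ne_zero)))).eq_of_nhds
      rw [h1, h2, sub_self, zero_mul, abs_zero]
      positivity
    · have hd : a + ε ≤ ‖z - x‖ := by
        rw [Metric.mem_ball, dist_eq_norm] at hx hz
        have := norm_add_le (z - x) (x - x₀)
        rw [sub_add_sub_cancel] at this
        linarith
      have h0 : 0 ≤ heatKernel τ (z - x) := heatKernel_nonneg hτ.le _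
      rw [abs_mul, abs_of_nonneg h0]
      have h1 : |χ z - χ₁ z| ≤ 1 :=
        abs_le.2 ⟨by linarith [(h01 z).1, (h01₁ z).2], by linarith [(h01 z).2, (h01₁ z).1]⟩
      refine (mul_le_mul_of_nonneg_right (h1.trans ?_) h0).trans (hC' τ hτ (z - x) hd)
      have : 0 < 1 / τ := by positivity
      linarith
  have hVQ₁ : ∀ z ∈ Metric.ball x₀ ε, z ∈ Q := fun z hz =>
    hKQ (Or.inl (hmem₁ z (by rw [hone₁ z (hball₁ hz)]; exact one_ne_zero)))
  have hVQ₂ : ∀ z ∈ Metric.ball y₀ ε, z ∈ Q := fun z hz =>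
    hKQ (Or.inr (hmem₂ z (by rw [hone₂ z (hball₂ hz)]; exact one_ne_zero)))
  let e₁ := vectorEmbedding hQU hU.measurableSet v
  let e₂ := vectorEmbedding hQU hU.measurableSet w
  obtain ⟨D₁, hD01, hD₁⟩ := exists_norm_localDefect_le e₁ hχ₁ hC01 hC₁
  obtain ⟨D₂, hD02, hD₂⟩ := exists_norm_localDefect_le e₂ hχ₂ hC02 hC₂
  have hu₁' : u₁ = push e₁ η := Lp.ext (hu₁.trans
    (push_vectorEmbedding_ae_eq hQU hU.measurableSet v hη.continuous fun z hz =>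
      image_eq_zero_of_notMem_tsupport fun h => hz (hVQ₁ z (hs h))).symm)
  have hu₂' : u₂ = push e₂ η₂ := Lp.ext (hu₂.trans
    (push_vectorEmbedding_ae_eq hQU hU.measurableSet w hη₂.continuous fun z hz =>
      image_eq_zero_of_notMem_tsupport fun h => hz (hVQ₂ z (hs₂' h))).symm)
  rw [hu₁', hu₂']
  exact exists_norm_inner_heatSemigroup_sub_le hA
    (actsAsLaplacian_vectorEmbedding hext hQU hU.measurableSet v)
    (actsAsLaplacian_vectorEmbedding hext hQU hU.measurableSet w)
    (fun f g hf hg => inner_push_vectorEmbedding hQU hU.measurableSet v w hf hg)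
    hχ hχs hχ₁ hs₁ hχ₂ hs₂ (fun z hz => hone z (Or.inr (hχs₂ hz)))
    Metric.isOpen_ball hD01 hC0' hD02 hD₁ hdiff hD₂
    (fun z hz => (hone z (Or.inl (hmem₁ z (by
      rw [hone₁ z (hball₁ hz)]; exact one_ne_zero)))).eq_of_nhds)
    (fun z hz => hone₁ z (hball₁ hz)) (fun z hz => hone₂ z (hball₂ hz))
    (hη.of_le (by norm_cast)) hc hs (hη₂.of_le (by norm_cast)) hc₂ hs₂'

end
end

/-! ### Free waves through the Fourier transform -/

section

open Filter Topology FourierTransform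

section FreeWave

variable {d : ℕ} {η η₂ : EuclideanSpace ℝ (Fin d) → ℝ}

variable (η η₂) in
/-- The product of the Fourier transforms of two functions. -/
def fourierProduct (ξ : EuclideanSpace ℝ (Fin d)) : ℂ :=
  starRingEnd ℂ (𝓕 (fun x => (η x : ℂ)) ξ) * 𝓕 (fun x => (η₂ x : ℂ)) ξ

theorem exists_schwartzMap_ofReal (hη : ContDiff ℝ ∞ η) (hc : HasCompactSupport η) :
    ∃ f : SchwartzMap (EuclideanSpace ℝ (Fin d)) ℂ, ⇑f = fun x => (η x : ℂ) := by
  have hc' : HasCompactSupport fun x => (η x : ℂ) :=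
    hc.comp_left (g := fun r : ℝ => (r : ℂ)) Complex.ofReal_zero
  exact ⟨hc'.toSchwartzMap (Complex.ofRealCLM.contDiff.comp hη), rfl⟩

theorem integrable_fourier_ofReal (hη : ContDiff ℝ ∞ η) (hc : HasCompactSupport η) :
    Integrable (𝓕 fun x => (η x : ℂ)) ∧ Continuous (𝓕 fun x => (η x : ℂ)) := by
  obtain ⟨f, hf⟩ := exists_schwartzMap_ofReal hη hc
  rw [← hf, ← SchwartzMap.fourier_coe]
  exact ⟨SchwartzMap.integrable _, SchwartzMap.continuous _⟩

theorem norm_fourier_ofReal_le (η : EuclideanSpace ℝ (Fin d) → ℝ) (ξ : EuclideanSpace ℝ (Fin d)) :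
    ‖𝓕 (fun x => (η x : ℂ)) ξ‖ ≤ ∫ x, |η x| := by
  refine (VectorFourier.norm_fourierIntegral_le_integral_norm Real.fourierChar volume
    (innerₗ (EuclideanSpace ℝ (Fin d))) (fun x => (η x : ℂ)) ξ).trans_eq ?_
  simp only [Complex.norm_real, Real.norm_eq_abs]

theorem norm_fourierProduct_le (ξ : EuclideanSpace ℝ (Fin d)) :
    ‖fourierProduct η η₂ ξ‖ ≤ (∫ x, |η x|) * ∫ x, |η₂ x| := by
  rw [fourierProduct, norm_mul, RCLike.norm_conj]
  exact mul_le_mul (norm_fourier_ofReal_le η ξ) (norm_fourier_ofReal_le η₂ ξ) (norm_nonneg _)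
    (integral_nonneg fun _ => abs_nonneg _)

theorem continuous_fourierProduct (hη : ContDiff ℝ ∞ η) (hc : HasCompactSupport η)
    (hη₂ : ContDiff ℝ ∞ η₂) (hc₂ : HasCompactSupport η₂) : Continuous (fourierProduct η η₂) :=
  (Complex.continuous_conj.comp (integrable_fourier_ofReal hη hc).2).mul
    (integrable_fourier_ofReal hη₂ hc₂).2

theorem integrable_fourierProduct (hη : ContDiff ℝ ∞ η) (hc : HasCompactSupport η)
    (hη₂ : ContDiff ℝ ∞ η₂) (hc₂ : HasCompactSupport η₂) : Integrable (fourierProduct η η₂) := by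
  refine (integrable_fourier_ofReal hη₂ hc₂).1.bdd_mul (c := ∫ x, |η x|)
    (Complex.continuous_conj.comp (integrable_fourier_ofReal hη hc).2).aestronglyMeasurable
    (Eventually.of_forall fun ξ => ?_)
  simp only [RCLike.norm_conj]
  exact norm_fourier_ofReal_le η ξ

variable (η η₂) in
/-- The matrix element of the cosine of the square root of the free Laplacian. -/
def freeWave (s : ℝ) : ℂ :=
  ∫ ξ, (Real.cos (s * (2 * Real.pi * ‖ξ‖)) : ℂ) * fourierProduct η η₂ ξ

theorem freeWave_neg (s : ℝ) : freeWave η η₂ (-s) = freeWave η η₂ s := by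
  simp [freeWave]

theorem norm_cos_mul_le (r : ℝ) (z : ℂ) : ‖(Real.cos r : ℂ) * z‖ ≤ ‖z‖ := by
  rw [norm_mul, Complex.norm_real]
  exact mul_le_of_le_one_left (norm_nonneg _) (Real.abs_cos_le_one _)

theorem norm_freeWave_le (hη : ContDiff ℝ ∞ η) (hc : HasCompactSupport η)
    (hη₂ : ContDiff ℝ ∞ η₂) (hc₂ : HasCompactSupport η₂) (s : ℝ) :
    ‖freeWave η η₂ s‖ ≤ ∫ ξ, ‖fourierProduct η η₂ ξ‖ :=
  norm_integral_le_of_norm_le (integrable_fourierProduct hη hc hη₂ hc₂).norm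
    (Eventually.of_forall fun _ => norm_cos_mul_le _ _)

theorem continuous_freeWave (hη : ContDiff ℝ ∞ η) (hc : HasCompactSupport η)
    (hη₂ : ContDiff ℝ ∞ η₂) (hc₂ : HasCompactSupport η₂) : Continuous (freeWave η η₂) := by
  refine continuous_of_dominated (bound := fun ξ => ‖fourierProduct η η₂ ξ‖) (fun s => ?_)
    (fun s => Eventually.of_forall fun ξ => norm_cos_mul_le _ _)
    (integrable_fourierProduct hη hc hη₂ hc₂).norm (Eventually.of_forall fun ξ => by fun_prop)
  have := continuous_fourierProduct hη hc hη₂ hc₂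
  exact Continuous.aestronglyMeasurable (by fun_prop)

/-- Fubini's theorem, with the product of the weight and the Fourier product as dominating function.
The free counterpart of `integral_mul_inner_waveOp`. -/
theorem integral_mul_freeWave (hη : ContDiff ℝ ∞ η) (hc : HasCompactSupport η)
    (hη₂ : ContDiff ℝ ∞ η₂) (hc₂ : HasCompactSupport η₂) {q : ℝ → ℝ} (hq : Continuous q)
    (hqi : Integrable q) :
    ∫ s, (q s : ℂ) * freeWave η η₂ s =
      ∫ ξ, ((∫ s, q s * Real.cos (s * (2 * Real.pi * ‖ξ‖)) : ℝ) : ℂ) * fourierProduct η η₂ ξ := by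
  have h1 : ∀ s, (q s : ℂ) * freeWave η η₂ s =
      ∫ ξ, (q s : ℂ) * ((Real.cos (s * (2 * Real.pi * ‖ξ‖)) : ℂ) * fourierProduct η η₂ ξ) :=
    fun s => by rw [freeWave, integral_const_mul]
  have h2 : ∀ ξ, ((∫ s, q s * Real.cos (s * (2 * Real.pi * ‖ξ‖)) : ℝ) : ℂ) * fourierProduct η η₂ ξ =
      ∫ s, (q s : ℂ) * ((Real.cos (s * (2 * Real.pi * ‖ξ‖)) : ℂ) * fourierProduct η η₂ ξ) := by
    intro ξ
    rw [← integral_complex_ofReal, ← integral_mul_const]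
    refine integral_congr_ae (Eventually.of_forall fun s => ?_)
    simp only [Complex.ofReal_mul]
    ring
  simp_rw [h1, h2]
  refine integral_integral_swap ?_
  have hg := continuous_fourierProduct hη hc hη₂ hc₂
  refine (hqi.norm.mul_prod (integrable_fourierProduct hη hc hη₂ hc₂).norm).mono' ?_
    (Eventually.of_forall fun p => ?_)
  · unfold Function.uncurry
    exact Continuous.aestronglyMeasurable (by fun_prop)
  · simp only [Function.uncurry]
    rw [norm_mul, Complex.norm_real]
    exact mul_le_mul_of_nonneg_left (norm_cos_mul_le _ _) (norm_nonneg _)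

/-- The heat kernel in terms of Fourier transforms. -/
theorem integral_exp_mul_fourierProduct (hη : ContDiff ℝ ∞ η) (hc : HasCompactSupport η)
    (hη₂ : ContDiff ℝ ∞ η₂) (hc₂ : HasCompactSupport η₂) {t : ℝ} (ht : 0 < t) :
    ∫ ξ, (Real.exp (-t * (2 * Real.pi * ‖ξ‖) ^ 2) : ℂ) * fourierProduct η η₂ ξ =
      (freePairing η η₂ t : ℂ) := by
  have hηi : Integrable fun x => (η x : ℂ) :=
    (hη.continuous.integrable_of_hasCompactSupport hc).ofReal
  have hη₂i : Integrable fun x => (η₂ x : ℂ) :=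
    (hη₂.continuous.integrable_of_hasCompactSupport hc₂).ofReal
  set b : ℝ := 4 * Real.pi ^ 2 * t with hb
  have hb0 : 0 < b := by positivity
  have hb0' : 0 < (b : ℂ).re := by simpa using hb0
  -- A Gaussian times a character, whose Fourier transform is the heat kernel with pole `x`.
  set gs : EuclideanSpace ℝ (Fin d) → EuclideanSpace ℝ (Fin d) → ℂ := fun x ξ =>
    Complex.exp (-(b : ℂ) * (‖ξ‖ : ℂ) ^ 2 + 2 * Real.pi * Complex.I * (inner ℝ x ξ : ℝ)) with hgs
  have hgnorm : ∀ x ξ, ‖gs x ξ‖ ≤ 1 := by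
    intro x ξ
    rw [hgs, Complex.norm_exp]
    refine Real.exp_le_one_iff.2 ?_
    have : (-(b : ℂ) * (‖ξ‖ : ℂ) ^ 2 + 2 * Real.pi * Complex.I * (inner ℝ x ξ : ℝ)).re =
        -(b * ‖ξ‖ ^ 2) := by
      have h1 : -(b : ℂ) * (‖ξ‖ : ℂ) ^ 2 + 2 * Real.pi * Complex.I * (inner ℝ x ξ : ℝ) =
        ((-(b * ‖ξ‖ ^ 2) : ℝ) : ℂ) + ((2 * Real.pi * inner ℝ x ξ : ℝ) : ℂ) * Complex.I := by
        push_cast; ring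
      rw [h1, Complex.add_re, Complex.ofReal_re, Complex.re_ofReal_mul, Complex.I_re]
      ring
    rw [this]
    have : 0 ≤ b * ‖ξ‖ ^ 2 := by positivity
    linarith
  have hfour : ∀ x z, 𝓕 (gs x) z = (heatKernel t (z - x) : ℂ) := by
    intro x z
    rw [hgs, fourier_gaussian_innerProductSpace' hb0', heatKernel, finrank_euclideanSpace_fin]
    push_cast
    have h1 : ((Real.pi : ℂ) / b) ^ ((d : ℂ) / 2) = (((4 * Real.pi * t) ^ (-(d : ℝ) / 2) : ℝ) : ℂ) := by
      have h2 : (Real.pi / b) ^ ((d : ℝ) / 2) = (4 * Real.pi * t) ^ (-(d : ℝ) / 2) := by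
        rw [neg_div, Real.rpow_neg (by positivity), ← Real.inv_rpow (by positivity)]
        congr 1
        rw [hb]
        field_simp
      rw [← h2, Complex.ofReal_cpow (by positivity)]
      push_cast
      rfl
    rw [h1, norm_sub_rev x z]
    congr 2
    rw [hb]
    push_cast
    have : (Real.pi : ℂ) ≠ 0 := by exact_mod_cast Real.pi_ne_zero
    have : (t : ℂ) ≠ 0 := by exact_mod_cast ht.ne'
    field_simp
  have hconj : ∀ ξ, (Real.exp (-t * (2 * Real.pi * ‖ξ‖) ^ 2) : ℂ) * fourierProduct η η₂ ξ =
      ∫ x, (η x : ℂ) * (𝓕 (fun x => (η₂ x : ℂ)) ξ * gs x ξ) := by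
    intro ξ
    have h1 : starRingEnd ℂ (𝓕 (fun x => (η x : ℂ)) ξ) =
        ∫ x, Complex.exp (2 * Real.pi * Complex.I * (inner ℝ x ξ : ℝ)) * (η x : ℂ) := by
      rw [Real.fourier_eq', ← integral_conj]
      refine integral_congr_ae (Eventually.of_forall fun x => ?_)
      simp only [smul_eq_mul, map_mul, Complex.conj_ofReal, ← Complex.exp_conj, Complex.conj_I]
      congr 2
      push_cast
      ring
    rw [fourierProduct, h1, ← integral_mul_const, ← integral_const_mul]
    refine integral_congr_ae (Eventually.of_forall fun x => ?_)
    simp only [hgs]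
    rw [Complex.exp_add, show (Real.exp (-t * (2 * Real.pi * ‖ξ‖) ^ 2) : ℂ) =
      Complex.exp (-(b : ℂ) * (‖ξ‖ : ℂ) ^ 2) from by rw [hb]; push_cast; congr 1; ring]
    ring
  simp_rw [hconj]
  have hF := integrable_fourier_ofReal hη₂ hc₂
  rw [integral_integral_swap]
  · rw [freePairing, ← integral_complex_ofReal]
    refine integral_congr_ae (Eventually.of_forall fun x => ?_)
    simp only
    rw [integral_const_mul, Complex.ofReal_mul]
    congr 1
    have hgi : Integrable (gs x) := GaussianFourier.integrable_cexp_neg_mul_sq_norm_add hb0' _ x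
    -- The multiplication formula moves the Fourier transform from `η₂` to the Gaussian.
    have h := VectorFourier.integral_fourierIntegral_smul_eq_flip (e := Real.fourierChar)
      (L := innerₗ (EuclideanSpace ℝ (Fin d))) (μ := volume) (ν := volume)
      Real.continuous_fourierChar continuous_inner hη₂i hgi
    rw [flip_innerₗ] at h
    refine h.trans ?_
    rw [← integral_complex_ofReal]
    refine integral_congr_ae (Eventually.of_forall fun z => ?_)
    have := hfour x z
    simp only [smul_eq_mul, Complex.ofReal_mul]
    rw [← this, mul_comm]
    rfl
  · have hηc := hη.continuous
    have hFc := hF.2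
    refine (hF.1.norm.mul_prod hηi.norm).mono' ?_ (Eventually.of_forall fun p => ?_)
    · refine Continuous.aestronglyMeasurable ?_
      simp only [hgs]
      unfold Function.uncurry
      fun_prop
    · simp only [Function.uncurry]
      rw [norm_mul, norm_mul, mul_comm]
      exact mul_le_mul_of_nonneg_right (mul_le_of_le_one_right (norm_nonneg _) (hgnorm _ _))
        (norm_nonneg _)

theorem integral_exp_mul_freeWave (hη : ContDiff ℝ ∞ η) (hc : HasCompactSupport η)
    (hη₂ : ContDiff ℝ ∞ η₂) (hc₂ : HasCompactSupport η₂) {t : ℝ} (ht : 0 < t) :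
    ∫ s, (Real.exp (-s ^ 2 / (4 * t)) : ℂ) * freeWave η η₂ s =
      ((2 * √(Real.pi * t) : ℝ) : ℂ) * (freePairing η η₂ t : ℂ) := by
  rw [integral_mul_freeWave hη hc hη₂ hc₂ (by fun_prop) (integrable_exp_neg_sq_div ht),
    ← integral_exp_mul_fourierProduct hη hc hη₂ hc₂ ht, ← integral_const_mul]
  refine integral_congr_ae (Eventually.of_forall fun ξ => ?_)
  simp only
  rw [integral_exp_mul_cos ht, Complex.ofReal_mul (2 * √(Real.pi * t)), mul_assoc]

/-- The trace density of `(1 - Δ)^(-m)`. -/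
theorem integrable_one_add_sq_pow_inv {m : ℕ} (hm : (d : ℝ) / 2 < m) :
    Integrable (fun ξ : EuclideanSpace ℝ (Fin d) => ((1 + (2 * Real.pi * ‖ξ‖) ^ 2) ^ m)⁻¹) ∧
    ∫ ξ : EuclideanSpace ℝ (Fin d), ((1 + (2 * Real.pi * ‖ξ‖) ^ 2) ^ m)⁻¹ =
      Real.Gamma (m - (d : ℝ) / 2) / ((4 * Real.pi) ^ ((d : ℝ) / 2) * ((m - 1).factorial : ℝ)) := by
  have hm0 : (0 : ℝ) < m := lt_of_le_of_lt (by positivity) hm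
  have hm1 : 1 ≤ m := by exact_mod_cast hm0
  have hΓ : Real.Gamma m = ((m - 1).factorial : ℝ) := by
    have := Real.Gamma_nat_eq_factorial (m - 1)
    rwa [Nat.cast_sub hm1, Nat.cast_one, sub_add_cancel] at this
  have hΓ0 : 0 < Real.Gamma m := Real.Gamma_pos_of_pos hm0
  -- The power is written as a Gamma integral, `Γ(m) c^(-m) = ∫ t^(m-1) exp (-c t) dt`. Exchanging
  -- the integrals leaves a Gaussian in `ξ` and then a Gamma integral with exponent `m - d/2`,
  -- convergent because `m > d / 2`.
  set f : EuclideanSpace ℝ (Fin d) × ℝ → ℝ := fun p =>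
    p.2 ^ ((m : ℝ) - 1) * Real.exp (-((1 + (2 * Real.pi * ‖p.1‖) ^ 2) * p.2)) with hf
  have hcont : ContinuousOn f (univ ×ˢ Ioi 0) := by
    refine ContinuousOn.mul ?_ (by fun_prop)
    exact ContinuousOn.rpow_const continuousOn_snd fun p hp => Or.inl (ne_of_gt (mem_Ioi.1 hp.2))
  have hmeas : AEStronglyMeasurable f (volume.prod (volume.restrict (Ioi 0))) := by
    have := hcont.aestronglyMeasurable (μ := volume.prod volume)
      (MeasurableSet.univ.prod measurableSet_Ioi)
    rwa [← Measure.prod_restrict, Measure.restrict_univ] at this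
  have hsplit : ∀ (ξ : EuclideanSpace ℝ (Fin d)) t, f (ξ, t) =
      t ^ ((m : ℝ) - 1) * Real.exp (-t) * Real.exp (-(4 * Real.pi ^ 2 * t) * ‖ξ‖ ^ 2) := by
    intro ξ t
    rw [hf, mul_assoc, ← Real.exp_add]
    simp only
    congr 2
    ring
  have hgauss : ∀ t, 0 < t → Integrable (fun ξ : EuclideanSpace ℝ (Fin d) =>
      Real.exp (-(4 * Real.pi ^ 2 * t) * ‖ξ‖ ^ 2)) ∧
      ∫ ξ : EuclideanSpace ℝ (Fin d), Real.exp (-(4 * Real.pi ^ 2 * t) * ‖ξ‖ ^ 2) =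
        (4 * Real.pi) ^ (-(d : ℝ) / 2) * t ^ (-(d : ℝ) / 2) := by
    intro t ht
    have h := GaussianFourier.integral_rexp_neg_mul_sq_norm (V := EuclideanSpace ℝ (Fin d))
      (b := 4 * Real.pi ^ 2 * t) (by positivity)
    rw [finrank_euclideanSpace_fin] at h
    have h2 : (Real.pi / (4 * Real.pi ^ 2 * t)) ^ ((d : ℝ) / 2) =
        (4 * Real.pi) ^ (-(d : ℝ) / 2) * t ^ (-(d : ℝ) / 2) := by
      rw [← Real.mul_rpow (by positivity) ht.le, neg_div, Real.rpow_neg (by positivity),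
        ← Real.inv_rpow (by positivity)]
      congr 1
      field_simp
    rw [h2] at h
    refine ⟨?_, h⟩
    by_contra hn
    rw [integral_undef hn] at h
    have : 0 < (4 * Real.pi) ^ (-(d : ℝ) / 2) * t ^ (-(d : ℝ) / 2) := by positivity
    linarith
  have hinner : ∀ t ∈ Ioi (0 : ℝ), ∫ ξ, f (ξ, t) =
      (4 * Real.pi) ^ (-(d : ℝ) / 2) * (Real.exp (-t) * t ^ ((m : ℝ) - d / 2 - 1)) := by
    intro t ht
    have ht' : 0 < t := ht
    simp only [hsplit]
    rw [integral_const_mul, (hgauss t ht').2, show (m : ℝ) - d / 2 - 1 = ((m : ℝ) - 1) + -(d : ℝ) / 2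
      by ring, Real.rpow_add ht']
    ring
  have hintg : Integrable f (volume.prod (volume.restrict (Ioi 0))) := by
    rw [integrable_prod_iff' hmeas]
    refine ⟨(ae_restrict_iff' measurableSet_Ioi).2 (Eventually.of_forall fun t ht => ?_), ?_⟩
    · simp only [hsplit]
      exact (hgauss t ht).1.const_mul _
    · refine (((Real.GammaIntegral_convergent (s := m - d / 2) (by linarith)).const_mul
        ((4 * Real.pi) ^ (-(d : ℝ) / 2)))).congr ?_
      refine (ae_restrict_iff' measurableSet_Ioi).2 (Eventually.of_forall fun t ht => ?_)
      have ht' : 0 < t := ht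
      simp only
      rw [← hinner t ht]
      refine integral_congr_ae (Eventually.of_forall fun ξ => ?_)
      simp only
      rw [Real.norm_of_nonneg]
      simp only [hsplit]
      positivity
  have hξ : ∀ ξ : EuclideanSpace ℝ (Fin d), ∫ t in Ioi (0 : ℝ), f (ξ, t) =
      ((1 + (2 * Real.pi * ‖ξ‖) ^ 2) ^ m)⁻¹ * Real.Gamma m := by
    intro ξ
    simp only [hf]
    rw [Real.integral_rpow_mul_exp_neg_mul_Ioi hm0 (by positivity), one_div, Real.rpow_natCast, inv_pow]
  have hval := integral_integral_swap (f := fun ξ t => f (ξ, t)) hintg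
  have hintg' := hintg.integral_prod_left
  simp only [hξ] at hval hintg'
  constructor
  · have := hintg'.mul_const (Real.Gamma m)⁻¹
    simpa [mul_assoc, hΓ0.ne'] using this
  · rw [integral_mul_const, setIntegral_congr_fun measurableSet_Ioi hinner, integral_const_mul,
      ← Real.Gamma_eq_integral (by linarith), neg_div, Real.rpow_neg (by positivity)] at hval
    rw [← hΓ, eq_div_iff (by positivity)]
    have h4 : (0 : ℝ) < (4 * Real.pi) ^ ((d : ℝ) / 2) := by positivity
    rw [mul_left_comm, hval, mul_inv_cancel_left₀ h4.ne']

/-- On the Fourier side the weight is `(1 + ν²)^(-m)` times a cosine transform bounded by the `L¹`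
norm of `r`. Since the Fourier transforms of `η` and `η₂` are bounded by their `L¹` norms, only the
integral of the power remains. -/
theorem norm_integral_mul_freeWave_le (hη : ContDiff ℝ ∞ η) (hc : HasCompactSupport η)
    (hη₂ : ContDiff ℝ ∞ η₂) (hc₂ : HasCompactSupport η₂) {q r : ℝ → ℝ} (hq : Continuous q)
    (hqi : Integrable q) (hri : Integrable r) {m : ℕ} (hm : (d : ℝ) / 2 < m)
    (hqr : ∀ ν : ℝ, (1 + ν ^ 2) ^ m * ∫ s, q s * Real.cos (s * ν) = ∫ s, r s * Real.cos (s * ν)) :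
    ‖∫ s, (q s : ℂ) * freeWave η η₂ s‖ ≤ (∫ s, |r s|) * (((∫ x, |η x|) * ∫ x, |η₂ x|) *
      (Real.Gamma (m - (d : ℝ) / 2) /
        ((4 * Real.pi) ^ ((d : ℝ) / 2) * ((m - 1).factorial : ℝ)))) := by
  rw [integral_mul_freeWave hη hc hη₂ hc₂ hq hqi, ← (integrable_one_add_sq_pow_inv hm).2,
    ← integral_const_mul, ← integral_const_mul]
  refine norm_integral_le_of_norm_le
    (((integrable_one_add_sq_pow_inv hm).1.const_mul _).const_mul _) (Eventually.of_forall fun ξ => ?_)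
  set ν := 2 * Real.pi * ‖ξ‖ with hν
  have hpos : 0 < (1 + ν ^ 2) ^ m := by positivity
  have h1 : ∫ s, q s * Real.cos (s * ν) = ((1 + ν ^ 2) ^ m)⁻¹ * ∫ s, r s * Real.cos (s * ν) := by
    rw [← hqr, inv_mul_cancel_left₀ hpos.ne']
  have h2 : ‖∫ s, r s * Real.cos (s * ν)‖ ≤ ∫ s, |r s| := by
    refine norm_integral_le_of_norm_le hri.abs (Eventually.of_forall fun s => ?_)
    rw [norm_mul]
    exact mul_le_of_le_one_right (norm_nonneg _) (Real.abs_cos_le_one _)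
  rw [norm_mul, Complex.norm_real, h1, norm_mul, Real.norm_of_nonneg (inv_nonneg.2 hpos.le)]
  have h3 := norm_fourierProduct_le (η := η) (η₂ := η₂) ξ
  calc ((1 + ν ^ 2) ^ m)⁻¹ * ‖∫ s, r s * Real.cos (s * ν)‖ * ‖fourierProduct η η₂ ξ‖
      ≤ ((1 + ν ^ 2) ^ m)⁻¹ * (∫ s, |r s|) * ((∫ x, |η x|) * ∫ x, |η₂ x|) := by gcongr
    _ = _ := by ring

end FreeWave
end

/-! ### Finite propagation speed and the bound for matrix elements -/

section

open Filter Topology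

section FinitePropagation

variable {d N : ℕ} {U : Set (EuclideanSpace ℝ (Fin d))}

/-- The difference of the matrix elements of the wave operators of `A` and of the free Laplacian. -/
def waveDifference (A : L2 U N →ₗ.[ℂ] L2 U N) (u g : L2 U N) (c : ℂ)
    (η η₂ : EuclideanSpace ℝ (Fin d) → ℝ) (s : ℝ) : ℂ :=
  inner ℂ u (waveOp A s g) - c * freeWave η η₂ s

variable {A : L2 U N →ₗ.[ℂ] L2 U N} {u g : L2 U N} {c : ℂ} {η η₂ : EuclideanSpace ℝ (Fin d) → ℝ}

/-- Test functions lie in the domain of `A`, so `g = u - Δu` works. This supplies the factor `(1 +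
A)⁻¹` that the wave operators carry. -/
theorem exists_invOneAdd_eq (hA : IsNonnegSelfAdjoint A) (hext : ExtendsLaplacian U A)
    (hη : ContDiff ℝ ∞ η) (hc : HasCompactSupport η) (hs : tsupport η ⊆ U)
    {v : EuclideanSpace ℂ (Fin N)} (hu : u =ᵐ[volume.restrict U] fun x => (η x : ℂ) • v) :
    ∃ g, invOneAdd A g = u := by
  have hcont : Continuous fun x => -((Laplacian.laplacian η x : ℂ) • v) :=
    ((Complex.continuous_ofReal.comp (continuous_laplacian hη)).smul continuous_const).neg
  have hsupp : HasCompactSupport fun x => -((Laplacian.laplacian η x : ℂ) • v) := by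
    refine HasCompactSupport.of_support_subset_isCompact hc fun x hx => ?_
    by_contra h
    exact hx (by simp [laplacian_eq_zero_of_notMem_tsupport h])
  have hmem : MemLp (fun x => -((Laplacian.laplacian η x : ℂ) • v)) 2 (volume.restrict U) :=
    hcont.memLp_of_hasCompactSupport hsupp
  have hgr := hext _ (isTestFunction_smul hη hc hs v) u hmem.toLp hu (hmem.coeFn_toLp.trans
    (Eventually.of_forall fun x => by
      simp only
      rw [laplacian_ofReal_smul (hη.of_le (by norm_cast))]))
  exact ⟨_, mem_graph_iff_invOneAdd hA hgr⟩

theorem continuous_waveDifference (hA : IsNonnegSelfAdjoint A) (hη : ContDiff ℝ ∞ η)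
    (hc : HasCompactSupport η) (hη₂ : ContDiff ℝ ∞ η₂) (hc₂ : HasCompactSupport η₂) :
    Continuous (waveDifference A u g c η η₂) :=
  (continuous_const.inner ((continuous_waveOp hA).clm_apply continuous_const)).sub
    (continuous_const.mul (continuous_freeWave hη hc hη₂ hc₂))

theorem norm_inner_waveOp_le (hA : IsNonnegSelfAdjoint A) (u g : L2 U N) (s : ℝ) :
    ‖inner ℂ u (waveOp A s g)‖ ≤ ‖u‖ * ‖g‖ :=
  (norm_inner_le_norm _ _).trans (mul_le_mul_of_nonneg_left
    ((waveOp A s).le_of_opNorm_le_of_le (norm_waveOp_le hA s) le_rfl |>.trans_eq (one_mul _))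
    (norm_nonneg _))

theorem norm_waveDifference_le (hA : IsNonnegSelfAdjoint A) (hη : ContDiff ℝ ∞ η)
    (hc : HasCompactSupport η) (hη₂ : ContDiff ℝ ∞ η₂) (hc₂ : HasCompactSupport η₂) (s : ℝ) :
    ‖waveDifference A u g c η η₂ s‖ ≤ ‖u‖ * ‖g‖ + ‖c‖ * ∫ ξ, ‖fourierProduct η η₂ ξ‖ := by
  refine (norm_sub_le _ _).trans (add_le_add (norm_inner_waveOp_le hA u g s) ?_)
  rw [norm_mul]
  exact mul_le_mul_of_nonneg_left (norm_freeWave_le hη hc hη₂ hc₂ s) (norm_nonneg _)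

theorem integral_mul_waveDifference (hA : IsNonnegSelfAdjoint A) (hη : ContDiff ℝ ∞ η)
    (hc : HasCompactSupport η) (hη₂ : ContDiff ℝ ∞ η₂) (hc₂ : HasCompactSupport η₂) {q : ℝ → ℝ}
    (hqi : Integrable q) :
    ∫ s, (q s : ℂ) * waveDifference A u g c η η₂ s =
      (∫ s, (q s : ℂ) * inner ℂ u (waveOp A s g)) - c * ∫ s, (q s : ℂ) * freeWave η η₂ s := by
  have h1 : Integrable fun s => (q s : ℂ) * inner ℂ u (waveOp A s g) :=
    hqi.ofReal.mul_bdd (c := ‖u‖ * ‖g‖)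
      (continuous_const.inner ((continuous_waveOp hA).clm_apply continuous_const)).aestronglyMeasurable
      (Eventually.of_forall (norm_inner_waveOp_le hA u g))
  have h2 : Integrable fun s => (q s : ℂ) * freeWave η η₂ s :=
    hqi.ofReal.mul_bdd (c := ∫ ξ, ‖fourierProduct η η₂ ξ‖)
      (continuous_freeWave hη hc hη₂ hc₂).aestronglyMeasurable
      (Eventually.of_forall (norm_freeWave_le hη hc hη₂ hc₂))
  rw [← integral_const_mul, ← integral_sub h1 (h2.const_mul c)]
  refine integral_congr_ae (Eventually.of_forall fun s => ?_)
  simp only [waveDifference]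
  ring

theorem integral_exp_mul_waveDifference (hA : IsNonnegSelfAdjoint A) (hη : ContDiff ℝ ∞ η)
    (hc : HasCompactSupport η) (hη₂ : ContDiff ℝ ∞ η₂) (hc₂ : HasCompactSupport η₂) {t : ℝ}
    (ht : 0 < t) :
    ∫ s, (Real.exp (-s ^ 2 / (4 * t)) : ℂ) * waveDifference A u g c η η₂ s =
      ((2 * √(Real.pi * t) : ℝ) : ℂ) *
        (inner ℂ u (heatSemigroup A t (invOneAdd A g)) - c * (freePairing η η₂ t : ℂ)) := by
  rw [integral_mul_waveDifference hA hη hc hη₂ hc₂ (integrable_exp_neg_sq_div ht),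
    integral_exp_mul_inner_waveOp hA ht, integral_exp_mul_freeWave hη hc hη₂ hc₂ ht]
  ring

/-- Gaussian bounds for the heat semigroup imply finite propagation speed. -/
theorem waveDifference_eq_zero (hA : IsNonnegSelfAdjoint A) (hη : ContDiff ℝ ∞ η)
    (hc : HasCompactSupport η) (hη₂ : ContDiff ℝ ∞ η₂) (hc₂ : HasCompactSupport η₂) {M L : ℝ}
    (hM0 : 0 ≤ M)
    (hM : ∀ t, 0 < t → ‖inner ℂ u (heatSemigroup A t (invOneAdd A g)) - c * (freePairing η η₂ t : ℂ)‖ ≤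
      M * (1 + t) * t * Real.exp (-L ^ 2 / (4 * t))) {s : ℝ} (hs : |s| < L) :
    waveDifference A u g c η η₂ s = 0 := by
  refine eq_zero_of_gaussian_integral_le (C := 2 * √Real.pi * (M * 2))
    (continuous_waveDifference hA hη hc hη₂ hc₂)
    (norm_waveDifference_le hA hη hc hη₂ hc₂) (fun s => ?_) (fun p hp => ?_) hs
  · simp only [waveDifference, waveOp_neg, freeWave_neg]
  · have hp0 : 0 < p := by linarith
    -- With this time `exp (-p s²)` is the Gaussian `exp (-s² / (4 t))`. The condition `p ≥ 1` keeps
    -- `t ≤ 1`, so the prefactor `(1 + t) t` is bounded.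
    set t := 1 / (4 * p) with htdef
    have ht : 0 < t := by positivity
    have ht1 : t ≤ 1 := by
      rw [htdef, div_le_one (by positivity)]
      linarith
    have he : ∀ r : ℝ, -p * r ^ 2 = -r ^ 2 / (4 * t) := by
      intro r
      rw [htdef]
      field_simp
    simp only [he]
    rw [integral_exp_mul_waveDifference hA hη hc hη₂ hc₂ ht, norm_mul, Complex.norm_real,
      Real.norm_of_nonneg (by positivity)]
    have h1 : √(Real.pi * t) ≤ √Real.pi :=
      Real.sqrt_le_sqrt (mul_le_of_le_one_right Real.pi_pos.le ht1)
    have h2 : M * (1 + t) * t ≤ M * 2 := by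
      rw [mul_assoc]
      refine mul_le_mul_of_nonneg_left ?_ hM0
      nlinarith
    calc 2 * √(Real.pi * t) * ‖inner ℂ u (heatSemigroup A t (invOneAdd A g)) -
          c * (freePairing η η₂ t : ℂ)‖
        ≤ 2 * √Real.pi * (M * 2 * Real.exp (-L ^ 2 / (4 * t))) := by
          refine mul_le_mul (by linarith) ((hM t ht).trans ?_) (norm_nonneg _) (by positivity)
          exact mul_le_mul_of_nonneg_right h2 (Real.exp_nonneg _)
      _ = _ := by ring

/-- The bound for the matrix elements in terms of a cutoff function. -/
theorem norm_inner_sub_freePairing_le (hA : IsNonnegSelfAdjoint A) (hη : ContDiff ℝ ∞ η)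
    (hc : HasCompactSupport η) (hη₂ : ContDiff ℝ ∞ η₂) (hc₂ : HasCompactSupport η₂) {m : ℕ}
    (hm : (d : ℝ) / 2 < m) {θ : ℝ → ℝ} (hθ : ContDiff ℝ (2 * m : ℕ) θ)
    (hθc : HasCompactSupport fun s => 1 - θ s)
    (hzero : ∀ s, θ s ≠ 1 → waveDifference A u g c η η₂ s = 0) {t : ℝ} (ht : 0 < t) :
    ‖inner ℂ u (heatSemigroup A t (invOneAdd A g)) - c * (freePairing η η₂ t : ℂ)‖ ≤
      (∫ s, |oneSubDerivSq m (fun r => θ r * Real.exp (-r ^ 2 / (4 * t))) s|) /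
        (2 * √(Real.pi * t)) *
      (√(inner ℂ u ((invOneAdd A ^ m) u)).re *
        √(inner ℂ (invOneAdd A g) ((invOneAdd A ^ m) (invOneAdd A g))).re +
        ‖c‖ * (((∫ x, |η x|) * ∫ x, |η₂ x|) * (Real.Gamma (m - (d : ℝ) / 2) /
          ((4 * Real.pi) ^ ((d : ℝ) / 2) * ((m - 1).factorial : ℝ))))) := by
  have hm0 : 0 < m := by
    have : (0 : ℝ) < m := lt_of_le_of_lt (by positivity) hm
    exact_mod_cast this
  have hq := integrableDerivs_cutoff hθ hθc ht
  obtain ⟨hri, hqr⟩ := hq.oneSubDerivSq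
  have h1 := norm_integral_mul_inner_waveOp_le hA hq.continuous hq.integrable hri hm0 hqr u g
  have h2 := norm_integral_mul_freeWave_le hη hc hη₂ hc₂ hq.continuous hq.integrable hri hm hqr
  -- The cutoff may be inserted because the waves agree wherever it differs from one. Only after
  -- this step are the two terms of the difference estimated separately.
  have h3 : ∫ s, (Real.exp (-s ^ 2 / (4 * t)) : ℂ) * waveDifference A u g c η η₂ s =
      ∫ s, ((θ s * Real.exp (-s ^ 2 / (4 * t)) : ℝ) : ℂ) * waveDifference A u g c η η₂ s := by
    refine integral_congr_ae (Eventually.of_forall fun s => ?_)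
    by_cases hs : θ s = 1
    · simp only [hs, one_mul]
    · simp only [hzero s hs, mul_zero]
  rw [integral_exp_mul_waveDifference hA hη hc hη₂ hc₂ ht,
    integral_mul_waveDifference hA hη hc hη₂ hc₂ hq.integrable] at h3
  have h4 := congrArg norm h3
  rw [norm_mul, Complex.norm_real, Real.norm_of_nonneg (by positivity)] at h4
  have h5 := (norm_sub_le (∫ s, ((θ s * Real.exp (-s ^ 2 / (4 * t)) : ℝ) : ℂ) * inner ℂ u (waveOp A s g))
    (c * ∫ s, ((θ s * Real.exp (-s ^ 2 / (4 * t)) : ℝ) : ℂ) * freeWave η η₂ s)).trans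
    (add_le_add h1 ((norm_mul_le _ _).trans (mul_le_mul_of_nonneg_left h2 (norm_nonneg c))))
  rw [← h4] at h5
  have hpos : 0 < 2 * √(Real.pi * t) := by positivity
  rw [div_mul_eq_mul_div, le_div_iff₀ hpos, mul_comm]
  refine h5.trans_eq ?_
  ring

end FinitePropagation
end

/-! ### Recovering kernels from matrix elements between mollifiers -/

section

open Filter Topology

section Mollifiers

variable {d : ℕ}

/-- A smooth probability density supported in the closed ball of radius `δ` around `x`. -/
structure IsMollifier (x : EuclideanSpace ℝ (Fin d)) (δ : ℝ) (η : EuclideanSpace ℝ (Fin d) → ℝ) :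
    Prop where
  contDiff : ContDiff ℝ ∞ η
  nonneg : ∀ z, 0 ≤ η z
  integral_eq : ∫ z, η z = 1
  tsupport_subset : tsupport η ⊆ Metric.closedBall x δ

theorem exists_isMollifier (x : EuclideanSpace ℝ (Fin d)) :
    ∃ η : ℝ → EuclideanSpace ℝ (Fin d) → ℝ, ∀ δ, 0 < δ → IsMollifier x δ (η δ) := by
  have h : ∀ δ : ℝ, 0 < δ → ∃ η, IsMollifier x δ η := by
    intro δ hδ
    let f : ContDiffBump x := ⟨δ / 2, δ, half_pos hδ, half_lt_self hδ⟩
    exact ⟨f.normed volume, f.contDiff_normed, f.nonneg_normed, f.integral_normed,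
      f.tsupport_normed_eq.subset⟩
  choose! η hη using h
  exact ⟨η, hη⟩

namespace IsMollifier

variable {x y : EuclideanSpace ℝ (Fin d)} {δ : ℝ} {η η₂ : EuclideanSpace ℝ (Fin d) → ℝ}

theorem hasCompactSupport (h : IsMollifier x δ η) : HasCompactSupport η :=
  HasCompactSupport.of_support_subset_isCompact (isCompact_closedBall x δ)
    ((subset_tsupport η).trans h.tsupport_subset)

theorem eq_zero (h : IsMollifier x δ η) {z : EuclideanSpace ℝ (Fin d)}
    (hz : z ∉ Metric.closedBall x δ) : η z = 0 :=
  image_eq_zero_of_notMem_tsupport fun h' => hz (h.tsupport_subset h')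

theorem integral_abs (h : IsMollifier x δ η) : ∫ z, |η z| = 1 := by
  simp only [abs_of_nonneg (h.nonneg _), h.integral_eq]

theorem integrable (h : IsMollifier x δ η) : Integrable η :=
  h.contDiff.continuous.integrable_of_hasCompactSupport h.hasCompactSupport

theorem integrable_mul (h : IsMollifier x δ η) {g : EuclideanSpace ℝ (Fin d) → ℂ}
    (hg : ContinuousOn g (Metric.closedBall x δ)) : Integrable fun z => (η z : ℂ) * g z := by
  have h1 : IntegrableOn (fun z => (η z : ℂ) * g z) (Metric.closedBall x δ) :=
    ((Complex.continuous_ofReal.comp h.contDiff.continuous).continuousOn.mul hg).integrableOn_compact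
      (isCompact_closedBall x δ)
  rw [← integrable_indicator_iff measurableSet_closedBall] at h1
  refine h1.congr (Eventually.of_forall fun z => ?_)
  by_cases hz : z ∈ Metric.closedBall x δ
  · simp [hz]
  · simp [hz, h.eq_zero hz]

theorem norm_integral_mul_sub_le (h : IsMollifier x δ η) {g : EuclideanSpace ℝ (Fin d) → ℂ}
    (hg : ContinuousOn g (Metric.closedBall x δ)) {c : ℂ} {ε : ℝ}
    (hε : ∀ z ∈ Metric.closedBall x δ, ‖g z - c‖ ≤ ε) :
    ‖(∫ z, (η z : ℂ) * g z) - c‖ ≤ ε := by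
  have h1 : (∫ z, (η z : ℂ) * g z) - c = ∫ z, (η z : ℂ) * (g z - c) := by
    have h2 : ∫ z, (η z : ℂ) * c = c := by
      rw [integral_mul_const, integral_complex_ofReal, h.integral_eq, Complex.ofReal_one, one_mul]
    simp only [mul_sub]
    rw [integral_sub (h.integrable_mul hg) (h.integrable_mul continuousOn_const), h2]
  rw [h1]
  refine (norm_integral_le_of_norm_le (g := fun z => η z * ε) (h.integrable.mul_const ε)
    (Eventually.of_forall fun z => ?_)).trans_eq (by rw [integral_mul_const, h.integral_eq, one_mul])
  rw [norm_mul, Complex.norm_real, Real.norm_of_nonneg (h.nonneg z)]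
  by_cases hz : z ∈ Metric.closedBall x δ
  · exact mul_le_mul_of_nonneg_left (hε z hz) (h.nonneg z)
  · simp [h.eq_zero hz]

theorem norm_integral_integral_mul_sub_le (h : IsMollifier x δ η) (h₂ : IsMollifier y δ η₂)
    {F : EuclideanSpace ℝ (Fin d) → EuclideanSpace ℝ (Fin d) → ℂ}
    (hF : ContinuousOn (Function.uncurry F) (Metric.closedBall x δ ×ˢ Metric.closedBall y δ))
    {c : ℂ} {ε : ℝ}
    (hε : ∀ z ∈ Metric.closedBall x δ, ∀ z' ∈ Metric.closedBall y δ, ‖F z z' - c‖ ≤ ε) :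
    ‖(∫ z, (η z : ℂ) * ∫ z', (η₂ z' : ℂ) * F z z') - c‖ ≤ ε := by
  obtain ⟨C, hC⟩ := ((isCompact_closedBall x δ).prod
    (isCompact_closedBall y δ)).exists_bound_of_continuousOn hF
  refine h.norm_integral_mul_sub_le ?_ fun z hz =>
    h₂.norm_integral_mul_sub_le (ContinuousOn.uncurry_left z hz hF) (hε z hz)
  refine continuousOn_of_dominated (bound := fun z' => η₂ z' * C) (fun z hz => ?_) (fun z hz => ?_)
    (h₂.integrable.mul_const C) (Eventually.of_forall fun z' => ?_)
  · exact (h₂.integrable_mul (ContinuousOn.uncurry_left z hz hF)).aestronglyMeasurable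
  · refine Eventually.of_forall fun z' => ?_
    rw [norm_mul, Complex.norm_real, Real.norm_of_nonneg (h₂.nonneg z')]
    by_cases hz' : z' ∈ Metric.closedBall y δ
    · exact mul_le_mul_of_nonneg_left (hC (z, z') ⟨hz, hz'⟩) (h₂.nonneg z')
    · simp [h₂.eq_zero hz']
  · by_cases hz' : z' ∈ Metric.closedBall y δ
    · exact continuousOn_const.mul (ContinuousOn.uncurry_right z' hz' hF)
    · simp only [h₂.eq_zero hz', Complex.ofReal_zero, zero_mul]
      exact continuousOn_const

end IsMollifier

theorem tendsto_integral_integral_mollifier {U : Set (EuclideanSpace ℝ (Fin d))} (hU : IsOpen U)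
    {x y : EuclideanSpace ℝ (Fin d)} (hx : x ∈ U) (hy : y ∈ U)
    {η η₂ : ℝ → EuclideanSpace ℝ (Fin d) → ℝ} (hη : ∀ δ, 0 < δ → IsMollifier x δ (η δ))
    (hη₂ : ∀ δ, 0 < δ → IsMollifier y δ (η₂ δ))
    {F : EuclideanSpace ℝ (Fin d) → EuclideanSpace ℝ (Fin d) → ℂ}
    (hF : ContinuousOn (Function.uncurry F) (U ×ˢ U)) :
    Tendsto (fun δ => ∫ z, (η δ z : ℂ) * ∫ z', (η₂ δ z' : ℂ) * F z z') (𝓝[>] 0) (𝓝 (F x y)) := by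
  rw [Metric.tendsto_nhds]
  intro ε hε
  have hcont : ContinuousAt (Function.uncurry F) (x, y) :=
    hF.continuousAt ((hU.prod hU).mem_nhds ⟨hx, hy⟩)
  have h1 : ∀ᶠ p in 𝓝 (x, y), ‖Function.uncurry F p - F x y‖ ≤ ε / 2 := by
    filter_upwards [Metric.tendsto_nhds.1 hcont.tendsto (ε / 2) (half_pos hε)] with p hp
    rw [← dist_eq_norm]
    exact hp.le
  have h2 : {p : EuclideanSpace ℝ (Fin d) × EuclideanSpace ℝ (Fin d) |
      ‖Function.uncurry F p - F x y‖ ≤ ε / 2} ∩ U ×ˢ U ∈ 𝓝 (x, y) :=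
    inter_mem h1 ((hU.prod hU).mem_nhds ⟨hx, hy⟩)
  obtain ⟨r, hr, hball⟩ := Metric.nhds_basis_closedBall.mem_iff.1 h2
  filter_upwards [Ioo_mem_nhdsGT hr] with δ hδ
  have hsub : Metric.closedBall x δ ×ˢ Metric.closedBall y δ ⊆ Metric.closedBall (x, y) r := by
    rw [closedBall_prod_same]
    exact Metric.closedBall_subset_closedBall hδ.2.le
  rw [dist_eq_norm]
  have hc : ContinuousOn (Function.uncurry F) (Metric.closedBall x δ ×ˢ Metric.closedBall y δ) :=
    hF.mono fun p hp => (hball (hsub hp)).2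
  have hb : ∀ z ∈ Metric.closedBall x δ, ∀ z' ∈ Metric.closedBall y δ, ‖F z z' - F x y‖ ≤ ε / 2 :=
    fun z hz z' hz' => (hball (hsub (mk_mem_prod hz hz'))).1
  exact ((hη δ hδ.1).norm_integral_integral_mul_sub_le (hη₂ δ hδ.1) hc hb).trans_lt
    (half_lt_self hε)

theorem tendsto_freePairing {x y : EuclideanSpace ℝ (Fin d)}
    {η η₂ : ℝ → EuclideanSpace ℝ (Fin d) → ℝ} (hη : ∀ δ, 0 < δ → IsMollifier x δ (η δ))
    (hη₂ : ∀ δ, 0 < δ → IsMollifier y δ (η₂ δ)) {t : ℝ} (ht : 0 < t) :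
    Tendsto (fun δ => (freePairing (η δ) (η₂ δ) t : ℂ)) (𝓝[>] 0) (𝓝 (heatKernel t (x - y) : ℂ)) := by
  have hF : ContinuousOn (Function.uncurry fun z z' : EuclideanSpace ℝ (Fin d) =>
      (heatKernel t (z' - z) : ℂ)) (univ ×ˢ univ) := by
    refine Complex.continuous_ofReal.comp_continuousOn ?_
    exact continuousOn_heatKernel.comp
      (f := fun p : EuclideanSpace ℝ (Fin d) × EuclideanSpace ℝ (Fin d) => (t, p.2 - p.1))
      (by fun_prop) fun p _ => ⟨ht, mem_univ _⟩
  have h := tendsto_integral_integral_mollifier isOpen_univ (mem_univ x) (mem_univ y) hη hη₂ hF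
  rw [heatKernel_sub_comm]
  refine h.congr fun δ => ?_
  rw [freePairing, ← integral_complex_ofReal]
  refine integral_congr_ae (Eventually.of_forall fun z => ?_)
  simp only [Complex.ofReal_mul]
  rw [← integral_complex_ofReal]
  congr 1
  refine integral_congr_ae (Eventually.of_forall fun z' => ?_)
  simp only [Complex.ofReal_mul]
  ring

variable {N : ℕ} {U : Set (EuclideanSpace ℝ (Fin d))}

/-- An integral kernel is recovered from the matrix elements between mollifiers. -/
theorem IsIntegralKernel.tendsto_inner (hU : IsOpen U) {T : L2 U N →L[ℂ] L2 U N}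
    {k : EuclideanSpace ℝ (Fin d) → EuclideanSpace ℝ (Fin d) →
      (EuclideanSpace ℂ (Fin N) →L[ℂ] EuclideanSpace ℂ (Fin N))} (hk : IsIntegralKernel U T k)
    {x y : EuclideanSpace ℝ (Fin d)} (hx : x ∈ U) (hy : y ∈ U)
    {η η₂ : ℝ → EuclideanSpace ℝ (Fin d) → ℝ} (hη : ∀ δ, 0 < δ → IsMollifier x δ (η δ))
    (hη₂ : ∀ δ, 0 < δ → IsMollifier y δ (η₂ δ)) {v w : EuclideanSpace ℂ (Fin N)}
    {u u₂ : ℝ → L2 U N}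
    (hu : ∀ᶠ δ in 𝓝[>] 0, u δ =ᵐ[volume.restrict U] fun z => (η δ z : ℂ) • v)
    (hu₂ : ∀ᶠ δ in 𝓝[>] 0, u₂ δ =ᵐ[volume.restrict U] fun z => (η₂ δ z : ℂ) • w) :
    Tendsto (fun δ => inner ℂ (u δ) (T (u₂ δ))) (𝓝[>] 0) (𝓝 (inner ℂ v (k x y w))) := by
  have hF : ContinuousOn (Function.uncurry fun z z' : EuclideanSpace ℝ (Fin d) =>
      inner ℂ v (k z z' w)) (U ×ˢ U) :=
    continuousOn_const.inner (hk.1.clm_apply continuousOn_const)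
  refine (tendsto_integral_integral_mollifier hU hx hy hη hη₂ hF).congr' ?_
  obtain ⟨r, hr, hrU⟩ := Metric.nhds_basis_closedBall.mem_iff.1 (hU.mem_nhds hx)
  obtain ⟨r', hr', hrU'⟩ := Metric.nhds_basis_closedBall.mem_iff.1 (hU.mem_nhds hy)
  filter_upwards [hu, hu₂, Ioo_mem_nhdsGT hr, Ioo_mem_nhdsGT hr'] with δ h1 h2 hδ hδ'
  have hs := ((hη δ hδ.1).tsupport_subset.trans (Metric.closedBall_subset_closedBall hδ.2.le)).trans hrU
  have hs' := ((hη₂ δ hδ.1).tsupport_subset.trans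
    (Metric.closedBall_subset_closedBall hδ'.2.le)).trans hrU'
  rw [hk.2 _ _ (isTestFunction_smul (hη δ hδ.1).contDiff (hη δ hδ.1).hasCompactSupport hs v)
    (isTestFunction_smul (hη₂ δ hδ.1).contDiff (hη₂ δ hδ.1).hasCompactSupport hs' w) _ _ h1 h2]
  rw [setIntegral_eq_integral_of_forall_compl_eq_zero]
  · refine integral_congr_ae (Eventually.of_forall fun z => ?_)
    simp only
    rw [setIntegral_eq_integral_of_forall_compl_eq_zero, ← integral_const_mul]
    · refine integral_congr_ae (Eventually.of_forall fun z' => ?_)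
      simp only [map_smul, inner_smul_left, inner_smul_right, Complex.conj_ofReal]
      ring
    · intro z' hz'
      rw [image_eq_zero_of_notMem_tsupport fun h => hz' (hs' h)]
      simp
  · intro z hz
    rw [image_eq_zero_of_notMem_tsupport fun h => hz (hs h)]
    simp

end Mollifiers
end

/-! ### Distance to the boundary and the pointwise kernel bound -/

section

open Filter Topology

section BoundaryDistance

variable {d : ℕ} {U : Set (EuclideanSpace ℝ (Fin d))} {x : EuclideanSpace ℝ (Fin d)}

/-- A ball that misses the frontier is covered by `U` and the complement of its closure, two
disjoint open sets. It is connected and meets `U`, so it lies in `U`. -/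
theorem closedBall_subset_of_lt_boundaryDist (hU : IsOpen U) (hx : x ∈ U) {r : ℝ} (hr : 0 ≤ r)
    (h : ENNReal.ofReal r < boundaryDist U x) : Metric.closedBall x r ⊆ U := by
  have hdisj : ∀ z ∈ Metric.closedBall x r, z ∉ frontier U := by
    intro z hz hzf
    have h1 : boundaryDist U x ≤ ENNReal.ofReal r := by
      refine (Metric.infEDist_le_edist_of_mem hzf).trans ?_
      rw [edist_dist, dist_comm]
      exact ENNReal.ofReal_le_ofReal hz
    exact absurd h1 (not_le.2 h)
  refine IsPreconnected.subset_left_of_subset_union hU isClosed_closure.isOpen_compl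
    (disjoint_compl_right.mono_left subset_closure) ?_ ⟨x, Metric.mem_closedBall_self hr, hx⟩
    (convex_closedBall x r).isPreconnected
  intro z hz
  by_contra h'
  rw [mem_union, not_or, mem_compl_iff, not_not] at h'
  exact hdisj z hz (by rw [hU.frontier_eq]; exact ⟨h'.2, h'.1⟩)

theorem boundaryDist_pos (hU : IsOpen U) (hx : x ∈ U) : 0 < boundaryDist U x := by
  rw [boundaryDist, Metric.infEDist_pos_iff_notMem_closure, isClosed_frontier.closure_eq,
    hU.frontier_eq]
  exact fun h => h.2 hx

theorem eq_univ_of_boundaryDist_eq_top (hx : x ∈ U) (h : boundaryDist U x = ⊤) : U = univ := by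
  rw [boundaryDist, Metric.infEDist_eq_top_iff, frontier_eq_empty_iff] at h
  exact h.resolve_left (Set.nonempty_iff_ne_empty.1 ⟨x, hx⟩)

end BoundaryDistance

section KernelBound

variable {d N : ℕ} {U : Set (EuclideanSpace ℝ (Fin d))} {A : L2 U N →ₗ.[ℂ] L2 U N}

theorem inner_freeHeatKernel (t : ℝ) (x y : EuclideanSpace ℝ (Fin d))
    (v w : EuclideanSpace ℂ (Fin N)) :
    inner ℂ v (freeHeatKernel N t x y w) = inner ℂ v w * (heatKernel t (x - y) : ℂ) := by
  rw [freeHeatKernel, heatKernel]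
  change inner ℂ v ((_ : ℂ) • w) = _
  rw [inner_smul_right, mul_comm]

/-- A bound for the matrix elements between mollifiers implies one for the kernel. -/
theorem norm_sub_freeHeatKernel_le (hU : IsOpen U) {m : ℕ} {t : ℝ} (ht : 0 < t)
    {K G : EuclideanSpace ℝ (Fin d) → EuclideanSpace ℝ (Fin d) →
      (EuclideanSpace ℂ (Fin N) →L[ℂ] EuclideanSpace ℂ (Fin N))}
    (hK : IsIntegralKernel U (heatSemigroup A t) K) (hG : IsIntegralKernel U (invOneAdd A ^ m) G)
    {x y : EuclideanSpace ℝ (Fin d)} (hx : x ∈ U) (hy : y ∈ U) {D c₀ : ℝ} (hD0 : 0 ≤ D)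
    (hc₀ : 0 ≤ c₀)
    (hD : ∀ᶠ δ in 𝓝[>] (0 : ℝ), ∀ η η₂, IsMollifier x δ η → IsMollifier y δ η₂ →
      ∀ (v w : EuclideanSpace ℂ (Fin N)) (u u₂ : L2 U N),
      u =ᵐ[volume.restrict U] (fun z => (η z : ℂ) • v) →
      u₂ =ᵐ[volume.restrict U] (fun z => (η₂ z : ℂ) • w) →
      ‖inner ℂ u (heatSemigroup A t u₂) - inner ℂ v w * (freePairing η η₂ t : ℂ)‖ ≤
        D * (√(inner ℂ u ((invOneAdd A ^ m) u)).re * √(inner ℂ u₂ ((invOneAdd A ^ m) u₂)).re +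
          ‖(inner ℂ v w : ℂ)‖ * c₀)) :
    ‖K x y - freeHeatKernel N t x y‖ ≤ D * ((‖G x x‖ * ‖G y y‖) ^ (1 / 2 : ℝ) + c₀) := by
  obtain ⟨η, hη⟩ := exists_isMollifier x
  obtain ⟨η₂, hη₂⟩ := exists_isMollifier y
  have hex : ∀ {x : EuclideanSpace ℝ (Fin d)} {η : ℝ → EuclideanSpace ℝ (Fin d) → ℝ},
      (∀ δ, 0 < δ → IsMollifier x δ (η δ)) → ∀ v : EuclideanSpace ℂ (Fin N),
      ∃ u : ℝ → L2 U N, ∀ᶠ δ in 𝓝[>] 0, u δ =ᵐ[volume.restrict U] fun z => (η δ z : ℂ) • v := by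
    intro x η hη v
    have h : ∀ δ : ℝ, 0 < δ → ∃ u : L2 U N, u =ᵐ[volume.restrict U] fun z => (η δ z : ℂ) • v := by
      intro δ hδ
      have hT := isTestFunction_smul (hη δ hδ).contDiff (hη δ hδ).hasCompactSupport
        (subset_univ _) v
      have hmem : MemLp (fun z => (η δ z : ℂ) • v) 2 (volume.restrict U) :=
        hT.1.continuous.memLp_of_hasCompactSupport hT.2.1
      exact ⟨hmem.toLp, hmem.coeFn_toLp⟩
    choose! u hu using h
    exact ⟨u, by filter_upwards [self_mem_nhdsWithin] with δ hδ using hu δ hδ⟩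
  have hinner : ∀ v w : EuclideanSpace ℂ (Fin N),
      ‖inner ℂ v ((K x y - freeHeatKernel N t x y) w)‖ ≤
        D * ((‖G x x‖ * ‖G y y‖) ^ (1 / 2 : ℝ) + c₀) * (‖v‖ * ‖w‖) := by
    intro v w
    obtain ⟨u, hu⟩ := hex hη v
    obtain ⟨u₂, hu₂⟩ := hex hη₂ w
    have h1 := hK.tendsto_inner hU hx hy hη hη₂ hu hu₂
    have h2 := hG.tendsto_inner hU hx hx hη hη hu hu
    have h3 := hG.tendsto_inner hU hy hy hη₂ hη₂ hu₂ hu₂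
    have h4 := (tendsto_freePairing hη hη₂ ht).const_mul (inner ℂ v w)
    have hs : ∀ {f : ℝ → ℂ} {a : ℂ}, Tendsto f (𝓝[>] 0) (𝓝 a) →
        Tendsto (fun δ => √(f δ).re) (𝓝[>] 0) (𝓝 √a.re) := fun h =>
      (Real.continuous_sqrt.tendsto _).comp ((Complex.continuous_re.tendsto _).comp h)
    have hle := le_of_tendsto_of_tendsto (h1.sub h4).norm
      ((((hs h2).mul (hs h3)).add_const (‖(inner ℂ v w : ℂ)‖ * c₀)).const_mul D) (by
        filter_upwards [hD, hu, hu₂, self_mem_nhdsWithin] with δ hδ h1 h2 h0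
        exact hδ _ _ (hη δ h0) (hη₂ δ h0) v w _ _ h1 h2)
    rw [_root_.sub_apply, inner_sub_right, inner_freeHeatKernel]
    refine hle.trans ?_
    rw [mul_assoc]
    refine mul_le_mul_of_nonneg_left ?_ hD0
    have hq : ∀ (T : EuclideanSpace ℂ (Fin N) →L[ℂ] EuclideanSpace ℂ (Fin N))
        (v : EuclideanSpace ℂ (Fin N)), √(inner ℂ v (T v)).re ≤ √‖T‖ * ‖v‖ := by
      intro T v
      have hv : √‖T‖ * ‖v‖ = √(‖T‖ * ‖v‖ ^ 2) := by
        rw [Real.sqrt_mul (norm_nonneg T), Real.sqrt_sq (norm_nonneg v)]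
      rw [hv]
      refine Real.sqrt_le_sqrt ((Complex.re_le_norm _).trans ((norm_inner_le_norm _ _).trans ?_))
      have := mul_le_mul_of_nonneg_left (T.le_opNorm v) (norm_nonneg v)
      refine this.trans_eq (by ring)
    calc √(inner ℂ v (G x x v)).re * √(inner ℂ w (G y y w)).re + ‖(inner ℂ v w : ℂ)‖ * c₀
        ≤ (√‖G x x‖ * ‖v‖) * (√‖G y y‖ * ‖w‖) + (‖v‖ * ‖w‖) * c₀ :=
          add_le_add (mul_le_mul (hq _ _) (hq _ _) (Real.sqrt_nonneg _) (by positivity))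
            (mul_le_mul_of_nonneg_right (norm_inner_le_norm _ _) hc₀)
      _ = ((‖G x x‖ * ‖G y y‖) ^ (1 / 2 : ℝ) + c₀) * (‖v‖ * ‖w‖) := by
          rw [← Real.sqrt_eq_rpow, Real.sqrt_mul (norm_nonneg _)]
          ring
  have hC0 : 0 ≤ D * ((‖G x x‖ * ‖G y y‖) ^ (1 / 2 : ℝ) + c₀) := by positivity
  refine ContinuousLinearMap.opNorm_le_bound _ hC0 fun w => ?_
  -- Choosing the left vector to be the image of `w` turns the bound on matrix elements into a bound
  -- on the operator norm.
  have h := hinner ((K x y - freeHeatKernel N t x y) w) w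
  rw [inner_self_eq_norm_sq_to_K, norm_pow, RCLike.norm_ofReal, abs_norm] at h
  rcases (norm_nonneg ((K x y - freeHeatKernel N t x y) w)).eq_or_lt with h0 | h0
  · rw [← h0]
    positivity
  · refine le_of_mul_le_mul_left ?_ h0
    rw [← pow_two]
    exact h.trans_eq (by ring)

/-- The bound for a single cutoff function, when the boundary distances are finite. -/
theorem norm_sub_freeHeatKernel_le_of_mem_cutoffs (hU : IsOpen U) (hA : IsNonnegSelfAdjoint A)
    (hext : ExtendsLaplacian U A) {m : ℕ} (hm : (d : ℝ) / 2 < m) {t : ℝ} (ht : 0 < t)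
    {K G : EuclideanSpace ℝ (Fin d) → EuclideanSpace ℝ (Fin d) →
      (EuclideanSpace ℂ (Fin N) →L[ℂ] EuclideanSpace ℂ (Fin N))}
    (hK : IsIntegralKernel U (heatSemigroup A t) K) (hG : IsIntegralKernel U (invOneAdd A ^ m) G)
    {x y : EuclideanSpace ℝ (Fin d)} (hx : x ∈ U) (hy : y ∈ U)
    (hR : boundaryDist U x + boundaryDist U y ≠ ⊤) {θ : ℝ → ℝ}
    (hθ : θ ∈ cutoffs m (boundaryDist U x + boundaryDist U y)) :
    HasCompactSupport (fun s => 1 - θ s) ∧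
    ‖K x y - freeHeatKernel N t x y‖ ≤
      (∫ s, |oneSubDerivSq m (fun r => θ r * Real.exp (-r ^ 2 / (4 * t))) s|) /
        (2 * √(Real.pi * t)) * ((‖G x x‖ * ‖G y y‖) ^ (1 / 2 : ℝ) +
          Real.Gamma (m - (d : ℝ) / 2) /
            ((4 * Real.pi) ^ ((d : ℝ) / 2) * ((m - 1).factorial : ℝ))) := by
  obtain ⟨hpt, hqt⟩ := ENNReal.add_ne_top.1 hR
  set p := (boundaryDist U x).toReal with hp
  set q := (boundaryDist U y).toReal with hq
  have hp0 : 0 < p := ENNReal.toReal_pos (boundaryDist_pos hU hx).ne' hpt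
  have hq0 : 0 < q := ENNReal.toReal_pos (boundaryDist_pos hU hy).ne' hqt
  have hlt : ∀ s ∈ tsupport (fun s => 1 - θ s), |s| < p + q := by
    intro s hs
    have h := hθ.2 hs
    rw [mem_ofPred_eq, ENNReal.ofReal_lt_iff_lt_toReal (abs_nonneg s) hR,
      ENNReal.toReal_add hpt hqt] at h
    exact h
  have hcomp : IsCompact (tsupport fun s => 1 - θ s) := by
    refine Metric.isCompact_of_isClosed_isBounded (isClosed_tsupport _)
      ((Metric.isBounded_closedBall (x := (0 : ℝ)) (r := p + q)).subset fun s hs => ?_)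
    rw [mem_closedBall_zero_iff, Real.norm_eq_abs]
    exact (hlt s hs).le
  refine ⟨hcomp, ?_⟩
  -- Compactness of the support leaves a positive gap below `p + q`. The gap is needed because
  -- propagation is controlled only for radii strictly smaller than the boundary distances.
  obtain ⟨s₀, hs₀0, hs₀, hmax⟩ : ∃ s₀, 0 ≤ s₀ ∧ s₀ < p + q ∧
      ∀ s ∈ tsupport (fun s => 1 - θ s), |s| ≤ s₀ := by
    rcases (tsupport fun s => 1 - θ s).eq_empty_or_nonempty with h | h
    · exact ⟨0, le_rfl, by positivity, fun s hs => by rw [h] at hs; exact absurd hs (notMem_empty s)⟩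
    · obtain ⟨s, hs, hmax⟩ := hcomp.exists_isMaxOn h continuous_abs.continuousOn
      exact ⟨|s|, abs_nonneg s, hlt s hs, fun s' hs' => hmax hs'⟩
  -- Both distances are scaled by the same factor, so that `a + b` is the midpoint of `s₀` and `p +
  -- q`.
  obtain ⟨a, b, ha, hb, hap, hbq, hab⟩ : ∃ a b, 0 ≤ a ∧ 0 ≤ b ∧ a < p ∧ b < q ∧ s₀ < a + b := by
    have hl : (s₀ + (p + q)) / (2 * (p + q)) < 1 := by
      rw [div_lt_one (by positivity)]
      linarith
    refine ⟨(s₀ + (p + q)) / (2 * (p + q)) * p, (s₀ + (p + q)) / (2 * (p + q)) * q, by positivity,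
      by positivity, mul_lt_of_lt_one_left hp0 hl, mul_lt_of_lt_one_left hq0 hl, ?_⟩
    rw [← mul_add, div_mul_eq_mul_div, lt_div_iff₀ (by positivity)]
    nlinarith
  -- Small enough for the balls of radii `a + 4ε` and `b + 4ε` to stay inside `U`, with room for
  -- cutoffs that are one up to `a + 2ε` and `b + 2ε`.
  set ε := min (p - a) (q - b) / 8 with hε
  have hmin : 0 < min (p - a) (q - b) := lt_min (by linarith) (by linarith)
  have hε0 : 0 < ε := by positivity
  have hε1 : 8 * ε ≤ p - a := by rw [hε, mul_div_cancel₀ _ (by norm_num)]; exact min_le_left _ _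
  have hε2 : 8 * ε ≤ q - b := by rw [hε, mul_div_cancel₀ _ (by norm_num)]; exact min_le_right _ _
  have hball₁ : Metric.closedBall x (a + 4 * ε) ⊆ U :=
    closedBall_subset_of_lt_boundaryDist hU hx (by positivity)
      ((ENNReal.ofReal_lt_iff_lt_toReal (by positivity) hpt).2 (by linarith))
  have hball₂ : Metric.closedBall y (b + 4 * ε) ⊆ U :=
    closedBall_subset_of_lt_boundaryDist hU hy (by positivity)
      ((ENNReal.ofReal_lt_iff_lt_toReal (by positivity) hqt).2 (by linarith))
  have hΓ : 0 < Real.Gamma (m - (d : ℝ) / 2) := Real.Gamma_pos_of_pos (by linarith)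
  refine norm_sub_freeHeatKernel_le hU ht hK hG hx hy
    (div_nonneg (integral_nonneg fun _ => abs_nonneg _) (by positivity)) (by positivity) ?_
  filter_upwards [Ioo_mem_nhdsGT hε0] with δ hδ η η₂ hη hη₂ v w u u₂ hu hu₂
  have hs : tsupport η ⊆ Metric.ball x ε :=
    hη.tsupport_subset.trans (Metric.closedBall_subset_ball hδ.2)
  have hs₂ : tsupport η₂ ⊆ Metric.ball y ε :=
    hη₂.tsupport_subset.trans (Metric.closedBall_subset_ball hδ.2)
  have hs₂U : tsupport η₂ ⊆ U := hs₂.trans ((Metric.ball_subset_closedBall.trans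
    (Metric.closedBall_subset_closedBall (by linarith))).trans hball₂)
  obtain ⟨M, hM0, hM⟩ := exists_norm_inner_sub_freePairing_le hU hA hext ha hb hε0
    (show a + 2 * ε < a + 4 * ε by linarith) (show b + 2 * ε < b + 4 * ε by linarith) hball₁ hball₂
    hη.contDiff hη.hasCompactSupport hs hη₂.contDiff hη₂.hasCompactSupport hs₂ hu hu₂
  obtain ⟨g, hg⟩ := exists_invOneAdd_eq hA hext hη₂.contDiff hη₂.hasCompactSupport hs₂U hu₂
  rw [← hg] at hM ⊢
  have h := norm_inner_sub_freePairing_le hA hη.contDiff hη.hasCompactSupport hη₂.contDiff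
    hη₂.hasCompactSupport hm hθ.1 hcomp (fun s hs => waveDifference_eq_zero hA hη.contDiff
      hη.hasCompactSupport hη₂.contDiff hη₂.hasCompactSupport hM0 hM
      ((hmax s (subset_tsupport _ (by rw [Function.mem_support]; exact sub_ne_zero.2 hs.symm))).trans_lt
        hab)) ht
  rwa [hη.integral_abs, hη₂.integral_abs, one_mul, one_mul] at h

/-- There is no boundary correction on the whole space. -/
theorem eq_freeHeatKernel_of_boundaryDist_eq_top (hU : IsOpen U) (hA : IsNonnegSelfAdjoint A)
    (hext : ExtendsLaplacian U A) {m : ℕ} {t : ℝ} (ht : 0 < t)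
    {K G : EuclideanSpace ℝ (Fin d) → EuclideanSpace ℝ (Fin d) →
      (EuclideanSpace ℂ (Fin N) →L[ℂ] EuclideanSpace ℂ (Fin N))}
    (hK : IsIntegralKernel U (heatSemigroup A t) K) (hG : IsIntegralKernel U (invOneAdd A ^ m) G)
    {x y : EuclideanSpace ℝ (Fin d)} (hx : x ∈ U) (hy : y ∈ U)
    (hR : boundaryDist U x + boundaryDist U y = ⊤) :
    ‖K x y - freeHeatKernel N t x y‖ = 0 := by
  have hUu : U = univ := by
    rcases ENNReal.add_eq_top.1 hR with h | h
    · exact eq_univ_of_boundaryDist_eq_top hx h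
    · exact eq_univ_of_boundaryDist_eq_top hy h
  have hsub : ∀ s : Set (EuclideanSpace ℝ (Fin d)), s ⊆ U := fun s => hUu ▸ subset_univ s
  refine le_antisymm ?_ (norm_nonneg _)
  -- Both constants are taken to be `0`: on the whole space the matrix elements agree exactly.
  refine (norm_sub_freeHeatKernel_le hU ht hK hG hx hy le_rfl le_rfl ?_).trans_eq (zero_mul _)
  filter_upwards [self_mem_nhdsWithin] with δ hδ η η₂ hη hη₂ v w u u₂ hu hu₂
  have hδ0 : 0 < δ := hδ
  obtain ⟨g, hg⟩ := exists_invOneAdd_eq hA hext hη₂.contDiff hη₂.hasCompactSupport (hsub _) hu₂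
  have hball : ∀ z : EuclideanSpace ℝ (Fin d), Metric.closedBall z δ ⊆ Metric.ball z (2 * δ) :=
    fun z => Metric.closedBall_subset_ball (by linarith)
  -- There is no boundary, so the radius around `x` may be chosen larger than any prescribed `|s|`,
  -- and the waves agree at all times.
  have hW : ∀ s, waveDifference A u g (inner ℂ v w) η η₂ s = 0 := by
    intro s
    obtain ⟨M, hM0, hM⟩ := exists_norm_inner_sub_freePairing_le hU hA hext
      (a := |s| + 1) (b := 0) (ε := 2 * δ) (by positivity) le_rfl (by positivity)
      (show |s| + 1 + 2 * (2 * δ) < |s| + 1 + 5 * δ by linarith)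
      (show 0 + 2 * (2 * δ) < 5 * δ by linarith) (hsub _) (hsub _)
      hη.contDiff hη.hasCompactSupport (hη.tsupport_subset.trans (hball x))
      hη₂.contDiff hη₂.hasCompactSupport (hη₂.tsupport_subset.trans (hball y)) hu hu₂
    rw [← hg] at hM
    exact waveDifference_eq_zero hA hη.contDiff hη.hasCompactSupport hη₂.contDiff
      hη₂.hasCompactSupport hM0 hM (by linarith)
  have h := integral_exp_mul_waveDifference (u := u) (g := g) (c := inner ℂ v w) hA hη.contDiff
    hη.hasCompactSupport hη₂.contDiff hη₂.hasCompactSupport ht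
  simp only [hW, mul_zero, integral_zero] at h
  have hne : ((2 * √(Real.pi * t) : ℝ) : ℂ) ≠ 0 := by
    have : 0 < 2 * √(Real.pi * t) := by positivity
    exact_mod_cast this.ne'
  rw [← hg, (mul_eq_zero.1 h.symm).resolve_left hne, norm_zero, zero_mul]

end KernelBound
end

end NotFeeling

end

/-! ### The infimum over all cutoff functions -/

theorem theorem2p1 (d N m : ℕ) (hd : 2 ≤ d) (hN : 0 < N) (hm : (d : ℝ) / 2 < m)
    (U : Set (EuclideanSpace ℝ (Fin d))) (hU : IsOpen U)
    (A : NotFeeling.L2 U N →ₗ.[ℂ] NotFeeling.L2 U N)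
    (hA : NotFeeling.IsNonnegSelfAdjoint A) (hext : NotFeeling.ExtendsLaplacian U A)
    (t : ℝ) (ht : 0 < t) :
    (∃ K, NotFeeling.IsIntegralKernel U (NotFeeling.heatSemigroup A t) K) ∧
    (∃ G, NotFeeling.IsIntegralKernel U (NotFeeling.invOneAdd A ^ m) G) ∧
    ∀ K G, NotFeeling.IsIntegralKernel U (NotFeeling.heatSemigroup A t) K →
      NotFeeling.IsIntegralKernel U (NotFeeling.invOneAdd A ^ m) G →
      ∀ x ∈ U, ∀ y ∈ U,
        ‖K x y - NotFeeling.freeHeatKernel N t x y‖ ≤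
          ((‖G x x‖ * ‖G y y‖) ^ (1 / 2 : ℝ) +
              Real.Gamma (m - (d : ℝ) / 2) /
                ((4 * Real.pi) ^ ((d : ℝ) / 2) * ((m - 1).factorial : ℝ))) *
            (NotFeeling.J m (NotFeeling.boundaryDist U x + NotFeeling.boundaryDist U y) t /
              (2 * Real.sqrt (Real.pi * t))) := by
  refine ⟨NotFeeling.exists_isIntegralKernel_heatSemigroup hU hA hext ht,
    NotFeeling.exists_isIntegralKernel_invOneAdd_pow hU hA hext hm, ?_⟩
  intro K G hK hG x hx y hy
  set R := NotFeeling.boundaryDist U x + NotFeeling.boundaryDist U y with hR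
  have hΓ : 0 < Real.Gamma (m - (d : ℝ) / 2) := Real.Gamma_pos_of_pos (by linarith)
  set c := (‖G x x‖ * ‖G y y‖) ^ (1 / 2 : ℝ) + Real.Gamma (m - (d : ℝ) / 2) /
    ((4 * Real.pi) ^ ((d : ℝ) / 2) * ((m - 1).factorial : ℝ)) with hc
  have hc0 : 0 < c := by positivity
  have hs0 : 0 < 2 * Real.sqrt (Real.pi * t) := by positivity
  -- For `R = ∞` the support of `1 - ψ` need not be compact, so the bound for a single cutoff
  -- function is not available. The left side is then zero and the right side nonnegative.
  rcases eq_or_ne R ⊤ with hRtop | hRtop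
  · rw [NotFeeling.eq_freeHeatKernel_of_boundaryDist_eq_top hU hA hext ht hK hG hx hy hRtop]
    exact mul_nonneg hc0.le (div_nonneg ENNReal.toReal_nonneg hs0.le)
  have hnorm : ∀ θ : ℝ → ℝ, ContDiff ℝ (2 * m : ℕ) θ → HasCompactSupport (fun s => 1 - θ s) →
      NotFeeling.cutoffNorm m θ t = ENNReal.ofReal
        (∫ s, |NotFeeling.oneSubDerivSq m (fun r => θ r * Real.exp (-r ^ 2 / (4 * t))) s|) :=
    fun θ hθ hθc => (ofReal_integral_norm_eq_lintegral_enorm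
      (NotFeeling.integrableDerivs_cutoff hθ hθc ht).oneSubDerivSq.1).symm
  -- The infimum is converted by `toReal`, which would send `⊤` to `0`; the constant cutoff `1`
  -- shows that it is finite.
  have hfin : (⨅ ψ ∈ NotFeeling.cutoffs m R, NotFeeling.cutoffNorm m ψ t) ≠ ⊤ := by
    have hone : tsupport (fun _ : ℝ => (1 : ℝ) - 1) = ∅ := by
      rw [tsupport_eq_empty_iff]
      ext
      simp
    have hmem : (fun _ : ℝ => (1 : ℝ)) ∈ NotFeeling.cutoffs m R := by
      refine ⟨contDiff_const, ?_⟩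
      rw [hone]
      exact empty_subset _
    refine ne_top_of_le_ne_top ?_ (iInf₂_le _ hmem)
    rw [hnorm _ contDiff_const (by rw [HasCompactSupport, hone]; exact isCompact_empty)]
    exact ENNReal.ofReal_ne_top
  -- The constant `c` is moved to the left before the infimum is taken, so that no multiplication of
  -- an infimum is needed. Dividing is possible because the Gamma quotient makes `c` strictly
  -- positive.
  have hle : ENNReal.ofReal (‖K x y - NotFeeling.freeHeatKernel N t x y‖ *
      (2 * Real.sqrt (Real.pi * t)) / c) ≤
      ⨅ ψ ∈ NotFeeling.cutoffs m R, NotFeeling.cutoffNorm m ψ t := by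
    refine le_iInf₂ fun θ hθ => ?_
    obtain ⟨hθc, h⟩ := NotFeeling.norm_sub_freeHeatKernel_le_of_mem_cutoffs hU hA hext hm ht hK hG
      hx hy hRtop hθ
    rw [hnorm θ hθ.1 hθc]
    refine ENNReal.ofReal_le_ofReal ?_
    rw [← hc, div_mul_eq_mul_div, le_div_iff₀ hs0] at h
    rwa [div_le_iff₀ hc0]
  have hJ := (ENNReal.ofReal_le_iff_le_toReal hfin).1 hle
  rw [div_le_iff₀ hc0] at hJ
  rw [mul_div_assoc', le_div_iff₀ hs0, mul_comm c]
  exact hJ
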